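/- Let $\mathfrak g$ be a finite-dimensional simple complex Lie algebra with Killing form $(\cdot,\cdot)$, $\mathfrak h\subset\mathfrak g$ a Cartan subalgebra with inclusion $i$, $\Delta$ the set of roots; $(\cdot,\cdot)$ also denotes the induced form on $\mathfrak h^*$, and $\mathfrak g^*\cong\mathfrak g$ is identified by it. Fix root vectors $e_\alpha\in\mathfrak g_\alpha$ with $(e_\alpha,e_{-\alpha})=1$ and an orthonormal basis $h_1,\dots,h_N$ of $\mathfrak h$; put $\Omega=\sum_i h_i\otimes h_i+\sum_{\alpha\in\Delta}e_\alpha\otimes e_{-\alpha}$ and, for $\xi\in\mathfrak g^*$, $\xi_\alpha=\langle\xi,e_{-\alpha}\rangle$; write $p=\sum_i p_ih_i\in\mathfrak h$. Consider one of the following functions $r(q,z)\in\mathfrak g\otimes\mathfrak g$ and $H(q,p,\xi)$ ($q\in\mathfrak h^*$, $z\in\mathbb C$). (I) Rational: $\Delta'\subset\Delta$ is closed under negation and under addition (of roots whose sum is a root), $$r=\frac{\Omega}{z}+\sum_{\alpha\in\Delta'}\frac{1}{(\alpha,q)}e_\alpha\otimes e_{-\alpha},\qquad H=\tfrac12\sum_i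 p_i^2-\tfrac12\sum_{\alpha\in\Delta'}\frac{\xi_\alpha\xi_{-\alpha}}{(\alpha,q)^2}.$$ (II) Trigonometric: $\Delta=\Delta_+\cup\Delta_-$ is a polarization, $\Pi'$ a subset of the simple roots, $\Delta(\Pi')$ the set of roots that are linear combinations of elements of $\Pi'$, $$r=\Bigl(\cot z+\frac z3\Bigr)\sum_i h_i\otimes h_i+\sum_{\alpha\in\Delta}\varphi_\alpha(q,z)\,e^{z(\alpha,q)/3}\,e_\alpha\otimes e_{-\alpha},$$ where $\varphi_\alpha=\frac{\sin((\alpha,q)+z)}{\sin(\alpha,q)\sin z}$ for $\alpha\in\Delta(\Pi')$, $\varphi_\alpha=\frac{e^{-iz}}{\sin z}$ for $\alpha\in\Delta_+\setminus\Delta(\Pi')$, $\varphi_\alpha=\frac{e^{iz}}{\sin z}$ for $\alpha\in\Delta_-\setminus\Delta(\Pi')$, and $$H=\tfrac12\sum_i p_i^2-\tfrac12\sum_{\alpha\in\Delta(\Pi')}\Bigl(\frac1{\sin^2(\alpha,q)}-\frac13\Bigr)\xi_\alpha\xi_{-\alpha}+\tfrac16\sum_{\alpha\in\Delta\setminus\Delta(\Pi')}\xi_\alpha\xi_{-\alpha}.$$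 (III) Elliptic: for a lattice $\Lambda\subset\mathbb C$ with Weierstrass functions $\sigma$, $\zeta=\sigma'/\sigma$, $\wp=-\zeta'$ and $l(u,z)=-\frac{\sigma(u+z)}{\sigma(u)\sigma(z)}$, $$r=\zeta(z)\sum_i h_i\otimes h_i-\sum_{\alpha\in\Delta}l((\alpha,q),z)\,e_\alpha\otimes e_{-\alpha},\qquad H=\tfrac12\sum_i p_i^2-\tfrac12\sum_{\alpha\in\Delta}\wp((\alpha,q))\,\xi_\alpha\xi_{-\alpha}.$$ The phase space is the part of $T^*\mathfrak h^*\times\mathfrak g^*=\mathfrak h^*\times\mathfrak h\times\mathfrak g^*\ni(q,p,\xi)$ where $q$ is regular (respectively: $(\alpha,q)\ne0$ for $\alpha\in\Delta'$; $\sin(\alpha,q)\neq0$ for $\alpha\in\Delta(\Pi')$; $(\alpha,q)\notin\Lambda$ for $\alpha\in\Delta$). It carries the product of the canonical Poisson structure, normalized by $\{p_i,q_j\}=\delta_{ij}$, and the Lie–Poisson structure $\{F,G\}(\xi)=\langle\xi,[dF,dG]\rangle$; the dynamics is $\dot F=\{F,H\}$. Let $r_0>0$ be such that $r(q,\cdot)$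 has no pole in $0<|z|<r_0$. Let $L\mathfrak g^*$ be the space of $\mathfrak g^*$-valued Laurent series with finitely many negative powers that converge in a punctured disc about $0$. Put $L(q,p,\xi)(z)=p+(\mathrm{id}\otimes\xi)(r(q,z))$, $M=L/z$, and, for $X\in L\mathfrak g^*$ and $0<|z|<r_0/2$ inside the disc of convergence of $X$, $$(R_qX)(z)=\mathrm{p.v.}\,\frac1{2\pi i}\oint_{|w|=|z|}(X(w)\otimes\mathrm{id})(r(q,w-z))\,dw .$$ Theorem B. These objects are well defined (the principal values exist, $M$ is a Laurent series as above converging for $0<|z|<r_0$, $H$ is differentiable), and $H=\frac12\oint_{|z|=\rho}(L(z),L(z))\frac{dz}{2\pi i z}$ for $0<\rho<r_0$. Moreover: (1) The Cartan torus (with Lie algebra $\mathfrak h$) acts by Poisson maps $x\cdot(q,p,\xi)=(q,p,\mathrm{Ad}^*_{x^{-1}}\xi)$, $\langle \mathrm{Ad}^*_{x^{-1}}\xi,y\rangle=\langle\xi,\mathrm{Ad}_{x^{-1}}y\rangle$; $H$ is invariant under this action; and $J(q,p,\xi)=i^*\xi\in\mathfrak h^*$ is an equivariant (i.e. invariant)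 momentum map for it: the action of $\exp(sh)$, $h\in\mathfrak h$, is generated by the Hamiltonian $\langle J,h\rangle$. (2) Let $\Sigma$ be the set of points $(q,p,\xi)$ of the phase space at which the derivative $\mathcal X_{i^*\xi}R$ of $q\mapsto R_q$ at $q$ in the direction $i^*\xi$ is zero. Then $\Sigma=J^{-1}(0)$ in cases (II) and (III), and $\Sigma=J^{-1}((\Delta')^\perp)$ in case (I), where $(\Delta')^\perp=\{a\in\mathfrak h^*:(\alpha,a)=0\ \forall\alpha\in\Delta'\}$. (3) $\Sigma$ is invariant under the dynamics: an integral curve on an open interval that meets $\Sigma$ stays in $\Sigma$. At every time at which an integral curve lies in $\Sigma$, $\frac{dL}{dt}(z)=[R_q(M)(z),L(z)]$ for all $0<|z|<r_0/2$. -/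

import Mathlib

open scoped TensorProduct Topology
open Filter LieModule LieAlgebra LieAlgebra.IsKilling

namespace SpinCM

noncomputable section

/-! ### Calculus in finite-dimensional complex vector spaces

A finite-dimensional complex vector space carries a unique Hausdorff vector space topology;
derivatives, limits and integrals are taken in coordinates or tested on linear functionals. -/

section Calculus

variable {V : Type*} [AddCommGroup V] [Module ℂ V] [FiniteDimensional ℂ V]

/-- The exponential of an endomorphism (the exponential of its matrix in a basis). -/
def linExp (A : Module.End ℂ V) : Module.End ℂ V :=
  Matrix.toLin (Module.finBasis ℂ V) (Module.finBasis ℂ V)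
    (NormedSpace.exp (LinearMap.toMatrix (Module.finBasis ℂ V) (Module.finBasis ℂ V) A))

theorem linExp_mul_linExp_neg (A : Module.End ℂ V) : linExp A * linExp (-A) = 1 := by
  have h : NormedSpace.exp
        (LinearMap.toMatrix (Module.finBasis ℂ V) (Module.finBasis ℂ V) A) *
      NormedSpace.exp
        (-LinearMap.toMatrix (Module.finBasis ℂ V) (Module.finBasis ℂ V) A) = 1 := by
    generalize LinearMap.toMatrix (Module.finBasis ℂ V) (Module.finBasis ℂ V) A = N
    have hN : Commute N (-N) := (Commute.refl N).neg_right
    rw [← Matrix.exp_add_of_commute N (-N) hN, add_neg_cancel, NormedSpace.exp_zero]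
  rw [linExp, linExp, map_neg, Module.End.mul_eq_comp, ← Matrix.toLin_mul, h, Matrix.toLin_one]
  rfl

/-- Complex (Fréchet) differentiability of a scalar function. -/
def IsDiffAt (F : V → ℂ) (x : V) : Prop :=
  DifferentiableAt ℂ (fun c => F ((Module.finBasis ℂ V).equivFun.symm c))
    ((Module.finBasis ℂ V).equivFun x)

/-- The differential of a scalar function, as a linear functional. -/
def differential (F : V → ℂ) (x : V) : Module.Dual ℂ V :=
  (fderiv ℂ (fun c => F ((Module.finBasis ℂ V).equivFun.symm c))
      ((Module.finBasis ℂ V).equivFun x)).toLinearMap ∘ₗ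
    (Module.finBasis ℂ V).equivFun.toLinearMap

/-- The curve `γ`, with real (`𝕜 = ℝ`) or complex (`𝕜 = ℂ`) time, has velocity `v` at `t`. -/
def HasVelocityAt {𝕜 : Type*} [NontriviallyNormedField 𝕜] [NormedSpace 𝕜 ℂ]
    (γ : 𝕜 → V) (v : V) (t : 𝕜) : Prop :=
  ∀ l : Module.Dual ℂ V, HasDerivAt (fun s => l (γ s)) (l v) t

/-- The integral `∫ θ in a..b, f θ` of a vector-valued function. -/
def vecIntegral (f : ℝ → V) (a b : ℝ) : V :=
  ∑ i, (∫ θ in a..b, (Module.finBasis ℂ V).coord i (f θ)) • Module.finBasis ℂ V i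

/-- `(2πi)⁻¹ ∫ f(w) dw` over the positively oriented circle about `0` through `z`, with the arc of
angle `ε` on either side of `z` removed. -/
def truncatedCircleIntegral (f : ℂ → V) (z : ℂ) (ε : ℝ) : V :=
  (2 * (Real.pi : ℂ) * Complex.I)⁻¹ •
    vecIntegral (fun θ : ℝ => (Complex.I * (z * Complex.exp (Complex.I * θ))) •
      f (z * Complex.exp (Complex.I * θ))) ε (2 * Real.pi - ε)

/-- `v` is the principal value of `(2πi)⁻¹ ∮ f(w) dw` over the circle about `0` through `z`, the
singularity being at `w = z`. -/
def HasPV (f : ℂ → V) (z : ℂ) (v : V) : Prop :=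
  ∀ l : Module.Dual ℂ V,
    Tendsto (fun ε : ℝ => l (truncatedCircleIntegral f z ε)) (𝓝[>] 0) (𝓝 (l v))

/-- The principal value of `(2πi)⁻¹ ∮ f(w) dw` over the circle about `0` through `z`; meaningful
when `HasPV f z v` holds for some `v`, which is then this vector. -/
def pv (f : ℂ → V) (z : ℂ) : V :=
  ∑ i, limUnder (𝓝[>] (0 : ℝ))
    (fun ε : ℝ => (Module.finBasis ℂ V).coord i (truncatedCircleIntegral f z ε)) •
      Module.finBasis ℂ V i

/-- On `0 < |z| < ρ`, the function `X` is the sum of a convergent Laurent series with finitely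
many negative powers. -/
def IsLoop (X : ℂ → V) (ρ : ℝ) : Prop :=
  ∃ (N : ℕ) (c : ℕ → V), ∀ z : ℂ, 0 < ‖z‖ → ‖z‖ < ρ → ∀ l : Module.Dual ℂ V,
    HasSum (fun n : ℕ => l (c n) * z ^ ((n : ℤ) - (N : ℤ))) (l (X z))

end Calculus

/-! ### Weierstrass functions -/

/-- The Weierstrass `σ`-function of the lattice spanned by the two periods. -/
def sigma (Λ : PeriodPair) (z : ℂ) : ℂ :=
  z * ∏' ω : {ω : Λ.lattice // ω ≠ 0},
    ((1 - z / (ω : ℂ)) * Complex.exp (z / (ω : ℂ) + z ^ 2 / (2 * (ω : ℂ) ^ 2)))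

/-- `ζ = σ' / σ`. -/
def zeta (Λ : PeriodPair) (z : ℂ) : ℂ := deriv (sigma Λ) z / sigma Λ z

/-- `℘ = -ζ'`. -/
def wp (Λ : PeriodPair) (z : ℂ) : ℂ := -deriv (zeta Λ) z

/-- `l(u, z) = -σ(u + z) / (σ(u) σ(z))`. -/
def ell (Λ : PeriodPair) (u z : ℂ) : ℂ := -(sigma Λ (u + z) / (sigma Λ u * sigma Λ z))

variable {𝔤 : Type*} [LieRing 𝔤] [LieAlgebra ℂ 𝔤] [FiniteDimensional ℂ 𝔤]

/-! ### The Poisson phase space `T*𝔥* × 𝔤*` -/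

section Phase

variable (𝔥 : LieSubalgebra ℂ 𝔤)

/-- The phase space `T*𝔥* × 𝔤* = 𝔥* × 𝔥 × 𝔤*`, with points `(q, p, ξ)`. -/
abbrev Phase : Type _ := Module.Dual ℂ 𝔥 × 𝔥 × Module.Dual ℂ 𝔤

variable {𝔥}

/-- `∂F/∂q`, an element of `𝔥 = 𝔥**`. -/
def gradQ (F : Phase 𝔥 → ℂ) (x : Phase 𝔥) : 𝔥 :=
  (Module.evalEquiv ℂ 𝔥).symm
    (differential F x ∘ₗ LinearMap.inl ℂ (Module.Dual ℂ 𝔥) (𝔥 × Module.Dual ℂ 𝔤))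

/-- `∂F/∂p`, an element of `𝔥*`. -/
def gradP (F : Phase 𝔥 → ℂ) (x : Phase 𝔥) : Module.Dual ℂ 𝔥 :=
  differential F x ∘ₗ LinearMap.inr ℂ (Module.Dual ℂ 𝔥) (𝔥 × Module.Dual ℂ 𝔤) ∘ₗ
    LinearMap.inl ℂ 𝔥 (Module.Dual ℂ 𝔤)

/-- `∂F/∂ξ`, an element of `𝔤 = 𝔤**`. -/
def gradXi (F : Phase 𝔥 → ℂ) (x : Phase 𝔥) : 𝔤 :=
  (Module.evalEquiv ℂ 𝔤).symm
    (differential F x ∘ₗ LinearMap.inr ℂ (Module.Dual ℂ 𝔥) (𝔥 × Module.Dual ℂ 𝔤) ∘ₗ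
      LinearMap.inr ℂ 𝔥 (Module.Dual ℂ 𝔤))

/-- The product of the canonical Poisson bracket of the cotangent bundle `T*𝔥*`, normalized by
`{p_i, q_j} = δ_ij`, and of the plus Lie–Poisson bracket `{F, G}(ξ) = ⟨ξ, [dF, dG]⟩` of `𝔤*`. -/
def poisson (F G : Phase 𝔥 → ℂ) (x : Phase 𝔥) : ℂ :=
  gradP F x (gradQ G x) - gradP G x (gradQ F x) + x.2.2 ⁅gradXi F x, gradXi G x⁆

/-- On the set `I` of times, `γ` is an integral curve of the Hamiltonian vector field of `H`:
`dF/dt = {F, H}` along `γ` for all linear coordinates `F`. -/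
def IsTrajectory (H : Phase 𝔥 → ℂ) (γ : ℝ → Phase 𝔥) (I : Set ℝ) : Prop :=
  ∀ t ∈ I, ∀ F : Module.Dual ℂ (Phase 𝔥),
    HasDerivAt (fun s => F (γ s)) (poisson F H (γ t)) t

/-- The Cartan torus: the group of automorphisms of `𝔤` generated by all `exp (ad h)`, `h ∈ 𝔥`
(the image of the Cartan subgroup under the adjoint representation). -/
def cartanTorus (𝔥 : LieSubalgebra ℂ 𝔤) : Subgroup (𝔤 ≃ₗ[ℂ] 𝔤) :=
  Subgroup.closure {x | ∃ h : 𝔥, (x : 𝔤 →ₗ[ℂ] 𝔤) = linExp (LieAlgebra.ad ℂ 𝔤 (h : 𝔤))}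

/-- The exponential map `h ↦ exp (ad h)` from `𝔥` to the torus. -/
def torusExp (h : 𝔥) : cartanTorus 𝔥 :=
  ⟨LinearEquiv.ofLinearMap (linExp (LieAlgebra.ad ℂ 𝔤 (h : 𝔤)))
      (linExp (-LieAlgebra.ad ℂ 𝔤 (h : 𝔤)))
      (linExp_mul_linExp_neg _)
      (by simpa only [neg_neg] using! linExp_mul_linExp_neg (-LieAlgebra.ad ℂ 𝔤 (h : 𝔤))),
    Subgroup.subset_closure ⟨h, rfl⟩⟩

/-- The action `x · (q, p, ξ) = (q, p, Ad*_{x⁻¹} ξ)`, where `⟨Ad*_{x⁻¹} ξ, y⟩ = ⟨ξ, Ad_{x⁻¹} y⟩`. -/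
def act (x : cartanTorus 𝔥) (s : Phase 𝔥) : Phase 𝔥 :=
  (s.1, s.2.1, s.2.2 ∘ₗ ((x⁻¹ : cartanTorus 𝔥) : 𝔤 ≃ₗ[ℂ] 𝔤).toLinearMap)

/-- `J(q, p, ξ) = i*ξ`, the restriction of `ξ` to `𝔥`. -/
def J (s : Phase 𝔥) : Module.Dual ℂ 𝔥 := s.2.2 ∘ₗ 𝔥.toSubmodule.subtype

theorem act_one (s : Phase 𝔥) : act (1 : cartanTorus 𝔥) s = s := by
  simp only [act, inv_one]
  rfl

theorem act_mul (x y : cartanTorus 𝔥) (s : Phase 𝔥) : act (x * y) s = act x (act y s) := by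
  simp only [act, mul_inv_rev]
  rfl

end Phase

/-! ### The canonical dynamical `r`-matrices -/

section Models

variable [LieAlgebra.IsKilling ℂ 𝔤] (𝔥 : LieSubalgebra ℂ 𝔤) [𝔥.IsCartanSubalgebra]

/-- An orthonormal basis `h_i` of `𝔥` and root vectors `e_α` with `(e_α, e_{-α}) = 1`, with respect
to the Killing form. -/
structure CartanWeyl where
  h : Module.Basis (Fin (Module.finrank ℂ 𝔥)) ℂ 𝔥
  h_orthonormal : ∀ i j, killingForm ℂ 𝔤 (h i : 𝔤) (h j : 𝔤) = if i = j then 1 else 0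
  e : Weight ℂ 𝔥 𝔤 → 𝔤
  e_mem : ∀ α ∈ 𝔥.root, e α ∈ rootSpace 𝔥 α
  e_dual : ∀ α ∈ 𝔥.root, killingForm ℂ 𝔤 (e α) (e (-α)) = 1

/-- The three families: rational, given by a set of roots closed under addition and negation;
trigonometric, given by a polarization (a base of the root system) and a subset of the simple
roots; elliptic, given by a pair of periods. -/
inductive Model where
  | rational (Δ' : Finset (Weight ℂ 𝔥 𝔤)) (subset_root : Δ' ⊆ 𝔥.root)
      (neg_mem : ∀ α ∈ Δ', -α ∈ Δ')
      (add_mem : ∀ α ∈ Δ', ∀ β ∈ Δ', ∀ δ ∈ 𝔥.root,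
        Weight.toLinear ℂ 𝔥 𝔤 δ = Weight.toLinear ℂ 𝔥 𝔤 α + Weight.toLinear ℂ 𝔥 𝔤 β → δ ∈ Δ') : Model
  | trigonometric (b : (rootSystem 𝔥).Base) (S : Finset 𝔥.root)
      (subset_support : S ⊆ b.support) : Model
  | elliptic (Λ : PeriodPair) : Model

variable {𝔥}

/-- The form `(α, q)` on `𝔥*` induced by the Killing form. -/
def pair (α : Weight ℂ 𝔥 𝔤) (q : Module.Dual ℂ 𝔥) : ℂ :=
  (Weight.toLinear ℂ 𝔥 𝔤 α) ((cartanEquivDual 𝔥).symm q)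

open Classical in
/-- `Δ(S)`: the roots that are linear combinations of roots from the set `S` of simple roots. -/
def rootsSpannedBy (S : Finset 𝔥.root) : Finset (Weight ℂ 𝔥 𝔤) :=
  {α ∈ 𝔥.root | Weight.toLinear ℂ 𝔥 𝔤 α ∈ Submodule.span ℂ ((rootSystem 𝔥).root '' (S : Set 𝔥.root))}

open Classical in
/-- `Δ₊`: the roots that are sums of simple roots. -/
def posRoots (b : (rootSystem 𝔥).Base) : Finset (Weight ℂ 𝔥 𝔤) :=
  {α ∈ 𝔥.root | Weight.toLinear ℂ 𝔥 𝔤 α ∈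
    AddSubmonoid.closure ((rootSystem 𝔥).root '' (b.support : Set 𝔥.root))}

open Classical in
/-- `Δ₋`: the roots that are not in `Δ₊`. -/
def negRoots (b : (rootSystem 𝔥).Base) : Finset (Weight ℂ 𝔥 𝔤) := 𝔥.root \ posRoots b

namespace CartanWeyl

variable (B : CartanWeyl 𝔥)

/-- `∑ h_i ⊗ h_i`. -/
def cartanTensor : 𝔤 ⊗[ℂ] 𝔤 := ∑ i, (B.h i : 𝔤) ⊗ₜ[ℂ] (B.h i : 𝔤)

/-- `e_α ⊗ e_{-α}`. -/
def rootTensor (α : Weight ℂ 𝔥 𝔤) : 𝔤 ⊗[ℂ] 𝔤 := B.e α ⊗ₜ[ℂ] B.e (-α)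

/-- The Casimir element `Ω`. -/
def casimir : 𝔤 ⊗[ℂ] 𝔤 := B.cartanTensor + ∑ α ∈ 𝔥.root, B.rootTensor α

/-- `½ ∑ p_i²`, where `p = ∑ p_i h_i`. -/
def kinetic (p : 𝔥) : ℂ := 1 / 2 * ∑ i, B.h.repr p i ^ 2

/-- `ξ_α = (ξ, e_{-α})`. -/
def spin (ξ : Module.Dual ℂ 𝔤) (α : Weight ℂ 𝔥 𝔤) : ℂ := ξ (B.e (-α))

end CartanWeyl

namespace Model

open Classical in
/-- The dynamical `r`-matrix `r(q, z)`. -/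
def r (B : CartanWeyl 𝔥) (q : Module.Dual ℂ 𝔥) (z : ℂ) : Model 𝔥 → 𝔤 ⊗[ℂ] 𝔤
  | rational Δ' _ _ _ => z⁻¹ • B.casimir + ∑ α ∈ Δ', (pair α q)⁻¹ • B.rootTensor α
  | trigonometric b S _ =>
      (Complex.cot z + z / 3) • B.cartanTensor
      + ∑ α ∈ rootsSpannedBy S,
          (Complex.sin (pair α q + z) / (Complex.sin (pair α q) * Complex.sin z)
            * Complex.exp (z * pair α q / 3)) • B.rootTensor α
      + ∑ α ∈ posRoots b \ rootsSpannedBy S,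
          (Complex.exp (-(Complex.I * z)) / Complex.sin z
            * Complex.exp (z * pair α q / 3)) • B.rootTensor α
      + ∑ α ∈ negRoots b \ rootsSpannedBy S,
          (Complex.exp (Complex.I * z) / Complex.sin z
            * Complex.exp (z * pair α q / 3)) • B.rootTensor α
  | elliptic Λ =>
      zeta Λ z • B.cartanTensor - ∑ α ∈ 𝔥.root, ell Λ (pair α q) z • B.rootTensor α

open Classical in
/-- The spin Calogero–Moser Hamiltonian `H(q, p, ξ)`. -/
def ham (B : CartanWeyl 𝔥) : Model 𝔥 → Phase 𝔥 → ℂ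
  | rational Δ' _ _ _, (q, p, ξ) =>
      B.kinetic p - 1 / 2 * ∑ α ∈ Δ', B.spin ξ α * B.spin ξ (-α) / pair α q ^ 2
  | trigonometric _ S _, (q, p, ξ) =>
      B.kinetic p
      - 1 / 2 * ∑ α ∈ rootsSpannedBy S,
          (1 / Complex.sin (pair α q) ^ 2 - 1 / 3) * (B.spin ξ α * B.spin ξ (-α))
      + 1 / 6 * ∑ α ∈ 𝔥.root \ rootsSpannedBy S, B.spin ξ α * B.spin ξ (-α)
  | elliptic Λ, (q, p, ξ) =>
      B.kinetic p
      - 1 / 2 * ∑ α ∈ 𝔥.root, wp Λ (pair α q) * (B.spin ξ α * B.spin ξ (-α))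

/-- The points `q ∈ 𝔥*` at which `r(q, z)` is defined. -/
def regular : Model 𝔥 → Set (Module.Dual ℂ 𝔥)
  | rational Δ' _ _ _ => {q | ∀ α ∈ Δ', pair α q ≠ 0}
  | trigonometric _ S _ => {q | ∀ α ∈ rootsSpannedBy S, Complex.sin (pair α q) ≠ 0}
  | elliptic Λ => {q | ∀ α ∈ 𝔥.root, pair α q ∉ Λ.lattice}

/-- The poles of `r(q, z)` in the spectral parameter `z`. -/
def poles : Model 𝔥 → Set ℂ
  | rational _ _ _ _ => {0}
  | trigonometric _ _ _ => {z | Complex.sin z = 0}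
  | elliptic Λ => Λ.lattice

/-- `(Δ')^⊥` in the rational case, `0` in the trigonometric and elliptic cases. -/
def momentumConstraint : Model 𝔥 → Set (Module.Dual ℂ 𝔥)
  | rational Δ' _ _ _ => {a | ∀ α ∈ Δ', pair α a = 0}
  | trigonometric _ _ _ => {0}
  | elliptic _ => {0}

variable (m : Model 𝔥) (B : CartanWeyl 𝔥)

/-- The Lax operator `L(q, p, ξ)(z) = p + (r₋^#(q) ξ)(z)`: the second leg of `r(q, z)` is paired
with `ξ`. -/
def lax (x : Phase 𝔥) (z : ℂ) : 𝔤 :=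
  (x.2.1 : 𝔤) + TensorProduct.rid ℂ 𝔤 (LinearMap.lTensor 𝔤 x.2.2 (m.r B x.1 z))

/-- `M(q, p, ξ)(z) = L(q, p, ξ)(z) / z`, as a loop in `𝔤* ≅ 𝔤` (by the Killing form). -/
def laxM (x : Phase 𝔥) (z : ℂ) : Module.Dual ℂ 𝔤 := killingForm ℂ 𝔤 (z⁻¹ • m.lax B x z)

/-- `(r(q, w - z), X(w) ⊗ 1)`: the first leg of `r(q, w - z)` is paired with `X(w)`. -/
def kernelR (q : Module.Dual ℂ 𝔥) (X : ℂ → Module.Dual ℂ 𝔤) (z w : ℂ) : 𝔤 :=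
  TensorProduct.lid ℂ 𝔤 (LinearMap.rTensor 𝔤 (X w) (m.r B q (w - z)))

/-- The operator `R_q`:
`(R_q X)(z) = p.v. (2πi)⁻¹ ∮_{|w| = |z|} (r(q, w - z), X(w) ⊗ 1) dw`. -/
def R (q : Module.Dual ℂ 𝔥) (X : ℂ → Module.Dual ℂ 𝔤) (z : ℂ) : 𝔤 :=
  pv (m.kernelR B q X z) z

/-- The regular part of the phase space. -/
def phaseSpace : Set (Phase 𝔥) := {x | x.1 ∈ m.regular}

/-- The set `Σ` defined by `𝒳_{i*ξ} R = 0`: the derivative of `q ↦ R_q X` at `q` in the direction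
`i*ξ` vanishes for every loop `X`, as a function of `z` with `0 < |z| < r₀ / 2` (and `|z|` less than
the radius of convergence of `X`). -/
def sigmaSet (r₀ : ℝ) : Set (Phase 𝔥) :=
  {x | x ∈ m.phaseSpace ∧ ∀ (ρ : ℝ) (X : ℂ → Module.Dual ℂ 𝔤), IsLoop X ρ →
    ∀ z : ℂ, 0 < ‖z‖ → ‖z‖ < ρ → ‖z‖ < r₀ / 2 →
      HasVelocityAt (fun s : ℂ => m.R B (x.1 + s • J x) X z) 0 0}

end Model

end Models

end

end SpinCM

/-! The three families have one shape, r = a(z) Σ h_i ⊗ h_i + Σ φ_α((α,q), z) e_α ⊗ e_{-α}, and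
everything used about the coefficients is listed in `Profile.IsCanonical`. Apart from parity and
simple poles of residue one at z = 0, there are three relations. With c_α(u) the constant term of
φ_α(u, ·) and V_α the potential, they are: (i) ∂_u φ_α = ∂_z φ_α + (a − c_α) φ_α; (ii) φ_α(u,z)
φ_{-α}(-u,z) = −a'(z) − V_α(u); (iii) an addition theorem relating φ_α, φ_γ and φ_{α+γ}, whose
degenerate case γ = −α is the u-derivative of (ii).

The kernel r(q, w − z) has its pole on the contour, so the principal value for M = L/z is the
residue at w = 0 plus half the residue at w = z (`HasSimplePole.hasScalarPV`). The half residue is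
L/(2z), which commutes with L; the rest is the explicit `laxPartner`. Along the flow q' = −p and ξ'
= [∂H/∂ξ, ξ]. When L' is compared with the commutator (`lax_identity`), the terms with α(p) match by
(i), and the root–root terms by (ii) and (iii) after symmetrization in the two roots
(`quadTerm_add_swap`). The remaining mismatch carries the factor (α, i*ξ). On Σ this factor is zero
in cases (II) and (III); in case (I) it is zero for α in Δ', and for the other roots φ_α = 1/z and
the cofactor is zero.

H is half the constant term of (L, L), by (ii) and because a(z) = 1/z + O(z²). The set Σ is found by
applying R_q to the loops w⁻¹ (e_{-α}, ·), which isolate φ_α((α,q), −z): the derivative can vanish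
only if ∂_u φ_α · (α, i*ξ) = 0 for all small z, and ∂_u φ_α does not vanish identically in z, except
for roots outside Δ' in case (I). Conversely, r itself is constant in the constraint directions.
Since H depends on ξ only through the torus-invariant products ξ_α ξ_{-α}, J is conserved and Σ is
invariant.

It remains to verify the relations. In the rational case they are identities between reciprocals. In
the trigonometric case φ_α = (cot z + C_α(u)) e^{zu/3} with C_α one of cot u, i, −i, and (iii) is
the addition formula of the cotangent together with C_α² = −1 outside Δ(Π'). In the elliptic case
φ(u,z) = σ(u+z)/(σ(u)σ(z)); (ii) is the formula for σ(a+b)σ(a−b), proved by Liouville's theorem, and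
(iii) is a derivative of the three-term identity of σ. -/

namespace SpinCM

noncomputable section

/-! ### The Weierstrass functions -/

section Weierstrass

/-- The elementary factor `(1 - t) exp (t + t² / 2)`. -/
def primaryFactor (t : ℂ) : ℂ := (1 - t) * Complex.exp (t + t ^ 2 / 2)

theorem hasDerivAt_primaryFactor (t : ℂ) :
    HasDerivAt primaryFactor (-t ^ 2 * Complex.exp (t + t ^ 2 / 2)) t := by
  have h1 : HasDerivAt (fun t : ℂ => t + t ^ 2 / 2) (1 + t) t := by
    have := (hasDerivAt_id t).add (((hasDerivAt_id t).pow 2).div_const 2)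
    refine this.congr_deriv ?_
    simp
  have h2 : HasDerivAt (fun t : ℂ => 1 - t) (-1) t := by
    simpa using (hasDerivAt_id t).const_sub 1
  exact (h2.mul h1.cexp).congr_deriv (by ring)

theorem primaryFactor_zero : primaryFactor 0 = 1 := by simp [primaryFactor]

theorem primaryFactor_ne_zero {t : ℂ} (ht : t ≠ 1) : primaryFactor t ≠ 0 :=
  mul_ne_zero (sub_ne_zero.2 ht.symm) (Complex.exp_ne_zero _)

/-- The derivative is −t² times an exponential bounded by exp 2 on the unit disc, so the mean value
inequality gives a cubic bound. With the convergence of Σ |l|⁻³ over the lattice this makes the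
product for σ converge. -/
theorem norm_primaryFactor_sub_one_le {t : ℂ} (ht : ‖t‖ ≤ 1) :
    ‖primaryFactor t - 1‖ ≤ Real.exp 2 * ‖t‖ ^ 3 := by
  have h := (convex_closedBall (0 : ℂ) ‖t‖).norm_image_sub_le_of_norm_hasDerivWithin_le
    (f := primaryFactor) (f' := fun s => -s ^ 2 * Complex.exp (s + s ^ 2 / 2))
    (C := Real.exp 2 * ‖t‖ ^ 2) (x := 0) (y := t)
    (fun s _ => (hasDerivAt_primaryFactor s).hasDerivWithinAt) (fun s hs => ?_) (by simp) (by simp)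
  · rw [primaryFactor_zero, sub_zero] at h
    exact h.trans_eq (by ring)
  · have hs' : ‖s‖ ≤ ‖t‖ := by simpa using hs
    rw [norm_mul, norm_neg, norm_pow, mul_comm]
    gcongr
    rw [Complex.norm_exp]
    gcongr
    refine (Complex.re_le_norm _).trans ((norm_add_le _ _).trans ?_)
    rw [norm_div, norm_pow, Complex.norm_ofNat]
    nlinarith [norm_nonneg s]

variable (Λ : PeriodPair)

/-- `σ(z) / z`, an entire function. -/
def sigmaQuot (z : ℂ) : ℂ := ∏' l : Λ.lattice, primaryFactor (z / (l : ℂ))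

/-- The lattice point 0 may be included in the product: z / 0 = 0, and the factor there is 1. -/
theorem sigma_eq (z : ℂ) : sigma Λ z = z * sigmaQuot Λ z := by
  rw [sigma, sigmaQuot]
  congr 1
  rw [← tprod_subtype_eq_of_mulSupport_subset (s := {l : Λ.lattice | l ≠ 0})]
  · refine tprod_congr fun l => ?_
    simp only [primaryFactor, div_pow]
    congr 3
    field_simp
  · intro l hl (h0 : l = 0)
    exact hl (by simp [h0, primaryFactor_zero])

theorem summable_lattice_norm_pow_three : Summable fun l : Λ.lattice => (‖(l : ℂ)‖ ^ 3)⁻¹ := by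
  have := ZLattice.summable_norm_rpow Λ.lattice (-3) (by simp; norm_num)
  refine this.congr fun l => ?_
  rw [Real.rpow_neg (norm_nonneg _)]
  norm_cast

theorem eventually_le_norm_lattice (R : ℝ) : ∀ᶠ l : Λ.lattice in cofinite, R ≤ ‖(l : ℂ)‖ := by
  refine (isCompact_iff_finite.mp (isCompact_closedBall (0 : Λ.lattice) R)).subset ?_
  intro l hl
  simp only [Set.mem_compl_iff, Set.mem_ofPred_eq, not_le] at hl
  simpa using hl.le

theorem eventually_norm_primaryFactor_sub_one_le (r : ℝ) (hr : 0 < r) :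
    ∀ᶠ l : Λ.lattice in cofinite, ∀ z : ℂ, ‖z‖ ≤ r →
      ‖primaryFactor (z / (l : ℂ)) - 1‖ ≤ Real.exp 2 * r ^ 3 * (‖(l : ℂ)‖ ^ 3)⁻¹ := by
  filter_upwards [eventually_le_norm_lattice Λ r] with l hl z hz
  have hl0 : 0 < ‖(l : ℂ)‖ := hr.trans_le hl
  have h1 : ‖z / (l : ℂ)‖ ≤ r / ‖(l : ℂ)‖ := by rw [norm_div]; gcongr
  have h2 : r / ‖(l : ℂ)‖ ≤ 1 := (div_le_one hl0).2 hl
  refine (norm_primaryFactor_sub_one_le (h1.trans h2)).trans ?_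
  rw [mul_assoc, ← div_eq_mul_inv, ← div_pow]
  gcongr

theorem differentiable_primaryFactor_div (l : ℂ) :
    Differentiable ℂ fun z : ℂ => primaryFactor (z / l) := by
  unfold primaryFactor
  fun_prop

theorem hasProdLocallyUniformlyOn_sigmaQuot :
    HasProdLocallyUniformlyOn (fun (l : Λ.lattice) (z : ℂ) => primaryFactor (z / (l : ℂ)))
      (sigmaQuot Λ) Set.univ := by
  refine hasProdLocallyUniformlyOn_of_forall_compact isOpen_univ fun K _ hK => ?_
  obtain ⟨r, hr, hKr⟩ := hK.isBounded.exists_pos_norm_le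
  have := ((summable_lattice_norm_pow_three Λ).mul_left
    (Real.exp 2 * r ^ 3)).hasProdUniformlyOn_one_add (K := K)
    (f := fun (l : Λ.lattice) (z : ℂ) => primaryFactor (z / (l : ℂ)) - 1) hK ?_ fun l =>
      ((differentiable_primaryFactor_div (l : ℂ)).continuous.continuousOn.sub continuousOn_const)
  · simp only [add_sub_cancel] at this
    exact this
  · filter_upwards [eventually_norm_primaryFactor_sub_one_le Λ r hr] with l hl z hz
    exact hl z (hKr z hz)

theorem differentiable_sigmaQuot : Differentiable ℂ (sigmaQuot Λ) := by
  rw [← differentiableOn_univ]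
  refine (hasProdLocallyUniformlyOn_sigmaQuot Λ).differentiableOn (.of_forall fun s => ?_)
    isOpen_univ
  simpa [Finset.prod_fn] using DifferentiableOn.finsetProd
    (fun _ _ => (differentiable_primaryFactor_div _).differentiableOn)

theorem sigmaQuot_zero : sigmaQuot Λ 0 = 1 := by
  simp [sigmaQuot, primaryFactor_zero]

theorem sigmaQuot_neg (z : ℂ) : sigmaQuot Λ (-z) = sigmaQuot Λ z := by
  rw [sigmaQuot, sigmaQuot, ← (Equiv.neg Λ.lattice).tprod_eq]
  simp [neg_div_neg_eq]

/-- An absolutely convergent product vanishes only if one of its factors does, and the factor of l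
vanishes only at z = l. The point z = 0 is allowed, unlike for σ. -/
theorem sigmaQuot_ne_zero {z : ℂ} (hz : z ∈ ((Λ.lattice : Set ℂ) \ {0})ᶜ) : sigmaQuot Λ z ≠ 0 := by
  have h := tprod_one_add_ne_zero_of_summable
    (f := fun l : Λ.lattice => primaryFactor (z / (l : ℂ)) - 1) (fun l => ?_) ?_
  · simp only [add_sub_cancel] at h
    exact h
  · rw [add_sub_cancel]
    refine primaryFactor_ne_zero fun h => hz ?_
    have hl : (l : ℂ) ≠ 0 := by
      intro h0
      simp [h0] at h
    have : z = l := by field_simp at h; exact h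
    exact ⟨this ▸ l.2, this ▸ hl⟩
  · refine Summable.of_norm_bounded_eventually
      ((summable_lattice_norm_pow_three Λ).mul_left (Real.exp 2 * (‖z‖ + 1) ^ 3)) ?_
    filter_upwards [eventually_norm_primaryFactor_sub_one_le Λ (‖z‖ + 1) (by positivity)] with l hl
    simpa using hl z (by linarith)

/-- The summand of the logarithmic derivative of `sigmaQuot`. -/
def zetaSummand (l : Λ.lattice) (z : ℂ) : ℂ :=
  if (l : ℂ) = 0 then 0 else 1 / (z - l) + 1 / l + z / l ^ 2

/-- The three terms combine to z² / ((z − l) l²), which is at most 2 r² / |l|³ on |z| = r once |l| ≥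
2r. -/
theorem hasSumLocallyUniformly_zetaSummand :
    HasSumLocallyUniformly (zetaSummand Λ) (∑' l, zetaSummand Λ l ·) := by
  refine Λ.hasSumLocallyUniformly_aux (u := fun r l => 2 * r ^ 2 * (‖(l : ℂ)‖ ^ 3)⁻¹) _
    (fun _ _ => (summable_lattice_norm_pow_three Λ).mul_left _) fun r hr =>
    eventually_atTop.mpr ⟨2 * r, ?_⟩
  rintro _ h s hs l rfl
  rw [zetaSummand]
  split_ifs with h0
  · simp [h0]
  have hl0 : 0 < ‖(l : ℂ)‖ := by linarith
  have hd : ‖(l : ℂ)‖ / 2 ≤ ‖s - l‖ := by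
    rw [norm_sub_rev]
    exact le_trans (by linarith) (norm_sub_norm_le (l : ℂ) s)
  have hne : s - l ≠ 0 := norm_pos_iff.1 (by linarith)
  have : 1 / (s - l) + 1 / (l : ℂ) + s / (l : ℂ) ^ 2 = s ^ 2 / ((s - l) * l ^ 2) := by
    field_simp
    ring
  rw [this, norm_div, norm_mul, norm_pow, norm_pow]
  calc ‖s‖ ^ 2 / (‖s - l‖ * ‖(l : ℂ)‖ ^ 2) ≤ r ^ 2 / (‖(l : ℂ)‖ / 2 * ‖(l : ℂ)‖ ^ 2) := by gcongr
    _ = _ := by field_simp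

theorem hasDerivAt_zetaSummand (l : Λ.lattice) {z : ℂ} (hz : z ∈ ((Λ.lattice : Set ℂ) \ {0})ᶜ) :
    HasDerivAt (zetaSummand Λ l)
      (-(if (l : ℂ) = 0 then 0 else (1 / (z - l) ^ 2 - 1 / l ^ 2))) z := by
  unfold zetaSummand
  split_ifs with h0
  · simpa using hasDerivAt_const z (0 : ℂ)
  have hne : z - l ≠ 0 := by
    intro h
    rw [sub_eq_zero] at h
    exact hz ⟨h ▸ l.2, h ▸ h0⟩
  have h1 : HasDerivAt (fun z : ℂ => z - l) 1 z := (hasDerivAt_id z).sub_const _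
  have h2 := ((h1.inv hne).add_const (1 / (l : ℂ))).add
    ((hasDerivAt_id z).div_const ((l : ℂ) ^ 2))
  refine HasDerivAt.congr_deriv (f := _) (h2.congr_of_eventuallyEq (.of_forall fun w => ?_)) ?_
  · simp
  · field_simp
    ring

/-- Locally uniform convergence allows termwise differentiation; the derivatives are minus the terms
of ℘ with the double pole at 0 left out. -/
theorem hasDerivAt_tsum_zetaSummand {z : ℂ} (hz : z ∈ ((Λ.lattice : Set ℂ) \ {0})ᶜ) :
    HasDerivAt (∑' l, zetaSummand Λ l ·) (-Λ.weierstrassPExcept 0 z) z := by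
  have hs := (hasSumLocallyUniformly_zetaSummand Λ).hasSumLocallyUniformlyOn (s :=
    ((Λ.lattice : Set ℂ) \ {0})ᶜ)
  have hd : DifferentiableOn ℂ (∑' l, zetaSummand Λ l ·) ((Λ.lattice : Set ℂ) \ {0})ᶜ :=
    hs.differentiableOn (.of_forall fun s => .fun_sum fun l _ w hw =>
      (hasDerivAt_zetaSummand Λ l hw).differentiableAt.differentiableWithinAt)
      Λ.isOpen_compl_lattice_sdiff
  have h1 := TendstoLocallyUniformlyOn.deriv
    (hasSumLocallyUniformlyOn_iff_tendstoLocallyUniformlyOn.1 hs) (.of_forall fun s => .fun_sum fun l _ w hw =>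
      (hasDerivAt_zetaSummand Λ l hw).differentiableAt.differentiableWithinAt)
      Λ.isOpen_compl_lattice_sdiff
  have h2 := h1.tendsto_at hz
  have h3 := (Λ.hasSum_weierstrassPExcept 0 z).neg
  have h4 : deriv (∑' l, zetaSummand Λ l ·) z = -Λ.weierstrassPExcept 0 z := by
    refine tendsto_nhds_unique h2 (h3.congr fun s => ?_)
    simp only [Function.comp_apply]
    rw [deriv_fun_sum fun l _ => (hasDerivAt_zetaSummand Λ l hz).differentiableAt]
    exact Finset.sum_congr rfl fun l _ => (hasDerivAt_zetaSummand Λ l hz).deriv.symm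
  rw [← h4]
  exact (hd.differentiableAt (Λ.isOpen_compl_lattice_sdiff.mem_nhds hz)).hasDerivAt

theorem logDeriv_primaryFactor_div (l : Λ.lattice) {z : ℂ}
    (hz : z ∈ ((Λ.lattice : Set ℂ) \ {0})ᶜ) :
    logDeriv (fun z : ℂ => primaryFactor (z / l)) z = zetaSummand Λ l z := by
  rw [zetaSummand]
  split_ifs with h0
  · simp [h0, logDeriv]
  have hne : z - l ≠ 0 := by
    intro h
    rw [sub_eq_zero] at h
    exact hz ⟨h ▸ l.2, h ▸ h0⟩
  have hd := HasDerivAt.comp z (h₂ := primaryFactor) (hasDerivAt_primaryFactor (z / l))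
    ((hasDerivAt_id' z).div_const (l : ℂ))
  rw [Function.comp_def] at hd
  have hne' : 1 - z / (l : ℂ) ≠ 0 := by
    rw [one_sub_div h0]
    exact div_ne_zero (by rwa [← neg_sub, neg_ne_zero]) h0
  have hne2 : (l : ℂ) - z ≠ 0 := by rwa [← neg_sub, neg_ne_zero]
  rw [logDeriv_apply, hd.deriv, primaryFactor]
  have := Complex.exp_ne_zero (z / l + (z / l) ^ 2 / 2)
  rw [mul_comm (1 - z / (l : ℂ)), div_eq_iff (mul_ne_zero this hne')]
  generalize Complex.exp (z / l + (z / l) ^ 2 / 2) = E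
  field_simp
  ring

theorem logDeriv_sigmaQuot {z : ℂ} (hz : z ∈ ((Λ.lattice : Set ℂ) \ {0})ᶜ) :
    logDeriv (sigmaQuot Λ) z = ∑' l, zetaSummand Λ l z := by
  have h := logDeriv_tprod_eq_tsum isOpen_univ (Set.mem_univ z)
    (f := fun (l : Λ.lattice) (z : ℂ) => primaryFactor (z / (l : ℂ))) (fun l => ?_)
    (fun l => (differentiable_primaryFactor_div (l : ℂ)).differentiableOn) ?_
    (hasProdLocallyUniformlyOn_sigmaQuot Λ).multipliableLocallyUniformlyOn
    (sigmaQuot_ne_zero Λ hz)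
  · refine Eq.trans h (tsum_congr fun l => logDeriv_primaryFactor_div Λ l hz)
  · refine primaryFactor_ne_zero fun h => hz ?_
    have hl : (l : ℂ) ≠ 0 := by
      intro h0
      simp [h0] at h
    have : z = l := by field_simp at h; exact h
    exact ⟨this ▸ l.2, this ▸ hl⟩
  · exact ((hasSumLocallyUniformly_zetaSummand Λ).hasSum (x := z)).summable.congr fun l =>
      (logDeriv_primaryFactor_div Λ l hz).symm

theorem hasDerivAt_logDeriv_sigmaQuot {z : ℂ} (hz : z ∈ ((Λ.lattice : Set ℂ) \ {0})ᶜ) :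
    HasDerivAt (logDeriv (sigmaQuot Λ)) (-Λ.weierstrassPExcept 0 z) z := by
  refine (hasDerivAt_tsum_zetaSummand Λ hz).congr_of_eventuallyEq ?_
  filter_upwards [Λ.isOpen_compl_lattice_sdiff.mem_nhds hz] with w hw
  exact logDeriv_sigmaQuot Λ hw

theorem logDeriv_sigmaQuot_zero : logDeriv (sigmaQuot Λ) 0 = 0 := by
  rw [logDeriv_sigmaQuot Λ (by simp)]
  refine (tsum_congr fun l => ?_).trans tsum_zero
  rw [zetaSummand]
  split_ifs <;> simp

theorem differentiable_sigma : Differentiable ℂ (sigma Λ) := by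
  rw [funext (sigma_eq Λ)]
  exact differentiable_id.mul (differentiable_sigmaQuot Λ)

theorem sigma_neg (z : ℂ) : sigma Λ (-z) = -sigma Λ z := by
  rw [sigma_eq, sigma_eq, sigmaQuot_neg, neg_mul]

theorem sigma_zero : sigma Λ 0 = 0 := by simp [sigma_eq]

theorem compl_lattice_subset : (Λ.lattice : Set ℂ)ᶜ ⊆ ((Λ.lattice : Set ℂ) \ {0})ᶜ :=
  Set.compl_subset_compl.2 Set.sdiff_subset

theorem ne_zero_of_notMem_lattice {z : ℂ} (hz : z ∉ Λ.lattice) : z ≠ 0 :=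
  fun h => hz (h ▸ Λ.lattice.zero_mem)

theorem sigma_ne_zero {z : ℂ} (hz : z ∉ Λ.lattice) : sigma Λ z ≠ 0 := by
  rw [sigma_eq]
  exact mul_ne_zero (ne_zero_of_notMem_lattice Λ hz)
    (sigmaQuot_ne_zero Λ (compl_lattice_subset Λ hz))

theorem zeta_eq {z : ℂ} (hz : z ∉ Λ.lattice) : zeta Λ z = 1 / z + logDeriv (sigmaQuot Λ) z := by
  have h := logDeriv_mul (f := fun z : ℂ => z) z (ne_zero_of_notMem_lattice Λ hz)
    (sigmaQuot_ne_zero Λ (compl_lattice_subset Λ hz)) differentiableAt_id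
    (differentiable_sigmaQuot Λ z)
  rw [zeta, ← logDeriv_apply, funext (sigma_eq Λ), h]
  simp [logDeriv_apply]

theorem hasDerivAt_zeta_weierstrassP {z : ℂ} (hz : z ∉ Λ.lattice) :
    HasDerivAt (zeta Λ) (-Λ.weierstrassP z) z := by
  have hz0 := ne_zero_of_notMem_lattice Λ hz
  have h := (hasDerivAt_inv hz0).add
    (hasDerivAt_logDeriv_sigmaQuot Λ (compl_lattice_subset Λ hz))
  refine (h.congr_of_eventuallyEq ?_).congr_deriv ?_
  · filter_upwards [Λ.isClosed_lattice.isOpen_compl.mem_nhds hz] with w hw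
    simp [zeta_eq Λ hw]
  · rw [← Λ.weierstrassPExcept_add 0 z]
    simp

theorem wp_eq {z : ℂ} (hz : z ∉ Λ.lattice) : wp Λ z = Λ.weierstrassP z := by
  rw [wp, (hasDerivAt_zeta_weierstrassP Λ hz).deriv, neg_neg]

theorem hasDerivAt_zeta {z : ℂ} (hz : z ∉ Λ.lattice) : HasDerivAt (zeta Λ) (-wp Λ z) z := by
  rw [wp_eq Λ hz]
  exact hasDerivAt_zeta_weierstrassP Λ hz

theorem hasDerivAt_sigma {z : ℂ} (hz : z ∉ Λ.lattice) :
    HasDerivAt (sigma Λ) (zeta Λ z * sigma Λ z) z := by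
  rw [zeta, div_mul_cancel₀ _ (sigma_ne_zero Λ hz)]
  exact (differentiable_sigma Λ z).hasDerivAt

end Weierstrass

/-! ### Quasi-periodicity and addition formulas of σ -/

section WeierstrassIdentities

variable (Λ : PeriodPair)

theorem countable_lattice : (Λ.lattice : Set ℂ).Countable :=
  Set.countable_coe_iff.1 (Λ.latticeEquivProd.toEquiv.countable_iff.2 inferInstance)

theorem isPreconnected_compl_lattice : IsPreconnected (Λ.lattice : Set ℂ)ᶜ :=
  ((countable_lattice Λ).isPathConnected_compl_of_one_lt_rank
    (by rw [Complex.rank_real_complex]; norm_num)).isConnected.isPreconnected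

theorem dense_compl_lattice : Dense (Λ.lattice : Set ℂ)ᶜ := (countable_lattice Λ).dense_compl ℝ

theorem isOpen_compl_lattice : IsOpen (Λ.lattice : Set ℂ)ᶜ := Λ.isClosed_lattice.isOpen_compl

theorem add_mem_lattice_iff {z : ℂ} (l : Λ.lattice) : z + l ∈ Λ.lattice ↔ z ∈ Λ.lattice :=
  Λ.lattice.toAddSubgroup.add_mem_cancel_right (y := z) l.2

/-- The difference has derivative zero because ℘ is periodic, and the complement of the countable
lattice is connected. -/
theorem exists_zeta_add (l : Λ.lattice) :
    ∃ η : ℂ, ∀ z ∉ Λ.lattice, zeta Λ (z + l) = zeta Λ z + η := by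
  have hd : ∀ z ∈ (Λ.lattice : Set ℂ)ᶜ, HasDerivAt (fun z => zeta Λ (z + l) - zeta Λ z) 0 z := by
    intro z hz
    have hz' : z + l ∉ Λ.lattice := fun h => hz ((add_mem_lattice_iff Λ l).1 h)
    have := ((hasDerivAt_zeta_weierstrassP Λ hz').comp_add_const z (l : ℂ)).sub
      (hasDerivAt_zeta_weierstrassP Λ hz)
    exact this.congr_deriv (by rw [Λ.weierstrassP_add_coe]; ring)
  obtain ⟨η, hη⟩ := (isOpen_compl_lattice Λ).exists_is_const_of_deriv_eq_zero
    (isPreconnected_compl_lattice Λ)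
    (fun z hz => (hd z hz).differentiableAt.differentiableWithinAt) (fun z hz => (hd z hz).deriv)
  exact ⟨η, fun z hz => by rw [← hη z hz]; ring⟩

/-- This integrates the quasi-periodicity of ζ: the quotient σ(z + l) e^{−ηz} / σ(z) has derivative
zero off the lattice. Continuity and density extend the formula to lattice points. -/
theorem exists_sigma_add (l : Λ.lattice) :
    ∃ C η : ℂ, C ≠ 0 ∧ ∀ z, sigma Λ (z + l) = C * Complex.exp (η * z) * sigma Λ z := by
  obtain ⟨η, hη⟩ := exists_zeta_add Λ l
  have hd : ∀ z ∈ (Λ.lattice : Set ℂ)ᶜ,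
      HasDerivAt (fun z => sigma Λ (z + l) * Complex.exp (-(η * z)) / sigma Λ z) 0 z := by
    intro z hz
    have hz' : z + l ∉ Λ.lattice := fun h => hz ((add_mem_lattice_iff Λ l).1 h)
    have h1 := (hasDerivAt_sigma Λ hz').comp_add_const z (l : ℂ)
    have h2 : HasDerivAt (fun z : ℂ => Complex.exp (-(η * z))) (Complex.exp (-(η * z)) * -η) z := by
      simpa using ((hasDerivAt_id' z).const_mul η).neg.cexp
    refine ((h1.mul h2).div (hasDerivAt_sigma Λ hz) (sigma_ne_zero Λ hz)).congr_deriv ?_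
    rw [hη z hz, div_eq_zero_iff]
    left
    simp only [Pi.mul_apply]
    ring
  obtain ⟨C, hC⟩ := (isOpen_compl_lattice Λ).exists_is_const_of_deriv_eq_zero
    (isPreconnected_compl_lattice Λ)
    (fun z hz => (hd z hz).differentiableAt.differentiableWithinAt) (fun z hz => (hd z hz).deriv)
  have hC' : ∀ z ∈ (Λ.lattice : Set ℂ)ᶜ,
      sigma Λ (z + l) = C * Complex.exp (η * z) * sigma Λ z := by
    intro z hz
    rw [← hC z hz]
    have := sigma_ne_zero Λ hz
    field_simp
    rw [mul_assoc, ← Complex.exp_add]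
    simp
  refine ⟨C, η, ?_, fun z => ?_⟩
  · rintro rfl
    obtain ⟨z, hz⟩ := (dense_compl_lattice Λ).nonempty
    have hz' : z + l ∉ Λ.lattice := fun h => hz ((add_mem_lattice_iff Λ l).1 h)
    exact sigma_ne_zero Λ hz' (by rw [hC' z hz]; ring)
  · have hσ := (differentiable_sigma Λ).continuous
    exact congrFun (Continuous.ext_on (dense_compl_lattice Λ)
      (f := fun z => sigma Λ (z + l)) (g := fun z => C * Complex.exp (η * z) * sigma Λ z)
      (by fun_prop) (by fun_prop) hC') z

/-- An even function, analytic near `0` and vanishing there, is divisible by `z²`. -/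
theorem exists_analyticAt_eq_sq_mul {N : ℂ → ℂ} (hN : AnalyticAt ℂ N 0) (h0 : N 0 = 0)
    (heven : ∀ z, N (-z) = N z) :
    ∃ M : ℂ → ℂ, AnalyticAt ℂ M 0 ∧ ∀ z ≠ 0, M z = N z / z ^ 2 := by
  have hd : deriv N 0 = 0 := by
    have h := deriv_comp_neg N 0
    rw [funext heven, neg_zero] at h
    exact self_eq_neg.1 h
  obtain ⟨p, hp⟩ := hN
  refine ⟨dslope (dslope N 0) 0, ⟨_, hp.has_fpower_series_dslope_fslope.has_fpower_series_dslope_fslope⟩,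
    fun z hz => ?_⟩
  rw [dslope_of_ne _ hz, slope_def_field, dslope_of_ne _ hz, slope_def_field, dslope_same, hd, h0]
  field_simp
  ring

/-- For fixed b, the function σ(a+b)σ(a−b)/(σ(a)²σ(b)²) + ℘(a) is elliptic in a, and its double
poles cancel. By Liouville's theorem it is constant, and at a = b it equals ℘(b). -/
theorem sigma_add_mul_sigma_sub {a b : ℂ} (ha : a ∉ Λ.lattice) (hb : b ∉ Λ.lattice) :
    sigma Λ (a + b) * sigma Λ (a - b) =
      sigma Λ a ^ 2 * sigma Λ b ^ 2 * (Λ.weierstrassP b - Λ.weierstrassP a) := by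
  have hb0 := sigma_ne_zero Λ hb
  have hσ := differentiable_sigma Λ
  have hS := differentiable_sigmaQuot Λ
  set F : ℂ → ℂ := fun a => sigma Λ (a + b) * sigma Λ (a - b) / (sigma Λ a ^ 2 * sigma Λ b ^ 2) +
    Λ.weierstrassP a - Λ.weierstrassP b with hF
  -- N(a) is 1 plus a² times the quotient. It is even and vanishes at 0, so N(a)/a² is analytic; the
  -- added 1 accounts for the pole a⁻² of ℘.
  obtain ⟨M, hM, hM'⟩ := exists_analyticAt_eq_sq_mul
    (N := fun a => sigma Λ (a + b) * sigma Λ (a - b) / (sigmaQuot Λ a ^ 2 * sigma Λ b ^ 2) + 1)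
    (by
      refine AnalyticAt.add (AnalyticAt.div ?_ ?_ ?_) analyticAt_const
      · exact Differentiable.analyticAt (by fun_prop) 0
      · exact Differentiable.analyticAt (by fun_prop) 0
      · simp [sigmaQuot_zero, hb0])
    (by
      simp only [zero_add, zero_sub, sigma_neg, sigmaQuot_zero]
      field_simp
      ring)
    (fun z => by
      rw [show -z + b = -(z - b) by ring, show -z - b = -(z + b) by ring, sigma_neg, sigma_neg,
        sigmaQuot_neg]
      ring)
  -- The limit of F at the removable singularity 0, hence by periodicity at every lattice point.
  set v : ℂ := M 0 + Λ.weierstrassPExcept 0 0 - Λ.weierstrassP b with hv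
  classical
  set G : ℂ → ℂ := fun a => if a ∈ Λ.lattice then v else F a with hG
  have hGper : ∀ (z : ℂ) (l : Λ.lattice), G (z + l) = G z := by
    intro z l
    simp only [hG, add_mem_lattice_iff]
    split_ifs with hz
    · rfl
    obtain ⟨C, η, hC, hl⟩ := exists_sigma_add Λ l
    have hz0 := sigma_ne_zero Λ hz
    simp only [hF, Λ.weierstrassP_add_coe]
    rw [show z + l + b = z + b + l by ring, show z + l - b = z - b + l by ring, hl, hl, hl]
    have hexp : Complex.exp (η * (z + b)) * Complex.exp (η * (z - b)) =
        Complex.exp (η * z) ^ 2 := by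
      rw [← Complex.exp_add, sq, ← Complex.exp_add]
      congr 1
      ring
    have he := Complex.exp_ne_zero (η * z)
    congr 2
    rw [div_eq_div_iff (by positivity) (by positivity)]
    linear_combination (C ^ 2 * sigma Λ (z + b) * sigma Λ (z - b) * (sigma Λ z ^ 2 * sigma Λ b ^ 2))
      * hexp
  have hG0 : AnalyticAt ℂ G 0 := by
    have hE := Λ.analyticAt_weierstrassPExcept 0
    refine ((hM.add hE).sub (analyticAt_const (v := Λ.weierstrassP b))).congr ?_
    filter_upwards [Λ.compl_lattice_sdiff_singleton_mem_nhds 0] with z hz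
    by_cases hz0 : z = 0
    · simp [hG, hz0, hv]
    · have hzΛ : z ∉ Λ.lattice := fun h => hz ⟨h, hz0⟩
      have hSz := sigmaQuot_ne_zero Λ hz
      simp only [Pi.add_apply, Pi.sub_apply, hG, if_neg hzΛ, hF, hM' z hz0]
      rw [← Λ.weierstrassPExcept_add 0 z, sigma_eq Λ z]
      simp only [ZeroMemClass.coe_zero, sub_zero]
      field_simp
      ring
  have hGd : Differentiable ℂ G := by
    intro z
    by_cases hz : z ∈ Λ.lattice
    · have h : AnalyticAt ℂ (fun w => G (w - z)) z := by
        have h0 : AnalyticAt ℂ G (z - z) := by rwa [sub_self]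
        exact h0.comp (f := fun w => w - z) (by fun_prop)
      have h2 : (fun w => G (w - z)) = G := by
        funext w
        simpa [sub_eq_add_neg] using hGper w (-⟨z, hz⟩)
      rw [h2] at h
      exact h.differentiableAt
    · have h1 : DifferentiableAt ℂ F z := by
        have := sigma_ne_zero Λ hz
        have hP : DifferentiableAt ℂ Λ.weierstrassP z :=
          Λ.differentiableOn_weierstrassP.differentiableAt ((isOpen_compl_lattice Λ).mem_nhds hz)
        refine ((DifferentiableAt.div (by fun_prop) (by fun_prop) (by positivity)).add hP).sub_const _
      refine h1.congr_of_eventuallyEq ?_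
      filter_upwards [(isOpen_compl_lattice Λ).mem_nhds hz] with w hw
      exact if_neg hw
  -- G is entire and periodic, so its range is compact. It is compared with its value at b, which is
  -- 0 since σ(b − b) = 0.
  have hconst := hGd.apply_eq_apply_of_bounded
    (IsZLattice.isCompact_range_of_periodic Λ.lattice _ hGd.continuous fun z w hw => by
      simpa using hGper z ⟨w, hw⟩).isBounded a b
  have ha0 := sigma_ne_zero Λ ha
  simp only [hG, if_neg ha, if_neg hb, hF, sub_self, sigma_zero, mul_zero, zero_div, zero_add] at hconst
  field_simp at hconst
  linear_combination hconst

/-- The entire function `σ² ℘`, written with the derivatives of `σ`. -/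
def sigmaSqWp (z : ℂ) : ℂ := deriv (sigma Λ) z ^ 2 - sigma Λ z * deriv (deriv (sigma Λ)) z

theorem differentiable_deriv_sigma : Differentiable ℂ (deriv (sigma Λ)) :=
  fun z => ((differentiable_sigma Λ).analyticAt z).deriv.differentiableAt

theorem continuous_sigmaSqWp : Continuous (sigmaSqWp Λ) := by
  have h1 := differentiable_deriv_sigma Λ
  have h0 := (differentiable_sigma Λ).continuous
  have h2 : Continuous (deriv (deriv (sigma Λ))) := continuous_iff_continuousAt.2
    fun z => (h1.analyticAt z).deriv.continuousAt
  have h1 := h1.continuous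
  unfold sigmaSqWp
  fun_prop

theorem sigmaSqWp_eq {z : ℂ} (hz : z ∉ Λ.lattice) :
    sigmaSqWp Λ z = sigma Λ z ^ 2 * Λ.weierstrassP z := by
  have h0 := sigma_ne_zero Λ hz
  have h := ((differentiable_deriv_sigma Λ z).hasDerivAt.div
    (differentiable_sigma Λ z).hasDerivAt h0).deriv
  have h2 := (hasDerivAt_zeta_weierstrassP Λ hz).deriv
  have h3 : zeta Λ = deriv (sigma Λ) / sigma Λ := rfl
  rw [h3, h] at h2
  rw [sigmaSqWp]
  field_simp at h2
  linear_combination -h2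

/-- Writing σ²℘ as an entire function turns the previous formula into an identity of continuous
functions, which extends to lattice points by density in each variable. -/
theorem sigma_bilinear (a b : ℂ) :
    sigma Λ (a + b) * sigma Λ (a - b) =
      sigma Λ a ^ 2 * sigmaSqWp Λ b - sigmaSqWp Λ a * sigma Λ b ^ 2 := by
  have hσ := (differentiable_sigma Λ).continuous
  have hW := continuous_sigmaSqWp Λ
  have h1 : ∀ a ∉ Λ.lattice, ∀ b, sigma Λ (a + b) * sigma Λ (a - b) =
      sigma Λ a ^ 2 * sigmaSqWp Λ b - sigmaSqWp Λ a * sigma Λ b ^ 2 := by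
    intro a ha b
    refine congrFun (Continuous.ext_on (dense_compl_lattice Λ)
      (f := fun b => sigma Λ (a + b) * sigma Λ (a - b))
      (g := fun b => sigma Λ a ^ 2 * sigmaSqWp Λ b - sigmaSqWp Λ a * sigma Λ b ^ 2)
      (by fun_prop) (by fun_prop) fun b hb => ?_) b
    simp only
    rw [sigma_add_mul_sigma_sub Λ ha hb, sigmaSqWp_eq Λ ha, sigmaSqWp_eq Λ hb]
    ring
  exact congrFun (Continuous.ext_on (dense_compl_lattice Λ)
      (f := fun a => sigma Λ (a + b) * sigma Λ (a - b))
      (g := fun a => sigma Λ a ^ 2 * sigmaSqWp Λ b - sigmaSqWp Λ a * sigma Λ b ^ 2)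
      (by fun_prop) (by fun_prop) fun a ha => h1 a ha b) a

/-- By `sigma_bilinear` every product σ(x+y)σ(x−y) is a 2 × 2 determinant of the vectors (σ², σ²℘)
at x and y; this is the Plücker relation for four vectors in a plane. -/
theorem sigma_three_term (a b c d : ℂ) :
    sigma Λ (a + b) * sigma Λ (a - b) * (sigma Λ (c + d) * sigma Λ (c - d)) +
      sigma Λ (b + c) * sigma Λ (b - c) * (sigma Λ (a + d) * sigma Λ (a - d)) +
      sigma Λ (c + a) * sigma Λ (c - a) * (sigma Λ (b + d) * sigma Λ (b - d)) = 0 := by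
  simp only [sigma_bilinear]
  ring

theorem deriv_sigma_zero : deriv (sigma Λ) 0 = 1 := by
  have h := (hasDerivAt_id' (0 : ℂ)).mul (differentiable_sigmaQuot Λ 0).hasDerivAt
  rw [funext (sigma_eq Λ)]
  exact h.deriv.trans (by simp [sigmaQuot_zero])

/-- The three-term identity is differentiated in d at d = a, with z = 2a, u = c − a, v = b − a. In
the term containing σ(a − d) only the derivative of that factor survives, with σ'(0) = 1. The left
side is the numerator of the elliptic addition theorem. -/
theorem deriv_sigma_four_term (u v z : ℂ) :
    (deriv (sigma Λ) (u + z) * sigma Λ u - sigma Λ (u + z) * deriv (sigma Λ) u) *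
        (sigma Λ (v + z) * sigma Λ v) -
      (deriv (sigma Λ) (v + z) * sigma Λ v - sigma Λ (v + z) * deriv (sigma Λ) v) *
        (sigma Λ (u + z) * sigma Λ u) =
      sigma Λ z * sigma Λ (u + v + z) * sigma Λ (u - v) := by
  obtain ⟨a, rfl⟩ : ∃ a, z = 2 * a := ⟨z / 2, by ring⟩
  obtain ⟨c, rfl⟩ : ∃ c, u = c - a := ⟨u + a, by ring⟩
  obtain ⟨b, rfl⟩ : ∃ b, v = b - a := ⟨v + a, by ring⟩
  rw [show c - a + 2 * a = c + a by ring, show b - a + 2 * a = b + a by ring]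
  have hD : ∀ x y : ℂ, HasDerivAt (fun d => sigma Λ (x + d) * sigma Λ (x - d))
      (deriv (sigma Λ) (x + y) * sigma Λ (x - y) - sigma Λ (x + y) * deriv (sigma Λ) (x - y)) y := by
    intro x y
    have h1 := ((differentiable_sigma Λ (x + y)).hasDerivAt.comp_const_add x y)
    have h2 := ((differentiable_sigma Λ (x - y)).hasDerivAt.comp_const_sub x y)
    exact (h1.mul h2).congr_deriv (by ring)
  have hsum := ((((hD c a).const_mul (sigma Λ (a + b) * sigma Λ (a - b))).add
    ((hD a a).const_mul (sigma Λ (b + c) * sigma Λ (b - c)))).add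
    ((hD b a).const_mul (sigma Λ (c + a) * sigma Λ (c - a)))).congr_of_eventuallyEq
    (f₁ := fun _ => 0) (.of_forall fun d => (sigma_three_term Λ a b c d).symm)
  have h0 := hsum.unique (hasDerivAt_const a 0)
  rw [sub_self, sigma_zero, deriv_sigma_zero] at h0
  have n1 : sigma Λ (a - b) = -sigma Λ (b - a) := by rw [← sigma_neg]; congr 1; ring
  have n2 : sigma Λ (b - c) = -sigma Λ (c - b) := by rw [← sigma_neg]; congr 1; ring
  rw [n1, n2, add_comm a b, ← two_mul] at h0
  rw [show c - a + (b - a) + 2 * a = b + c by ring, show c - a - (b - a) = c - b by ring]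
  linear_combination -h0

theorem zeta_neg (z : ℂ) : zeta Λ (-z) = -zeta Λ z := by
  have h := deriv_comp_neg (sigma Λ) z
  rw [funext (sigma_neg Λ), deriv.fun_neg, neg_inj] at h
  rw [zeta, zeta, ← h, sigma_neg, div_neg]

/-- `ζ` is not constant near any point off the lattice. -/
theorem not_eventually_zeta_eq_const {u : ℂ} (hu : u ∉ Λ.lattice) (k : ℂ) :
    ¬ ∀ᶠ z in 𝓝 u, zeta Λ z = k := by
  intro h
  have han : AnalyticOnNhd ℂ (fun z => zeta Λ z - k) (Λ.lattice : Set ℂ)ᶜ :=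
    DifferentiableOn.analyticOnNhd (fun z hz =>
      ((hasDerivAt_zeta Λ hz).differentiableAt.sub_const k).differentiableWithinAt)
      (isOpen_compl_lattice Λ)
  have hz := han.eqOn_zero_of_preconnected_of_eventuallyEq_zero (isPreconnected_compl_lattice Λ) hu
    (h.mono fun z hz => by simp [hz])
  have hP : Set.EqOn Λ.weierstrassP 0 (Λ.lattice : Set ℂ)ᶜ := by
    intro z hz'
    have h1 := (hasDerivAt_zeta_weierstrassP Λ hz').sub_const k
    have h2 := h1.congr_of_eventuallyEq (f₁ := fun _ => 0) (by
      filter_upwards [(isOpen_compl_lattice Λ).mem_nhds hz'] with w hw using (hz hw).symm)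
    simpa using h2.unique (hasDerivAt_const z 0)
  -- Off the lattice ℘ = −ζ' would vanish, and `weierstrassP` is 0 at lattice points by convention,
  -- so it would be identically zero, contrary to its pole at 0.
  refine Λ.not_continuousAt_weierstrassP 0 Λ.lattice.zero_mem ?_
  have : Λ.weierstrassP = 0 := by
    funext z
    by_cases hz' : z ∈ Λ.lattice
    · exact Λ.weierstrassP_coe ⟨z, hz'⟩
    · exact hP hz'
  rw [this]
  exact continuousAt_const

end WeierstrassIdentities

/-! ### Principal values on circles -/

section PrincipalValue

/-- The integrand of `∮ g(w) dw` in the angle measured from `z`. -/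
def circleIntegrand (g : ℂ → ℂ) (z : ℂ) (θ : ℝ) : ℂ :=
  Complex.I * (z * Complex.exp (Complex.I * θ)) * g (z * Complex.exp (Complex.I * θ))

/-- The scalar version of `HasPV`, with integrability of the truncations. -/
structure HasScalarPV (g : ℂ → ℂ) (z v : ℂ) : Prop where
  integrable : ∀ ε : ℝ, 0 < ε → ε < Real.pi →
    IntervalIntegrable (circleIntegrand g z) MeasureTheory.volume ε (2 * Real.pi - ε)
  tendsto : Tendsto (fun ε : ℝ => (2 * (Real.pi : ℂ) * Complex.I)⁻¹ *
    ∫ θ in ε..(2 * Real.pi - ε), circleIntegrand g z θ) (𝓝[>] 0) (𝓝 v)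

theorem eventually_angle : ∀ᶠ ε : ℝ in 𝓝[>] 0, 0 < ε ∧ ε < Real.pi :=
  Ioo_mem_nhdsGT Real.pi_pos

theorem HasScalarPV.congr_value {g : ℂ → ℂ} {z v v' : ℂ} (h : HasScalarPV g z v) (e : v = v') :
    HasScalarPV g z v' := e ▸ h

theorem HasScalarPV.add {g₁ g₂ : ℂ → ℂ} {z v₁ v₂ : ℂ} (h₁ : HasScalarPV g₁ z v₁)
    (h₂ : HasScalarPV g₂ z v₂) : HasScalarPV (fun w => g₁ w + g₂ w) z (v₁ + v₂) := by
  have e : circleIntegrand (fun w => g₁ w + g₂ w) z =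
      fun θ => circleIntegrand g₁ z θ + circleIntegrand g₂ z θ := by
    funext θ
    simp only [circleIntegrand, mul_add]
  refine ⟨fun ε h0 h1 => ?_, ?_⟩
  · rw [e]
    exact (h₁.integrable ε h0 h1).add (h₂.integrable ε h0 h1)
  · refine (h₁.tendsto.add h₂.tendsto).congr' ?_
    filter_upwards [eventually_angle] with ε hε
    rw [e, intervalIntegral.integral_add (h₁.integrable ε hε.1 hε.2) (h₂.integrable ε hε.1 hε.2),
      mul_add]

theorem HasScalarPV.const_mul {g : ℂ → ℂ} {z v : ℂ} (h : HasScalarPV g z v) (k : ℂ) :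
    HasScalarPV (fun w => k * g w) z (k * v) := by
  have e : circleIntegrand (fun w => k * g w) z = fun θ => k * circleIntegrand g z θ := by
    funext θ
    simp only [circleIntegrand]
    ring
  refine ⟨fun ε h0 h1 => ?_, ?_⟩
  · rw [e]
    exact (h.integrable ε h0 h1).const_mul k
  · refine (h.tendsto.const_mul k).congr fun ε => ?_
    rw [e, intervalIntegral.integral_const_mul]
    ring

theorem exp_angle_ne_one {ε θ : ℝ} (h0 : 0 < ε) (hθ : θ ∈ Set.Icc ε (2 * Real.pi - ε)) :
    Complex.exp (Complex.I * θ) ≠ 1 := by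
  intro h
  obtain ⟨n, hn⟩ := Complex.exp_eq_one_iff.1 h
  have hn' : θ = n * (2 * Real.pi) := by
    have : (Complex.I : ℂ) * θ = Complex.I * ((n * (2 * Real.pi) : ℝ) : ℂ) := by
      rw [hn]; push_cast; ring
    exact_mod_cast mul_left_cancel₀ Complex.I_ne_zero this
  have h1 : (0 : ℝ) < n * (2 * Real.pi) := by linarith [hθ.1]
  have h2 : n * (2 * Real.pi) < 1 * (2 * Real.pi) := by linarith [hθ.2]
  have h3 : (0 : ℝ) < n := pos_of_mul_pos_left h1 (by positivity)
  have h4 : (n : ℝ) < 1 := lt_of_mul_lt_mul_right h2 (by positivity)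
  have h3' : 0 < n := by exact_mod_cast h3
  have h4' : n < 1 := by exact_mod_cast h4
  omega

theorem norm_mul_exp_angle (z : ℂ) (θ : ℝ) : ‖z * Complex.exp (Complex.I * θ)‖ = ‖z‖ := by
  rw [norm_mul, mul_comm Complex.I, Complex.norm_exp_ofReal_mul_I, mul_one]

theorem mul_exp_angle_ne {z : ℂ} (hz : z ≠ 0) {ε θ : ℝ} (h0 : 0 < ε)
    (hθ : θ ∈ Set.Icc ε (2 * Real.pi - ε)) : z * Complex.exp (Complex.I * θ) ≠ z := fun h =>
  exp_angle_ne_one h0 hθ (mul_left_cancel₀ hz (h.trans (mul_one z).symm))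

/-- The truncated arcs avoid w = z, so the value of the integrand there is irrelevant and may be
whatever division by zero produces. -/
theorem HasScalarPV.congr {g₁ g₂ : ℂ → ℂ} {z v : ℂ} (hz : z ≠ 0) (h : HasScalarPV g₁ z v)
    (e : ∀ w, ‖w‖ = ‖z‖ → w ≠ z → g₂ w = g₁ w) : HasScalarPV g₂ z v := by
  have key : ∀ ε : ℝ, 0 < ε → ε < Real.pi → ∀ θ ∈ Set.Icc ε (2 * Real.pi - ε),
      circleIntegrand g₁ z θ = circleIntegrand g₂ z θ := by
    intro ε h0 _ θ hθ
    rw [circleIntegrand, circleIntegrand, e _ (norm_mul_exp_angle z θ) (mul_exp_angle_ne hz h0 hθ)]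
  refine ⟨fun ε h0 h1 => ?_, ?_⟩
  · have hle : ε ≤ 2 * Real.pi - ε := by linarith
    refine (h.integrable ε h0 h1).congr_ae ?_
    filter_upwards [MeasureTheory.ae_restrict_mem measurableSet_uIoc] with θ hθ
    rw [Set.uIoc_of_le hle] at hθ
    exact key ε h0 h1 θ ⟨hθ.1.le, hθ.2⟩
  · refine h.tendsto.congr' ?_
    filter_upwards [eventually_angle] with ε hε
    have hle : ε ≤ 2 * Real.pi - ε := by linarith [hε.1, hε.2]
    congr 1
    refine intervalIntegral.integral_congr fun θ hθ => ?_
    rw [Set.uIcc_of_le hle] at hθ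
    exact key ε hε.1 hε.2 θ hθ

theorem integral_circleIntegrand (g : ℂ → ℂ) (z : ℂ) :
    ∫ θ in (0 : ℝ)..(2 * Real.pi), circleIntegrand g z θ = ∮ w in C(0, ‖z‖), g w := by
  have e : ∀ θ : ℝ, circleIntegrand g z θ = deriv (circleMap 0 ‖z‖) (θ + Complex.arg z) •
      g (circleMap 0 ‖z‖ (θ + Complex.arg z)) := by
    intro θ
    have h : circleMap 0 ‖z‖ (θ + Complex.arg z) = z * Complex.exp (Complex.I * θ) := by
      rw [circleMap, zero_add]
      push_cast
      rw [add_mul, Complex.exp_add, mul_comm Complex.I, mul_left_comm,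
        Complex.norm_mul_exp_arg_mul_I, mul_comm]
    rw [deriv_circleMap, h]
    rw [circleIntegrand, smul_eq_mul]
    ring
  simp only [e, circleIntegral]
  rw [intervalIntegral.integral_comp_add_right
    (fun θ => deriv (circleMap 0 ‖z‖) θ • g (circleMap 0 ‖z‖ θ))]
  have hper : Function.Periodic (fun θ => deriv (circleMap 0 ‖z‖) θ • g (circleMap 0 ‖z‖ θ))
      (2 * Real.pi) := by
    intro θ
    simp only [deriv_circleMap]
    rw [periodic_circleMap]
  have := hper.intervalIntegral_add_eq (Complex.arg z) 0
  rw [zero_add] at this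
  rw [zero_add, add_comm (2 * Real.pi)]
  exact this

theorem hasScalarPV_of_continuousOn {g : ℂ → ℂ} {z : ℂ}
    (hg : ContinuousOn g (Metric.sphere 0 ‖z‖)) :
    HasScalarPV g z ((2 * (Real.pi : ℂ) * Complex.I)⁻¹ * ∮ w in C(0, ‖z‖), g w) := by
  have hc : Continuous (circleIntegrand g z) := by
    have h1 : Continuous fun θ : ℝ => z * Complex.exp (Complex.I * θ) := by fun_prop
    refine Continuous.mul (by fun_prop) ?_
    exact hg.comp_continuous h1 fun θ => mem_sphere_zero_iff_norm.2 (norm_mul_exp_angle z θ)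
  have hi : ∀ a b : ℝ, IntervalIntegrable (circleIntegrand g z) MeasureTheory.volume a b :=
    fun a b => hc.intervalIntegrable a b
  refine ⟨fun ε _ _ => hi _ _, ?_⟩
  rw [← integral_circleIntegrand]
  have hp := intervalIntegral.continuous_primitive hi 0
  have h1 : Continuous fun ε : ℝ => (2 * (Real.pi : ℂ) * Complex.I)⁻¹ *
      ((∫ θ in (0 : ℝ)..(2 * Real.pi - ε), circleIntegrand g z θ) -
        ∫ θ in (0 : ℝ)..ε, circleIntegrand g z θ) := by fun_prop
  have h2 := (h1.tendsto 0).mono_left (nhdsWithin_le_nhds (s := Set.Ioi 0))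
  simp only [sub_zero, intervalIntegral.integral_same] at h2
  refine h2.congr fun ε => ?_
  rw [intervalIntegral.integral_interval_sub_left (hi _ _) (hi _ _)]

/-- The integrand at θ and at 2π − θ adds up to the constant i, so the truncated integral is exactly
(π − ε) i. This is the source of all half residues. -/
theorem hasScalarPV_inv_sub {z : ℂ} (hz : z ≠ 0) : HasScalarPV (fun w => (w - z)⁻¹) z (1 / 2) := by
  set G : ℝ → ℂ := circleIntegrand (fun w => (w - z)⁻¹) z with hG
  have hcont : ∀ ε : ℝ, 0 < ε → ContinuousOn G (Set.Icc ε (2 * Real.pi - ε)) := by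
    intro ε h0
    refine ContinuousOn.mul (by fun_prop) (ContinuousOn.inv₀ (by fun_prop) fun θ hθ => ?_)
    exact sub_ne_zero.2 (mul_exp_angle_ne hz h0 hθ)
  have hInt : ∀ ε : ℝ, 0 < ε → ε < Real.pi →
      IntervalIntegrable G MeasureTheory.volume ε (2 * Real.pi - ε) := by
    intro ε h0 h1
    exact ContinuousOn.intervalIntegrable_of_Icc (by linarith) (hcont ε h0)
  have hsymm : ∀ ε : ℝ, 0 < ε → ∀ θ ∈ Set.Icc ε (2 * Real.pi - ε),
      G θ + G (2 * Real.pi - θ) = Complex.I := by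
    intro ε h0 θ hθ
    have he := exp_angle_ne_one h0 hθ
    have e1 : Complex.exp (Complex.I * ((2 * Real.pi - θ : ℝ) : ℂ)) =
        (Complex.exp (Complex.I * θ))⁻¹ := by
      rw [← Complex.exp_neg]
      push_cast
      rw [show Complex.I * (2 * (Real.pi : ℂ) - θ) = -(Complex.I * θ) + 2 * Real.pi * Complex.I
        by ring, Complex.exp_add, Complex.exp_two_pi_mul_I, mul_one]
    simp only [hG, circleIntegrand, e1]
    have h0 := Complex.exp_ne_zero (Complex.I * θ)
    generalize Complex.exp (Complex.I * θ) = x at he h0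
    have h1 : x - 1 ≠ 0 := sub_ne_zero.2 he
    have h2 : z * x - z ≠ 0 := by
      rw [show z * x - z = z * (x - 1) by ring]
      exact mul_ne_zero hz h1
    have h3 : z * x⁻¹ - z ≠ 0 := by
      rw [show z * x⁻¹ - z = -(z * (x - 1)) * x⁻¹ by field_simp; ring]
      exact mul_ne_zero (neg_ne_zero.2 (mul_ne_zero hz h1)) (inv_ne_zero h0)
    have h4 : (z * x - z)⁻¹ = z⁻¹ * (x - 1)⁻¹ := by rw [← mul_inv]; congr 1; ring
    have h5 : (z * x⁻¹ - z)⁻¹ = -(z⁻¹ * (x - 1)⁻¹ * x) := by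
      rw [show z * x⁻¹ - z = -(z * (x - 1)) * x⁻¹ by field_simp; ring, mul_inv, inv_inv, inv_neg,
        mul_inv]
      ring
    rw [h4, h5]
    field_simp
    ring
  have hval : ∀ ε : ℝ, 0 < ε → ε < Real.pi →
      ∫ θ in ε..(2 * Real.pi - ε), G θ = (Real.pi - ε) * Complex.I := by
    intro ε h0 h1
    have hle : ε ≤ 2 * Real.pi - ε := by linarith
    have hr : ∫ θ in ε..(2 * Real.pi - ε), G (2 * Real.pi - θ) =
        ∫ θ in ε..(2 * Real.pi - ε), G θ := by
      rw [intervalIntegral.integral_comp_sub_left]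
      congr 1
      ring
    have hInt2 : IntervalIntegrable (fun θ => G (2 * Real.pi - θ)) MeasureTheory.volume ε
        (2 * Real.pi - ε) := by
      have := (hInt ε h0 h1).comp_sub_left (2 * Real.pi)
      rw [sub_sub_cancel] at this
      exact this.symm
    have hs := intervalIntegral.integral_add (hInt ε h0 h1) hInt2
    rw [hr, intervalIntegral.integral_congr (g := fun _ => Complex.I)
      (fun θ hθ => by rw [Set.uIcc_of_le hle] at hθ; exact hsymm ε h0 θ hθ),
      intervalIntegral.integral_const] at hs
    have h2 : (2 : ℂ) * ∫ θ in ε..(2 * Real.pi - ε), G θ = 2 * ((Real.pi - ε) * Complex.I) := by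
      rw [two_mul, ← hs, Complex.real_smul]
      push_cast
      ring
    exact mul_left_cancel₀ two_ne_zero h2
  refine ⟨hInt, ?_⟩
  have hpi : (Real.pi : ℂ) ≠ 0 := Complex.ofReal_ne_zero.2 Real.pi_ne_zero
  have h1 : Continuous fun ε : ℝ => (2 * (Real.pi : ℂ) * Complex.I)⁻¹ *
    ((Real.pi - ε) * Complex.I) := by fun_prop
  have h2 := (h1.tendsto 0).mono_left (nhdsWithin_le_nhds (s := Set.Ioi 0))
  rw [show (2 * (Real.pi : ℂ) * Complex.I)⁻¹ * ((Real.pi - ((0 : ℝ) : ℂ)) * Complex.I) = 1 / 2 by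
    have := Complex.I_ne_zero
    rw [Complex.ofReal_zero, sub_zero]
    field_simp] at h2
  refine h2.congr' ?_
  filter_upwards [eventually_angle] with ε hε
  rw [hval ε hε.1 hε.2]

/-- `φ` has a simple pole at `0` with residue `1` and no other pole in the disc of radius `r₀`; its
regular part is `h`. -/
structure HasSimplePole (φ h : ℂ → ℂ) (r₀ : ℝ) : Prop where
  diff : DifferentiableOn ℂ h (Metric.ball 0 r₀)
  eq : ∀ z, 0 < ‖z‖ → ‖z‖ < r₀ → φ z = z⁻¹ + h z

variable {φ h : ℂ → ℂ} {r₀ : ℝ} {z : ℂ}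

theorem differentiableOn_comp_sub (hh : DifferentiableOn ℂ h (Metric.ball 0 r₀)) :
    DifferentiableOn ℂ (fun w => h (w - z)) (Metric.ball 0 (r₀ - ‖z‖)) := by
  refine hh.comp (by fun_prop) fun w hw => ?_
  simp only [Metric.mem_ball, dist_zero_right] at hw ⊢
  linarith [norm_sub_le w z]

theorem HasSimplePole.comp_sub_eq (hφ : HasSimplePole φ h r₀) (hz : ‖z‖ < r₀ / 2) {w : ℂ}
    (hw : ‖w‖ = ‖z‖) (hne : w ≠ z) : φ (w - z) = (w - z)⁻¹ + h (w - z) :=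
  hφ.eq _ (norm_pos_iff.2 (sub_ne_zero.2 hne)) ((norm_sub_le w z).trans_lt (by rw [hw]; linarith))

theorem isOpen_puncturedBall (ρ : ℝ) : IsOpen {w : ℂ | 0 < ‖w‖ ∧ ‖w‖ < ρ} :=
  (isOpen_lt continuous_const continuous_norm).inter (isOpen_lt continuous_norm continuous_const)

/-- Cauchy kernels with a simple pole on the contour have principal values. -/
theorem HasSimplePole.exists_hasScalarPV (hφ : HasSimplePole φ h r₀) {X : ℂ → ℂ} {ρ : ℝ}
    (hX : DifferentiableOn ℂ X {w : ℂ | 0 < ‖w‖ ∧ ‖w‖ < ρ}) (hz0 : 0 < ‖z‖) (hzρ : ‖z‖ < ρ)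
    (hz : ‖z‖ < r₀ / 2) : ∃ v, HasScalarPV (fun w => φ (w - z) * X w) z v := by
  have hzne : z ≠ 0 := norm_pos_iff.1 hz0
  have hsub : Metric.sphere (0 : ℂ) ‖z‖ ⊆ {w : ℂ | 0 < ‖w‖ ∧ ‖w‖ < ρ} := by
    intro w hw
    have : ‖w‖ = ‖z‖ := by simpa using hw
    exact ⟨this ▸ hz0, this ▸ hzρ⟩
  have hsub' : Metric.sphere (0 : ℂ) ‖z‖ ⊆ Metric.ball 0 (r₀ - ‖z‖) := by
    intro w hw
    have : ‖w‖ = ‖z‖ := by simpa using hw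
    simp only [Metric.mem_ball, dist_zero_right]
    linarith
  have hds := ((Complex.differentiableOn_dslope ((isOpen_puncturedBall ρ).mem_nhds
    (show z ∈ {w : ℂ | 0 < ‖w‖ ∧ ‖w‖ < ρ} from ⟨hz0, hzρ⟩))).2 hX).continuousOn.mono hsub
  have hh := (differentiableOn_comp_sub (z := z) hφ.diff).continuousOn.mono hsub'
  have hXc := hX.continuousOn.mono hsub
  -- X(w) = X(z) + (w − z) · (difference quotient), so only the constant X(z) meets the pole; the
  -- rest is continuous on the circle.
  refine ⟨_, (((hasScalarPV_inv_sub hzne).const_mul (X z)).add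
    (hasScalarPV_of_continuousOn (hds.add (hh.mul hXc)))).congr hzne fun w hw hne => ?_⟩
  rw [hφ.comp_sub_eq hz hw hne, Pi.add_apply, Pi.mul_apply, dslope_of_ne _ hne, slope_def_field]
  have := sub_ne_zero.2 hne
  field_simp
  ring

theorem circleIntegral_eq_zero_of_differentiableOn {g : ℂ → ℂ} {R ρ : ℝ} (hR : 0 ≤ R) (hRρ : R < ρ)
    (hg : DifferentiableOn ℂ g (Metric.ball 0 ρ)) : ∮ w in C(0, R), g w = 0 :=
  Complex.circleIntegral_eq_zero_of_differentiable_on_off_countable hR Set.countable_empty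
    (hg.continuousOn.mono (Metric.closedBall_subset_ball hRρ)) fun w hw =>
      hg.differentiableAt (Metric.isOpen_ball.mem_nhds
        (Metric.ball_subset_ball hRρ.le (by simpa using hw)))

theorem circleIntegral_mul_inv {g : ℂ → ℂ} {R ρ : ℝ} (hR : 0 < R) (hRρ : R < ρ)
    (hg : DifferentiableOn ℂ g (Metric.ball 0 ρ)) :
    (2 * (Real.pi : ℂ) * Complex.I)⁻¹ * ∮ w in C(0, R), g w * w⁻¹ = g 0 := by
  have h := (hg.mono (Metric.closedBall_subset_ball hRρ)).diffContOnCl_ball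
    (subset_refl _) |>.circleIntegral_sub_inv_smul (Metric.mem_ball_self hR)
  simp only [sub_zero, smul_eq_mul] at h
  simp only [mul_comm (g _)]
  rw [h, inv_mul_cancel_left₀ Complex.two_pi_I_ne_zero]

theorem circleIntegral_mul_sq_inv {g : ℂ → ℂ} {R ρ : ℝ} (hR : 0 < R) (hRρ : R < ρ)
    (hg : DifferentiableOn ℂ g (Metric.ball 0 ρ)) :
    (2 * (Real.pi : ℂ) * Complex.I)⁻¹ * ∮ w in C(0, R), g w * (w ^ 2)⁻¹ = deriv g 0 := by
  have h := Complex.two_pi_I_inv_smul_circleIntegral_sub_sq_inv_smul_of_differentiable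
    Metric.isOpen_ball (Metric.closedBall_subset_ball hRρ) hg (Metric.mem_ball_self hR)
  simpa only [sub_zero, smul_eq_mul, mul_comm] using h

theorem HasSimplePole.deriv_eq (hφ : HasSimplePole φ h r₀) (h0 : 0 < ‖z‖) (hz : ‖z‖ < r₀) :
    HasDerivAt φ (-(z ^ 2)⁻¹ + deriv h z) z := by
  have hd := hφ.diff.differentiableAt (Metric.isOpen_ball.mem_nhds
    (show z ∈ Metric.ball 0 r₀ by simpa using hz))
  refine ((hasDerivAt_inv (norm_pos_iff.1 h0)).add hd.hasDerivAt).congr_of_eventuallyEq ?_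
  filter_upwards [(isOpen_puncturedBall r₀).mem_nhds (show z ∈ {w : ℂ | 0 < ‖w‖ ∧ ‖w‖ < r₀} from
    ⟨h0, hz⟩)] with w hw
  exact hφ.eq w hw.1 hw.2

/-- The principal value of a Cauchy kernel applied to a function with at most a double pole at the
centre, by residues. -/
theorem HasSimplePole.hasScalarPV (hφ : HasSimplePole φ h r₀) {E : ℂ → ℂ} (A C : ℂ)
    (hE : DifferentiableOn ℂ E (Metric.ball 0 r₀)) (hz0 : 0 < ‖z‖) (hz : ‖z‖ < r₀ / 2) :
    HasScalarPV (fun w => φ (w - z) * (A * (w ^ 2)⁻¹ + C * w⁻¹ + E w)) z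
      (A * deriv φ (-z) + C * φ (-z) + 1 / 2 * (A * (z ^ 2)⁻¹ + C * z⁻¹ + E z)) := by
  have hzne : z ≠ 0 := norm_pos_iff.1 hz0
  have hlt : ‖z‖ < r₀ - ‖z‖ := by linarith
  have hsub' : Metric.sphere (0 : ℂ) ‖z‖ ⊆ Metric.ball 0 (r₀ - ‖z‖) :=
    Metric.sphere_subset_closedBall.trans (Metric.closedBall_subset_ball hlt)
  have hE' : DifferentiableOn ℂ E (Metric.ball 0 (r₀ - ‖z‖)) :=
    hE.mono (Metric.ball_subset_ball (by linarith))
  have hds := (Complex.differentiableOn_dslope (f := E) (Metric.isOpen_ball.mem_nhds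
    (show z ∈ Metric.ball 0 (r₀ - ‖z‖) by simpa using hlt))).2 hE'
  have hh := differentiableOn_comp_sub (z := z) hφ.diff
  have hne0 : ∀ w ∈ Metric.sphere (0 : ℂ) ‖z‖, w ≠ 0 := by
    intro w hw
    have : ‖w‖ = ‖z‖ := by simpa using hw
    exact norm_pos_iff.1 (this ▸ hz0)
  have hinv : ContinuousOn (fun w : ℂ => w⁻¹) (Metric.sphere (0 : ℂ) ‖z‖) :=
    continuousOn_id.inv₀ hne0
  have hinv2 : ContinuousOn (fun w : ℂ => (w ^ 2)⁻¹) (Metric.sphere (0 : ℂ) ‖z‖) :=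
    (continuousOn_id.pow 2).inv₀ fun w hw => pow_ne_zero 2 (hne0 w hw)
  -- Partial fractions: 1/(w(w−z)) = z⁻¹/(w−z) − z⁻¹/w and 1/(w²(w−z)) = z⁻²/(w−z) − z⁻¹/w² − z⁻²/w.
  -- All terms in 1/(w−z) are collected here with the full value at z as coefficient; the others are
  -- the corrections subtracted from h in `hg1` and `hg2`.
  have hpv := (hasScalarPV_inv_sub hzne).const_mul (A * (z ^ 2)⁻¹ + C * z⁻¹ + E z)
  have hreg := hasScalarPV_of_continuousOn ((hds.add (hh.mul hE')).continuousOn.mono hsub')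
  rw [circleIntegral_eq_zero_of_differentiableOn hz0.le hlt (hds.add (hh.mul hE')), mul_zero] at hreg
  have hg1 : DifferentiableOn ℂ (fun w => h (w - z) - z⁻¹) (Metric.ball 0 (r₀ - ‖z‖)) :=
    hh.sub (differentiableOn_const _)
  have h1 := hasScalarPV_of_continuousOn (g := fun w => (h (w - z) - z⁻¹) * w⁻¹)
    ((hg1.continuousOn.mono hsub').mul hinv)
  have e1 := circleIntegral_mul_inv hz0 hlt hg1
  rw [e1] at h1
  have hg2 : DifferentiableOn ℂ (fun w => h (w - z) - z⁻¹ - (z ^ 2)⁻¹ * w)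
      (Metric.ball 0 (r₀ - ‖z‖)) := hg1.sub (differentiableOn_id.const_mul _)
  have h2 := hasScalarPV_of_continuousOn
    (g := fun w => (h (w - z) - z⁻¹ - (z ^ 2)⁻¹ * w) * (w ^ 2)⁻¹)
    ((hg2.continuousOn.mono hsub').mul hinv2)
  have e2 := circleIntegral_mul_sq_inv hz0 hlt hg2
  rw [e2] at h2
  have hnz : -z ∈ Metric.ball (0 : ℂ) r₀ := by simp; linarith
  have hdh : HasDerivAt (fun w => h (w - z)) (deriv h (-z)) 0 := by
    have := (hφ.diff.differentiableAt (Metric.isOpen_ball.mem_nhds hnz)).hasDerivAt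
    exact HasDerivAt.comp_sub_const 0 z (by rwa [zero_sub])
  have hd2 : deriv (fun w => h (w - z) - z⁻¹ - (z ^ 2)⁻¹ * w) 0 = deriv h (-z) - (z ^ 2)⁻¹ := by
    refine (((hdh.sub_const z⁻¹).sub ((hasDerivAt_id' (0 : ℂ)).const_mul _))).deriv.trans ?_
    simp
  rw [hd2] at h2
  refine HasScalarPV.congr_value ((((hpv.add hreg).add (h1.const_mul C)).add
    (h2.const_mul A)).congr hzne fun w hw hne => ?_) ?_
  · have hw0 : w ≠ 0 := norm_pos_iff.1 (hw ▸ hz0)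
    have := sub_ne_zero.2 hne
    rw [hφ.comp_sub_eq hz hw hne, Pi.add_apply, Pi.mul_apply, dslope_of_ne _ hne, slope_def_field]
    generalize h (w - z) = H
    field_simp
    ring
  · rw [(hφ.deriv_eq (by simpa using hz0) (by rw [norm_neg]; linarith)).deriv,
      hφ.eq (-z) (by simpa using hz0) (by rw [norm_neg]; linarith), zero_sub, neg_sq, inv_neg]
    ring

/-- The constant term of a Laurent polynomial of order at most two plus a regular function. -/
theorem circleIntegral_div_eq_of_eq {g k : ℂ → ℂ} {R ρ : ℝ} (hR : 0 < R) (hRρ : R < ρ) (A C : ℂ)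
    (hk : DifferentiableOn ℂ k (Metric.ball 0 ρ))
    (hg : ∀ w, ‖w‖ = R → g w = A * (w ^ 2)⁻¹ + C * w⁻¹ + k w) :
    (2 * (Real.pi : ℂ) * Complex.I)⁻¹ * ∮ w in C(0, R), g w / w = k 0 := by
  have hne0 : ∀ w ∈ Metric.sphere (0 : ℂ) R, w ≠ 0 := by
    intro w hw
    have : ‖w‖ = R := by simpa using hw
    exact norm_pos_iff.1 (this ▸ hR)
  have e : ∮ w in C(0, R), g w / w = ∮ w in C(0, R),
      (A * (w - 0) ^ (-3 : ℤ) + C * (w - 0) ^ (-2 : ℤ) + k w * w⁻¹) := by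
    refine circleIntegral.integral_congr hR.le fun w hw => ?_
    have hw0 := hne0 w hw
    rw [hg w (by simpa using hw), sub_zero, zpow_neg, zpow_neg, div_eq_mul_inv]
    norm_cast
    field_simp
  have i1 : CircleIntegrable (fun w => A * (w - 0) ^ (-3 : ℤ)) 0 R :=
    ContinuousOn.circleIntegrable hR.le (continuousOn_const.mul
      (ContinuousOn.zpow₀ (by fun_prop) _ fun w hw => .inl (by simpa using hne0 w hw)))
  have i2 : CircleIntegrable (fun w => C * (w - 0) ^ (-2 : ℤ)) 0 R :=
    ContinuousOn.circleIntegrable hR.le (continuousOn_const.mul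
      (ContinuousOn.zpow₀ (by fun_prop) _ fun w hw => .inl (by simpa using hne0 w hw)))
  have i3 : CircleIntegrable (fun w => k w * w⁻¹) 0 R :=
    ContinuousOn.circleIntegrable hR.le ((hk.continuousOn.mono
      (Metric.sphere_subset_closedBall.trans (Metric.closedBall_subset_ball hRρ))).mul
        (continuousOn_id.inv₀ hne0))
  have i12 : CircleIntegrable (fun w => A * (w - 0) ^ (-3 : ℤ) + C * (w - 0) ^ (-2 : ℤ)) 0 R :=
    i1.add i2
  rw [e, circleIntegral.integral_add i12 i3, circleIntegral.integral_add i1 i2,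
    circleIntegral.integral_const_mul, circleIntegral.integral_const_mul,
    circleIntegral.integral_sub_zpow_of_ne (by norm_num),
    circleIntegral.integral_sub_zpow_of_ne (by norm_num), mul_zero, mul_zero, zero_add, zero_add,
    circleIntegral_mul_inv hR hRρ hk]

end PrincipalValue

/-! ### Vector-valued calculus -/

section VectorCalculus

variable {V : Type*} [AddCommGroup V] [Module ℂ V]

/-- A power series that converges on a punctured disc is differentiable there. -/
theorem differentiableOn_of_hasSum {a : ℕ → ℂ} {Y : ℂ → ℂ} {ρ : ℝ}
    (h : ∀ z : ℂ, 0 < ‖z‖ → ‖z‖ < ρ → HasSum (fun n => a n * z ^ n) (Y z)) :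
    DifferentiableOn ℂ Y {w : ℂ | 0 < ‖w‖ ∧ ‖w‖ < ρ} := by
  set p := FormalMultilinearSeries.ofScalars ℂ a with hp
  have hrad : ∀ r : NNReal, 0 < r → (r : ℝ) < ρ → (r : ENNReal) ≤ p.radius := by
    intro r h0 hr
    have hs := h (r : ℂ) (by simpa using h0) (by simpa using hr)
    have h1 := hs.summable.tendsto_atTop_zero.norm
    simp only [norm_zero, norm_mul, norm_pow] at h1
    refine p.le_radius_of_tendsto (l := 0) (h1.congr fun n => ?_)
    rw [hp, FormalMultilinearSeries.ofScalars_norm]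
    simp
  intro w hw
  obtain ⟨r, hwr, hrρ⟩ := exists_between hw.2
  lift r to NNReal using (norm_nonneg w).trans hwr.le
  have hr0 : 0 < r := by exact_mod_cast hw.1.trans hwr
  have hball := hrad r hr0 hrρ
  have hpos : 0 < p.radius := lt_of_lt_of_le (by exact_mod_cast hr0) hball
  have hd := (p.hasFPowerSeriesOnBall hpos).differentiableOn
  have hwmem : w ∈ Metric.eball (0 : ℂ) p.radius := by
    refine Metric.eball_subset_eball hball ?_
    rw [Metric.mem_eball, edist_zero_right]
    rw [enorm_lt_coe]
    exact_mod_cast hwr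
  refine ((hd.differentiableAt (Metric.isOpen_eball.mem_nhds hwmem)).congr_of_eventuallyEq
    ?_).differentiableWithinAt
  filter_upwards [(isOpen_puncturedBall ρ).mem_nhds hw] with y hy
  rw [← (h y hy.1 hy.2).tsum_eq]
  exact (FormalMultilinearSeries.ofScalars_sum_eq a y).symm

theorem IsLoop.differentiableOn {X : ℂ → V} {ρ : ℝ} (h : IsLoop X ρ) (l : Module.Dual ℂ V) :
    DifferentiableOn ℂ (fun w => l (X w)) {w : ℂ | 0 < ‖w‖ ∧ ‖w‖ < ρ} := by
  obtain ⟨N, c, hc⟩ := h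
  have h1 : DifferentiableOn ℂ (fun w => l (X w) * w ^ N) {w : ℂ | 0 < ‖w‖ ∧ ‖w‖ < ρ} := by
    refine differentiableOn_of_hasSum (a := fun n => l (c n)) fun z h0 hρ => ?_
    convert! (hc z h0 hρ l).mul_right (z ^ N) using 2 with n
    rw [mul_assoc, ← zpow_natCast z N, ← zpow_add₀ (norm_pos_iff.1 h0), sub_add_cancel,
      zpow_natCast]
  refine (h1.div (differentiableOn_pow N) fun w hw =>
    pow_ne_zero N (norm_pos_iff.1 hw.1)).congr fun w hw => ?_
  have := pow_ne_zero N (norm_pos_iff.1 hw.1)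
  rw [Pi.div_apply]
  field_simp

theorem isLoop_of_sum {ι : Type*} (s : Finset ι) {X : ℂ → V} {g : ι → ℂ → ℂ} {v : ι → V} {ρ : ℝ}
    (N : ℕ) {Y : ι → ℂ → ℂ} (hY : ∀ j ∈ s, DifferentiableOn ℂ (Y j) (Metric.ball 0 ρ))
    (hg : ∀ j ∈ s, ∀ z, 0 < ‖z‖ → ‖z‖ < ρ → g j z = Y j z * z ^ (-(N : ℤ)))
    (hX : ∀ z, 0 < ‖z‖ → ‖z‖ < ρ → X z = ∑ j ∈ s, g j z • v j) : IsLoop X ρ := by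
  refine ⟨N, fun n => ∑ j ∈ s, ((n.factorial : ℂ)⁻¹ * iteratedDeriv n (Y j) 0) • v j,
    fun z h0 hz l => ?_⟩
  have h : HasSum (fun n : ℕ => ∑ j ∈ s, ((n.factorial : ℂ)⁻¹ • (z - 0) ^ n •
      iteratedDeriv n (Y j) 0) * (z ^ (-(N : ℤ)) * l (v j)))
      (∑ j ∈ s, Y j z * (z ^ (-(N : ℤ)) * l (v j))) :=
    hasSum_sum fun j hj => (Complex.hasSum_taylorSeries_on_ball (hY j hj)
      (by simpa using hz)).mul_right _
  rw [hX z h0 hz, map_sum]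
  have e : ∑ j ∈ s, l (g j z • v j) = ∑ j ∈ s, Y j z * (z ^ (-(N : ℤ)) * l (v j)) :=
    Finset.sum_congr rfl fun j hj => by rw [map_smul, hg j hj z h0 hz, smul_eq_mul, mul_assoc]
  rw [e]
  convert! h using 2 with n
  rw [map_sum, Finset.sum_mul]
  refine Finset.sum_congr rfl fun j _ => ?_
  rw [map_smul, sub_eq_add_neg, zpow_add₀ (norm_pos_iff.1 h0), zpow_natCast, sub_zero]
  simp only [smul_eq_mul]
  ring

variable [FiniteDimensional ℂ V]

theorem truncatedCircleIntegral_eq_sum {ι : Type*} (s : Finset ι) {f : ℂ → V} {g : ι → ℂ → ℂ}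
    {v : ι → V} {z : ℂ} (hz : z ≠ 0) {c : ι → ℂ} (hg : ∀ j ∈ s, HasScalarPV (g j) z (c j))
    (hf : ∀ w, ‖w‖ = ‖z‖ → w ≠ z → f w = ∑ j ∈ s, g j w • v j) {ε : ℝ} (h0 : 0 < ε)
    (h1 : ε < Real.pi) :
    truncatedCircleIntegral f z ε = ∑ j ∈ s, ((2 * (Real.pi : ℂ) * Complex.I)⁻¹ *
      ∫ θ in ε..(2 * Real.pi - ε), circleIntegrand (g j) z θ) • v j := by
  have hle : ε ≤ 2 * Real.pi - ε := by linarith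
  rw [truncatedCircleIntegral, vecIntegral]
  have key : ∀ i, ∫ θ in ε..(2 * Real.pi - ε), (Module.finBasis ℂ V).coord i
      ((Complex.I * (z * Complex.exp (Complex.I * θ))) • f (z * Complex.exp (Complex.I * θ))) =
      ∑ j ∈ s, (∫ θ in ε..(2 * Real.pi - ε), circleIntegrand (g j) z θ) *
        (Module.finBasis ℂ V).coord i (v j) := by
    intro i
    simp only [← intervalIntegral.integral_mul_const]
    rw [← intervalIntegral.integral_finsetSum fun j hj =>
      ((hg j hj).integrable ε h0 h1).mul_const _]
    refine intervalIntegral.integral_congr fun θ hθ => ?_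
    rw [Set.uIcc_of_le hle] at hθ
    rw [hf _ (norm_mul_exp_angle z θ) (mul_exp_angle_ne hz h0 hθ), map_smul, map_sum,
      Finset.smul_sum]
    refine Finset.sum_congr rfl fun j _ => ?_
    rw [map_smul, circleIntegrand, smul_eq_mul, smul_eq_mul]
    ring
  simp only [key, Finset.sum_smul, Finset.smul_sum]
  rw [Finset.sum_comm]
  refine Finset.sum_congr rfl fun j _ => ?_
  conv_rhs => rw [← (Module.finBasis ℂ V).sum_repr (v j), Finset.smul_sum]
  refine Finset.sum_congr rfl fun i _ => ?_
  rw [smul_smul, smul_smul, Module.Basis.coord_apply]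
  congr 1
  ring

/-- Reduces principal values of vectors to scalar ones; the vectors v j need not form a basis. -/
theorem hasPV_of_sum {ι : Type*} (s : Finset ι) {f : ℂ → V} {g : ι → ℂ → ℂ} {v : ι → V} {z : ℂ}
    (hz : z ≠ 0) {c : ι → ℂ} (hg : ∀ j ∈ s, HasScalarPV (g j) z (c j))
    (hf : ∀ w, ‖w‖ = ‖z‖ → w ≠ z → f w = ∑ j ∈ s, g j w • v j) :
    HasPV f z (∑ j ∈ s, c j • v j) := by
  intro l
  have h : Tendsto (fun ε : ℝ => ∑ j ∈ s, ((2 * (Real.pi : ℂ) * Complex.I)⁻¹ *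
      ∫ θ in ε..(2 * Real.pi - ε), circleIntegrand (g j) z θ) * l (v j)) (𝓝[>] 0)
      (𝓝 (∑ j ∈ s, c j * l (v j))) :=
    tendsto_finsetSum s fun j hj => (hg j hj).tendsto.mul_const _
  simp only [map_sum, map_smul, smul_eq_mul]
  refine h.congr' ?_
  filter_upwards [eventually_angle] with ε hε
  rw [truncatedCircleIntegral_eq_sum s hz hg hf hε.1 hε.2, map_sum]
  simp only [map_smul, smul_eq_mul]

theorem HasPV.pv_eq {f : ℂ → V} {z : ℂ} {v : V} (h : HasPV f z v) : pv f z = v := by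
  rw [pv]
  conv_rhs => rw [← (Module.finBasis ℂ V).sum_repr v]
  refine Finset.sum_congr rfl fun i _ => ?_
  rw [(h ((Module.finBasis ℂ V).coord i)).limUnder_eq]
  rfl

theorem HasPV.hasPV_pv {f : ℂ → V} {z : ℂ} {v : V} (h : HasPV f z v) : HasPV f z (pv f z) := by
  rwa [h.pv_eq]

theorem isDiffAt_dual (l : Module.Dual ℂ V) (x : V) : IsDiffAt (fun y => l y) x :=
  (LinearMap.toContinuousLinearMap
    (l ∘ₗ (Module.finBasis ℂ V).equivFun.symm.toLinearMap)).differentiableAt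

theorem IsDiffAt.comp {f : ℂ → ℂ} {F : V → ℂ} {x : V} (hf : DifferentiableAt ℂ f (F x))
    (hF : IsDiffAt F x) : IsDiffAt (fun y => f (F y)) x := by
  refine DifferentiableAt.comp (g := f) _ ?_ hF
  simpa using hf

theorem IsDiffAt.mul {F G : V → ℂ} {x : V} (hF : IsDiffAt F x) (hG : IsDiffAt G x) :
    IsDiffAt (fun y => F y * G y) x := DifferentiableAt.fun_mul hF hG

theorem IsDiffAt.sub {F G : V → ℂ} {x : V} (hF : IsDiffAt F x) (hG : IsDiffAt G x) :
    IsDiffAt (fun y => F y - G y) x := DifferentiableAt.fun_sub hF hG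

theorem IsDiffAt.const_mul {F : V → ℂ} {x : V} (hF : IsDiffAt F x) (c : ℂ) :
    IsDiffAt (fun y => c * F y) x := DifferentiableAt.const_mul hF c

theorem IsDiffAt.sum {ι : Type*} {s : Finset ι} {F : ι → V → ℂ} {x : V}
    (hF : ∀ i ∈ s, IsDiffAt (F i) x) : IsDiffAt (fun y => ∑ i ∈ s, F i y) x :=
  DifferentiableAt.fun_sum hF

theorem IsDiffAt.hasDerivAt_line {F : V → ℂ} {x : V} (hF : IsDiffAt F x) (v : V) :
    HasDerivAt (fun s : ℂ => F (x + s • v)) (differential F x v) 0 := by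
  set b := (Module.finBasis ℂ V).equivFun
  have hd : HasFDerivAt (fun c => F (b.symm c)) (fderiv ℂ (fun c => F (b.symm c)) (b x))
      (b x + (0 : ℂ) • b v) := by
    rw [zero_smul, add_zero]
    exact DifferentiableAt.hasFDerivAt hF
  have hl : HasDerivAt (fun s : ℂ => b x + s • b v) (b v) 0 := by
    simpa using ((hasDerivAt_id' (0 : ℂ)).smul_const (b v)).const_add (b x)
  have h := hd.comp_hasDerivAt (0 : ℂ) hl
  refine (h.congr_of_eventuallyEq (.of_forall fun s => ?_))
  simp

theorem IsDiffAt.differential_eq {F : V → ℂ} {x v : V} {d : ℂ} (hF : IsDiffAt F x)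
    (h : HasDerivAt (fun s : ℂ => F (x + s • v)) d 0) : differential F x v = d :=
  (hF.hasDerivAt_line v).unique h

theorem differential_dual (l : Module.Dual ℂ V) (x : V) : differential (fun y => l y) x = l := by
  ext v
  refine (isDiffAt_dual l x).differential_eq ?_
  simpa using ((hasDerivAt_id' (0 : ℂ)).mul_const (l v)).const_add (l x)

/-- Linear changes of variables. -/
theorem IsDiffAt.comp_linear {F : V → ℂ} {x : V} (A : V →ₗ[ℂ] V) (hF : IsDiffAt F (A x)) :
    IsDiffAt (fun y => F (A y)) x := by
  set b := (Module.finBasis ℂ V).equivFun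
  set T := LinearMap.toContinuousLinearMap (b.toLinearMap ∘ₗ A ∘ₗ b.symm.toLinearMap) with hT
  have hd : DifferentiableAt ℂ (fun c => F (b.symm c)) (T (b x)) := by
    have : T (b x) = b (A x) := by simp [hT]
    rw [this]
    exact hF
  have h := hd.comp (b x) T.differentiableAt
  have e1 : ((fun c => F (b.symm c)) ∘ T) = fun c => F (A (b.symm c)) := by
    funext w
    simp [hT]
  rw [e1] at h
  exact h

theorem differential_comp_linear {F : V → ℂ} {x : V} (A : V →ₗ[ℂ] V) (hF : IsDiffAt F (A x)) :
    differential (fun y => F (A y)) x = differential F (A x) ∘ₗ A := by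
  ext v
  refine (hF.comp_linear A).differential_eq ?_
  simpa using hF.hasDerivAt_line (A v)

end VectorCalculus

/-! ### Exponentials on eigenvectors -/

section LinExp

/-- The exponential series is summed in the normed algebra of continuous endomorphisms and carried
to matrices by the continuous algebra map `f`; there T^k v = c^k v termwise. -/
theorem matrix_exp_mulVec {n : ℕ} (M : Matrix (Fin n) (Fin n) ℂ) (v : Fin n → ℂ) (c : ℂ)
    (h : M.mulVec v = c • v) : (NormedSpace.exp M).mulVec v = Complex.exp c • v := by
  let f : ((Fin n → ℂ) →L[ℂ] (Fin n → ℂ)) →ₐ[ℂ] Matrix (Fin n) (Fin n) ℂ :=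
    (LinearMap.toMatrixAlgEquiv' (R := ℂ) (n := Fin n)).toAlgHom.comp
      (Module.End.toContinuousLinearMap (𝕜 := ℂ) (Fin n → ℂ)).symm.toAlgHom
  have hf : Continuous f := LinearMap.continuous_of_finiteDimensional f.toLinearMap
  have hfv : ∀ T w, (f T).mulVec w = T w := by
    intro T w
    change (LinearMap.toMatrix' _).mulVec w = _
    rw [LinearMap.toMatrix'_mulVec]
    rfl
  obtain ⟨T, rfl⟩ : ∃ T, f T = M :=
    ⟨Module.End.toContinuousLinearMap (Fin n → ℂ) (LinearMap.toMatrixAlgEquiv'.symm M), by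
      change LinearMap.toMatrixAlgEquiv' ((Module.End.toContinuousLinearMap _).symm _) = M
      simp⟩
  rw [hfv] at h
  have hexp : NormedSpace.exp (f T) = f (NormedSpace.exp T) := by
    have h1 := (NormedSpace.exp_series_hasSum_exp' (𝕂 := ℂ) T).map f.toLinearMap hf
    rw [NormedSpace.exp_eq_tsum ℂ]
    refine Eq.trans (tsum_congr fun k => ?_) h1.tsum_eq
    simp
  rw [hexp, hfv]
  have hpow : ∀ k : ℕ, (T ^ k) v = c ^ k • v := by
    intro k
    induction k with
    | zero => simp
    | succ k ih => rw [pow_succ', mul_apply_eq_comp, ih, map_smul, h, smul_smul, pow_succ]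
  have h1 := (NormedSpace.exp_series_hasSum_exp' (𝕂 := ℂ) T).mapL
    (ContinuousLinearMap.apply ℂ (Fin n → ℂ) v)
  have h2 := (NormedSpace.exp_series_hasSum_exp' (𝕂 := ℂ) c).smul_const v
  rw [← Complex.exp_eq_exp_ℂ] at h2
  refine h1.unique ?_
  convert! h2 using 2 with k
  simp [hpow, smul_smul]

theorem linExp_apply_of_eigenvector {V : Type*} [AddCommGroup V] [Module ℂ V]
    [FiniteDimensional ℂ V] (A : Module.End ℂ V) {v : V} {c : ℂ} (h : A v = c • v) :
    linExp A v = Complex.exp c • v := by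
  set b := Module.finBasis ℂ V with hb
  have h1 : (LinearMap.toMatrix b b A).mulVec (b.repr v) = c • (b.repr v : _ → ℂ) := by
    rw [LinearMap.toMatrix_mulVec_repr, h]
    simp
  have h2 := matrix_exp_mulVec _ _ _ h1
  rw [linExp, Matrix.toLin_apply, ← hb, h2]
  simp only [Pi.smul_apply, smul_eq_mul, mul_smul]
  rw [← Finset.smul_sum, b.sum_repr]

end LinExp

/-! ### Root space decomposition in a Cartan–Weyl basis -/

section CartanWeylBasis

variable {𝔤 : Type*} [LieRing 𝔤] [LieAlgebra ℂ 𝔤] [FiniteDimensional ℂ 𝔤] [LieAlgebra.IsKilling ℂ 𝔤]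
  {𝔥 : LieSubalgebra ℂ 𝔤} [𝔥.IsCartanSubalgebra]

/-- The element of `𝔥` dual to a weight under the Killing form. -/
def rootDual (α : Weight ℂ 𝔥 𝔤) : 𝔥 := (cartanEquivDual 𝔥).symm (Weight.toLinear ℂ 𝔥 𝔤 α)

theorem mem_root {α : Weight ℂ 𝔥 𝔤} : α ∈ 𝔥.root ↔ α.IsNonZero := by simp

theorem neg_mem_root {α : Weight ℂ 𝔥 𝔤} (h : α ∈ 𝔥.root) : -α ∈ 𝔥.root := by
  rw [mem_root] at h ⊢
  exact h.neg

theorem cartanEquivDual_apply (x y : 𝔥) : cartanEquivDual 𝔥 x y = killingForm ℂ 𝔤 (x : 𝔤) (y : 𝔤) :=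
  rfl

theorem killingForm_rootDual (α : Weight ℂ 𝔥 𝔤) (h : 𝔥) :
    killingForm ℂ 𝔤 (rootDual α : 𝔤) (h : 𝔤) = α h := by
  rw [← cartanEquivDual_apply, rootDual, LinearEquiv.apply_symm_apply, Weight.toLinear_apply]

theorem pair_eq (α : Weight ℂ 𝔥 𝔤) (q : Module.Dual ℂ 𝔥) : pair α q = q (rootDual α) := by
  obtain ⟨h, rfl⟩ := (cartanEquivDual 𝔥).surjective q
  rw [pair, LinearEquiv.symm_apply_apply, cartanEquivDual_apply, LieModule.traceForm_comm,
    killingForm_rootDual, Weight.toLinear_apply]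

theorem pair_neg (α : Weight ℂ 𝔥 𝔤) (q : Module.Dual ℂ 𝔥) : pair (-α) q = -pair α q := by
  rw [pair, pair, Weight.toLinear_neg, LinearMap.neg_apply]

theorem rootDual_neg (α : Weight ℂ 𝔥 𝔤) : rootDual (-α) = -rootDual α := by
  rw [rootDual, rootDual, Weight.toLinear_neg, map_neg]

theorem pair_add_smul (α : Weight ℂ 𝔥 𝔤) (q a : Module.Dual ℂ 𝔥) (s : ℂ) :
    pair α (q + s • a) = pair α q + s * pair α a := by
  simp [pair_eq]

theorem pair_of_toLinear_add {α β γ : Weight ℂ 𝔥 𝔤}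
    (h : Weight.toLinear ℂ 𝔥 𝔤 β = Weight.toLinear ℂ 𝔥 𝔤 α + Weight.toLinear ℂ 𝔥 𝔤 γ)
    (q : Module.Dual ℂ 𝔥) : pair β q = pair α q + pair γ q := by
  rw [pair, h, LinearMap.add_apply]
  rfl

/-- The roots span the dual of `𝔥`, so the element of `𝔥` corresponding to a is killed by every
functional. -/
theorem eq_zero_of_pair_eq_zero {a : Module.Dual ℂ 𝔥} (h : ∀ α ∈ 𝔥.root, pair α a = 0) : a = 0 := by
  have hs := span_weight_isNonZero_eq_top (K := ℂ) (L := 𝔤) (H := 𝔥)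
  have h0 : (cartanEquivDual 𝔥).symm a = 0 := by
    rw [← Module.forall_dual_apply_eq_zero_iff ℂ]
    intro l
    have hl : l ∈ Submodule.span ℂ ({α : Weight ℂ 𝔥 𝔤 | α.IsNonZero}.image (Weight.toLinear ℂ 𝔥 𝔤)) :=
      hs ▸ Submodule.mem_top
    induction hl using Submodule.span_induction with
    | mem l hl =>
      obtain ⟨α, hα, rfl⟩ := hl
      exact h α (mem_root.2 hα)
    | zero => simp
    | add l l' _ _ h1 h2 => rw [LinearMap.add_apply, h1, h2, add_zero]
    | smul c l _ h1 => rw [LinearMap.smul_apply, h1, smul_zero]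
  simpa using h0

theorem lie_eq_zero_of_cartan (h h' : 𝔥) : ⁅(h : 𝔤), (h' : 𝔤)⁆ = 0 := by
  have := congrArg (Subtype.val) (trivial_lie_zero 𝔥 𝔥 h h')
  simpa using this

namespace CartanWeyl

variable (B : CartanWeyl 𝔥)

theorem e_ne_zero {α : Weight ℂ 𝔥 𝔤} (hα : α ∈ 𝔥.root) : B.e α ≠ 0 := by
  intro h
  have := B.e_dual α hα
  simp [h] at this

theorem e_neg_mem {α : Weight ℂ 𝔥 𝔤} (hα : α ∈ 𝔥.root) : B.e (-α) ∈ rootSpace 𝔥 (-(α : 𝔥 → ℂ)) := by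
  have h := B.e_mem (-α) (neg_mem_root hα)
  rw [Weight.coe_neg] at h
  exact h

theorem lie_cartan_e {α : Weight ℂ 𝔥 𝔤} (hα : α ∈ 𝔥.root) (h : 𝔥) :
    ⁅(h : 𝔤), B.e α⁆ = α h • B.e α :=
  lie_eq_smul_of_mem_rootSpace (B.e_mem α hα) h

theorem lie_e_neg {α : Weight ℂ 𝔥 𝔤} (hα : α ∈ 𝔥.root) :
    ⁅B.e α, B.e (-α)⁆ = (rootDual α : 𝔤) := by
  rw [lie_eq_killingForm_smul_of_mem_rootSpace_of_mem_rootSpace_neg (B.e_mem α hα) (B.e_neg_mem hα),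
    B.e_dual α hα, one_smul]
  rfl

theorem exists_smul_e_of_mem {α : Weight ℂ 𝔥 𝔤} (hα : α ∈ 𝔥.root) {y : 𝔤}
    (hy : y ∈ rootSpace 𝔥 α) : ∃ c : ℂ, y = c • B.e α := by
  have h1 := finrank_rootSpace_eq_one α (mem_root.1 hα)
  obtain ⟨c, hc⟩ := (finrank_eq_one_iff_of_nonzero' (⟨B.e α, B.e_mem α hα⟩ : rootSpace 𝔥 α)
    (fun h => B.e_ne_zero hα (congrArg Subtype.val h))).1 h1 ⟨y, hy⟩
  exact ⟨c, (congrArg Subtype.val hc).symm⟩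

theorem lie_e_e {α γ : Weight ℂ 𝔥 𝔤} (hα : α ∈ 𝔥.root) (hγ : γ ∈ 𝔥.root) (hne : γ ≠ -α) :
    ⁅B.e α, B.e γ⁆ = 0 ∨ ∃ β ∈ 𝔥.root,
      Weight.toLinear ℂ 𝔥 𝔤 β = Weight.toLinear ℂ 𝔥 𝔤 α + Weight.toLinear ℂ 𝔥 𝔤 γ ∧
      ∃ c : ℂ, ⁅B.e α, B.e γ⁆ = c • B.e β := by
  have hmem := lie_mem_genWeightSpace_of_mem_genWeightSpace (B.e_mem α hα) (B.e_mem γ hγ)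
  by_cases hbot : genWeightSpace 𝔤 ((α : 𝔥 → ℂ) + (γ : 𝔥 → ℂ)) = ⊥
  · left
    rw [hbot] at hmem
    simpa using hmem
  · right
    let β : Weight ℂ 𝔥 𝔤 := ⟨(α : 𝔥 → ℂ) + (γ : 𝔥 → ℂ), hbot⟩
    have hβ : β ∈ 𝔥.root := by
      rw [mem_root]
      intro h0
      refine hne (Weight.ext fun x => ?_)
      have h1 : (α : 𝔥 → ℂ) + (γ : 𝔥 → ℂ) = 0 := h0
      have h2 : α x + γ x = 0 := congrFun h1 x
      rw [Weight.coe_neg, Pi.neg_apply]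
      linear_combination h2
    refine ⟨β, hβ, ?_, B.exists_smul_e_of_mem hβ hmem⟩
    ext x
    rfl

theorem killingForm_e_e {α γ : Weight ℂ 𝔥 𝔤} (hα : α ∈ 𝔥.root) (hγ : γ ∈ 𝔥.root) (hne : γ ≠ -α) :
    killingForm ℂ 𝔤 (B.e α) (B.e γ) = 0 := by
  refine killingForm_apply_eq_zero_of_mem_rootSpace_of_add_ne_zero ℂ 𝔤 𝔥 (B.e_mem α hα)
    (B.e_mem γ hγ) fun h => hne (Weight.ext fun x => ?_)
  have h2 : α x + γ x = 0 := congrFun h x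
  rw [Weight.coe_neg, Pi.neg_apply]
  linear_combination h2

theorem cartan_mem_rootSpace (h : 𝔥) : (h : 𝔤) ∈ rootSpace 𝔥 (0 : 𝔥 → ℂ) :=
  LieAlgebra.toLieSubmodule_le_rootSpace_zero ℂ 𝔤 𝔥 h.2

theorem killingForm_cartan_e {α : Weight ℂ 𝔥 𝔤} (hα : α ∈ 𝔥.root) (h : 𝔥) :
    killingForm ℂ 𝔤 (h : 𝔤) (B.e α) = 0 := by
  refine killingForm_apply_eq_zero_of_mem_rootSpace_of_add_ne_zero ℂ 𝔤 𝔥 (cartan_mem_rootSpace h)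
    (B.e_mem α hα) fun h => mem_root.1 hα ?_
  rw [zero_add] at h
  exact h

theorem killingForm_e_cartan {α : Weight ℂ 𝔥 𝔤} (hα : α ∈ 𝔥.root) (h : 𝔥) :
    killingForm ℂ 𝔤 (B.e α) (h : 𝔤) = 0 := by
  rw [LieModule.traceForm_comm]
  exact B.killingForm_cartan_e hα h

/-- The root space decomposition as an induction principle: the zero weight space is `𝔥`, and all
other weight spaces are lines. -/
theorem induction {P : 𝔤 → Prop} (cartan : ∀ h : 𝔥, P h)
    (root : ∀ α ∈ 𝔥.root, ∀ c : ℂ, P (c • B.e α))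
    (add : ∀ x y, P x → P y → P (x + y)) (y : 𝔤) : P y := by
  have hy : y ∈ ⨆ χ : Weight ℂ 𝔥 𝔤, genWeightSpace 𝔤 χ := by
    rw [LieModule.iSup_genWeightSpace_eq_top' ℂ 𝔥 𝔤]
    trivial
  refine LieSubmodule.iSup_induction (motive := P) _ hy (fun α x hx => ?_) (by simpa using cartan 0) add
  by_cases hα : α ∈ 𝔥.root
  · obtain ⟨c, rfl⟩ := B.exists_smul_e_of_mem hα hx
    exact root α hα c
  · rw [mem_root] at hα
    have h0 : (α : 𝔥 → ℂ) = 0 := by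
      by_contra h
      exact hα h
    rw [h0] at hx
    have hx' : x ∈ rootSpace 𝔥 (0 : 𝔥 → ℂ) := hx
    rw [LieAlgebra.rootSpace_zero_eq] at hx'
    exact cartan ⟨x, hx'⟩

theorem repr_eq_killingForm (h : 𝔥) (i) : B.h.repr h i = killingForm ℂ 𝔤 (B.h i : 𝔤) (h : 𝔤) := by
  conv_rhs => rw [← B.h.sum_repr h]
  push_cast
  simp only [map_sum, map_smul, B.h_orthonormal, smul_eq_mul, mul_ite, mul_one, mul_zero,
    Finset.sum_ite_eq, Finset.mem_univ, if_true]

theorem sum_killingForm_smul (h : 𝔥) :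
    ∑ i, killingForm ℂ 𝔤 (B.h i : 𝔤) (h : 𝔤) • B.h i = h := by
  simp only [← B.repr_eq_killingForm]
  exact B.h.sum_repr h

theorem sum_killingForm_smul_coe (h : 𝔥) :
    ∑ i, killingForm ℂ 𝔤 (B.h i : 𝔤) (h : 𝔤) • (B.h i : 𝔤) = h := by
  conv_rhs => rw [← B.sum_killingForm_smul h]
  push_cast
  rfl

/-- The Cartan part of `ξ ∈ 𝔤* ≅ 𝔤`. -/
def cartanPart (ξ : Module.Dual ℂ 𝔤) : 𝔥 := ∑ i, ξ (B.h i) • B.h i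

theorem killingForm_cartanPart (ξ : Module.Dual ℂ 𝔤) (h : 𝔥) :
    killingForm ℂ 𝔤 (B.cartanPart ξ : 𝔤) (h : 𝔤) = ξ h := by
  conv_rhs => rw [← B.sum_killingForm_smul_coe h]
  simp only [cartanPart, map_sum, map_smul, smul_eq_mul]
  push_cast
  rw [map_sum, LinearMap.sum_apply]
  refine Finset.sum_congr rfl fun i _ => ?_
  rw [map_smul, LinearMap.smul_apply, smul_eq_mul, mul_comm]

theorem weight_cartanPart (ξ : Module.Dual ℂ 𝔤) (α : Weight ℂ 𝔥 𝔤) :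
    α (B.cartanPart ξ) = ξ (rootDual α : 𝔤) := by
  rw [← killingForm_rootDual, LieModule.traceForm_comm, B.killingForm_cartanPart]

theorem neg_eq_iff_of_root {α γ : Weight ℂ 𝔥 𝔤} : γ = -α ↔ α = -γ := by
  constructor <;> (rintro rfl; simp)

theorem sum_mul_killingForm_e {α : Weight ℂ 𝔥 𝔤} (hα : α ∈ 𝔥.root) (f : Weight ℂ 𝔥 𝔤 → ℂ) :
    ∑ β ∈ 𝔥.root, f β * killingForm ℂ 𝔤 (B.e β) (B.e α) = f (-α) := by
  classical
  rw [Finset.sum_eq_single_of_mem (-α) (neg_mem_root hα)]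
  · have := B.e_dual (-α) (neg_mem_root hα)
    rw [neg_neg] at this
    rw [this, mul_one]
  · intro β hβ hne
    rw [B.killingForm_e_e hβ hα (fun h => hne (neg_eq_iff_of_root.1 h)), mul_zero]

/-- `ξ` as an element of `𝔤`. -/
theorem dual_apply_eq (ξ : Module.Dual ℂ 𝔤) (y : 𝔤) :
    ξ y = killingForm ℂ 𝔤 (B.cartanPart ξ + ∑ α ∈ 𝔥.root, B.spin ξ α • B.e α) y := by
  induction y using B.induction with
  | cartan h =>
    simp only [map_add, map_sum, map_smul, LinearMap.add_apply, LinearMap.sum_apply,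
      LinearMap.smul_apply, smul_eq_mul]
    rw [B.killingForm_cartanPart, Finset.sum_eq_zero, add_zero]
    intro α hα
    rw [B.killingForm_e_cartan hα, mul_zero]
  | root α hα c =>
    simp only [map_add, map_sum, map_smul, LinearMap.add_apply, LinearMap.sum_apply,
      LinearMap.smul_apply, smul_eq_mul]
    rw [B.killingForm_cartan_e hα, B.sum_mul_killingForm_e hα, spin, neg_neg, zero_add]
  | add x y hx hy => rw [map_add, map_add, hx, hy]

end CartanWeyl

end CartanWeylBasis

/-! ### The Poisson structure and the torus action -/

section Gradients

variable {𝔤 : Type*} [LieRing 𝔤] [LieAlgebra ℂ 𝔤] [FiniteDimensional ℂ 𝔤] {𝔥 : LieSubalgebra ℂ 𝔤}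

theorem apply_gradQ (F : Phase 𝔥 → ℂ) (x : Phase 𝔥) (η : Module.Dual ℂ 𝔥) :
    η (gradQ F x) = differential F x (η, 0, 0) := by
  have h := Module.apply_evalEquiv_symm_apply (R := ℂ) (M := 𝔥) η
    (differential F x ∘ₗ LinearMap.inl ℂ (Module.Dual ℂ 𝔥) (𝔥 × Module.Dual ℂ 𝔤))
  exact h

theorem gradP_apply (F : Phase 𝔥 → ℂ) (x : Phase 𝔥) (y : 𝔥) :
    gradP F x y = differential F x (0, y, 0) := rfl

theorem apply_gradXi (F : Phase 𝔥 → ℂ) (x : Phase 𝔥) (η : Module.Dual ℂ 𝔤) :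
    η (gradXi F x) = differential F x (0, 0, η) := by
  have h := Module.apply_evalEquiv_symm_apply (R := ℂ) (M := 𝔤) η
    (differential F x ∘ₗ LinearMap.inr ℂ (Module.Dual ℂ 𝔥) (𝔥 × Module.Dual ℂ 𝔤) ∘ₗ
      LinearMap.inr ℂ 𝔥 (Module.Dual ℂ 𝔤))
  exact h

theorem eq_of_forall_dual {V : Type*} [AddCommGroup V] [Module ℂ V] {v w : V}
    (h : ∀ l : Module.Dual ℂ V, l v = l w) : v = w := by
  rw [← sub_eq_zero, ← Module.forall_dual_apply_eq_zero_iff ℂ]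
  intro l
  rw [map_sub, h l, sub_self]

variable (x : Phase 𝔥)

/-- The Hamiltonian vector field on linear functions of `p`. -/
theorem poisson_momentum (l : Module.Dual ℂ 𝔥) (H : Phase 𝔥 → ℂ) :
    poisson (fun y : Phase 𝔥 => l y.2.1) H x = l (gradQ H x) := by
  let F : Module.Dual ℂ (Phase 𝔥) := l ∘ₗ LinearMap.fst ℂ 𝔥 (Module.Dual ℂ 𝔤) ∘ₗ
    LinearMap.snd ℂ (Module.Dual ℂ 𝔥) (𝔥 × Module.Dual ℂ 𝔤)
  have hF : (fun y : Phase 𝔥 => l y.2.1) = fun y => F y := rfl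
  have h1 : gradP (fun y => F y) x = l := by
    ext y
    rw [gradP_apply, differential_dual]
    rfl
  have h2 : gradQ (fun y => F y) x = 0 := eq_of_forall_dual fun η => by
    rw [apply_gradQ, differential_dual, map_zero]
    exact map_zero l
  have h3 : gradXi (fun y => F y) x = 0 := eq_of_forall_dual fun η => by
    rw [apply_gradXi, differential_dual, map_zero]
    exact map_zero l
  rw [hF, poisson, h1, h2, h3, zero_lie, map_zero, map_zero, sub_zero, add_zero]

theorem poisson_position (h : 𝔥) (H : Phase 𝔥 → ℂ) :
    poisson (fun y : Phase 𝔥 => y.1 h) H x = -gradP H x h := by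
  let F : Module.Dual ℂ (Phase 𝔥) := Module.Dual.eval ℂ 𝔥 h ∘ₗ
    LinearMap.fst ℂ (Module.Dual ℂ 𝔥) (𝔥 × Module.Dual ℂ 𝔤)
  have hF : (fun y : Phase 𝔥 => y.1 h) = fun y => F y := rfl
  have h1 : gradP (fun y => F y) x = 0 := by
    ext y
    rw [gradP_apply, differential_dual]
    rfl
  have h2 : gradQ (fun y => F y) x = h := eq_of_forall_dual fun η => by
    rw [apply_gradQ, differential_dual]
    rfl
  have h3 : gradXi (fun y => F y) x = 0 := eq_of_forall_dual fun η => by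
    rw [apply_gradXi, differential_dual, map_zero]
    rfl
  rw [hF, poisson, h1, h2, h3, zero_lie, map_zero, LinearMap.zero_apply, zero_sub, add_zero]

theorem poisson_spin (y : 𝔤) (H : Phase 𝔥 → ℂ) :
    poisson (fun s : Phase 𝔥 => s.2.2 y) H x = x.2.2 ⁅y, gradXi H x⁆ := by
  let F : Module.Dual ℂ (Phase 𝔥) := Module.Dual.eval ℂ 𝔤 y ∘ₗ
    LinearMap.snd ℂ 𝔥 (Module.Dual ℂ 𝔤) ∘ₗ LinearMap.snd ℂ (Module.Dual ℂ 𝔥) (𝔥 × Module.Dual ℂ 𝔤)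
  have hF : (fun s : Phase 𝔥 => s.2.2 y) = fun s => F s := rfl
  have h1 : gradP (fun y => F y) x = 0 := by
    ext y
    rw [gradP_apply, differential_dual]
    rfl
  have h2 : gradQ (fun y => F y) x = 0 := eq_of_forall_dual fun η => by
    rw [apply_gradQ, differential_dual, map_zero]
    rfl
  have h3 : gradXi (fun y => F y) x = y := eq_of_forall_dual fun η => by
    rw [apply_gradXi, differential_dual]
    rfl
  rw [hF, poisson, h1, h2, h3, map_zero, LinearMap.zero_apply, zero_sub, neg_zero, zero_add]

theorem IsTrajectory.hasDerivAt_momentum {H : Phase 𝔥 → ℂ} {γ : ℝ → Phase 𝔥} {I : Set ℝ}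
    (hγ : IsTrajectory H γ I) {t : ℝ} (ht : t ∈ I) (l : Module.Dual ℂ 𝔥) :
    HasDerivAt (fun s => l (γ s).2.1) (l (gradQ H (γ t))) t := by
  rw [← poisson_momentum]
  exact hγ t ht (l ∘ₗ LinearMap.fst ℂ 𝔥 (Module.Dual ℂ 𝔤) ∘ₗ
    LinearMap.snd ℂ (Module.Dual ℂ 𝔥) (𝔥 × Module.Dual ℂ 𝔤))

theorem IsTrajectory.hasDerivAt_position {H : Phase 𝔥 → ℂ} {γ : ℝ → Phase 𝔥} {I : Set ℝ}
    (hγ : IsTrajectory H γ I) {t : ℝ} (ht : t ∈ I) (h : 𝔥) :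
    HasDerivAt (fun s => (γ s).1 h) (-gradP H (γ t) h) t := by
  rw [← poisson_position]
  exact hγ t ht (Module.Dual.eval ℂ 𝔥 h ∘ₗ
    LinearMap.fst ℂ (Module.Dual ℂ 𝔥) (𝔥 × Module.Dual ℂ 𝔤))

theorem IsTrajectory.hasDerivAt_spin {H : Phase 𝔥 → ℂ} {γ : ℝ → Phase 𝔥} {I : Set ℝ}
    (hγ : IsTrajectory H γ I) {t : ℝ} (ht : t ∈ I) (y : 𝔤) :
    HasDerivAt (fun s => (γ s).2.2 y) ((γ t).2.2 ⁅y, gradXi H (γ t)⁆) t := by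
  rw [← poisson_spin]
  exact hγ t ht (Module.Dual.eval ℂ 𝔤 y ∘ₗ
    LinearMap.snd ℂ 𝔥 (Module.Dual ℂ 𝔤) ∘ₗ
      LinearMap.snd ℂ (Module.Dual ℂ 𝔥) (𝔥 × Module.Dual ℂ 𝔤))

end Gradients

/-! ### The action of the Cartan torus and its momentum map -/

section Torus

variable {𝔤 : Type*} [LieRing 𝔤] [LieAlgebra ℂ 𝔤] [FiniteDimensional ℂ 𝔤] [LieAlgebra.IsKilling ℂ 𝔤]
  {𝔥 : LieSubalgebra ℂ 𝔤} [𝔥.IsCartanSubalgebra]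

/-- `𝔤` is spanned by eigenvectors of `ad h`. -/
theorem CartanWeyl.eigen_induction (B : CartanWeyl 𝔥) {P : 𝔤 → Prop} (h : 𝔥)
    (eigen : ∀ y (c : ℂ), ⁅(h : 𝔤), y⁆ = c • y → P y)
    (add : ∀ x y, P x → P y → P (x + y)) (y : 𝔤) : P y := by
  refine B.induction (fun h' => eigen _ 0 ?_) (fun α hα c => eigen _ (α h) ?_) add y
  · rw [lie_eq_zero_of_cartan, zero_smul]
  · rw [lie_smul, B.lie_cartan_e hα, smul_comm]

theorem linExp_ad_apply (h : 𝔥) {y : 𝔤} {c : ℂ} (hy : ⁅(h : 𝔤), y⁆ = c • y) :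
    linExp (LieAlgebra.ad ℂ 𝔤 (h : 𝔤)) y = Complex.exp c • y :=
  linExp_apply_of_eigenvector _ (by rw [LieAlgebra.ad_apply, hy])

/-- On eigenvectors of ad h the eigenvalues add under the bracket, and exp turns the sum into a
product. -/
theorem linExp_ad_lie (B : CartanWeyl 𝔥) (h : 𝔥) (x y : 𝔤) :
    linExp (LieAlgebra.ad ℂ 𝔤 (h : 𝔤)) ⁅x, y⁆ =
      ⁅linExp (LieAlgebra.ad ℂ 𝔤 (h : 𝔤)) x, linExp (LieAlgebra.ad ℂ 𝔤 (h : 𝔤)) y⁆ := by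
  induction x using B.eigen_induction h with
  | add x x' hx hx' => simp only [add_lie, map_add, hx, hx']
  | eigen x a hx =>
    induction y using B.eigen_induction h with
    | add y y' hy hy' => simp only [lie_add, map_add, hy, hy']
    | eigen y b hy =>
      have hxy : ⁅(h : 𝔤), ⁅x, y⁆⁆ = (a + b) • ⁅x, y⁆ := by
        rw [leibniz_lie, hx, hy, smul_lie, lie_smul, add_smul]
      rw [linExp_ad_apply h hx, linExp_ad_apply h hy, linExp_ad_apply h hxy, smul_lie, lie_smul,
        smul_smul, Complex.exp_add]

theorem torus_lie (B : CartanWeyl 𝔥) (g : cartanTorus 𝔥) :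
    (∀ x y : 𝔤, (g : 𝔤 ≃ₗ[ℂ] 𝔤) ⁅x, y⁆ = ⁅(g : 𝔤 ≃ₗ[ℂ] 𝔤) x, (g : 𝔤 ≃ₗ[ℂ] 𝔤) y⁆) ∧
      ∀ h : 𝔥, (g : 𝔤 ≃ₗ[ℂ] 𝔤) (h : 𝔤) = h := by
  obtain ⟨g, hg⟩ := g
  change (∀ x y : 𝔤, g ⁅x, y⁆ = ⁅g x, g y⁆) ∧ ∀ h : 𝔥, g (h : 𝔤) = h
  induction hg using Subgroup.closure_induction with
  | mem g hg =>
    obtain ⟨h, hh⟩ := hg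
    have hg' : ∀ y, g y = linExp (LieAlgebra.ad ℂ 𝔤 (h : 𝔤)) y := fun y => LinearMap.congr_fun hh y
    refine ⟨fun x y => ?_, fun h' => ?_⟩
    · rw [hg', hg', hg', linExp_ad_lie B]
    · rw [hg', linExp_ad_apply h (c := 0) (by rw [lie_eq_zero_of_cartan, zero_smul]),
        Complex.exp_zero, one_smul]
  | one => exact ⟨fun _ _ => rfl, fun _ => rfl⟩
  | mul g g' _ _ h h' =>
    refine ⟨fun x y => ?_, fun k => ?_⟩
    · rw [LinearEquiv.mul_apply, LinearEquiv.mul_apply, LinearEquiv.mul_apply, h'.1, h.1]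
    · rw [LinearEquiv.mul_apply, h'.2, h.2]
  | inv g _ h =>
    have hinv : ∀ y, g (g⁻¹ y) = y := fun y => LinearEquiv.apply_symm_apply g y
    refine ⟨fun x y => g.injective ?_, fun k => g.injective ?_⟩
    · rw [h.1, hinv, hinv, hinv]
    · rw [hinv, h.2]

/-- An automorphism fixing `𝔥` pointwise preserves each weight space, and root spaces are lines.
Applying it to [e_α, e_{-α}], a nonzero element of `𝔥`, forces c c' = 1; hence ξ_α ξ_{-α} is
invariant. -/
theorem torus_apply_e (B : CartanWeyl 𝔥) (g : cartanTorus 𝔥) {α : Weight ℂ 𝔥 𝔤} (hα : α ∈ 𝔥.root) :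
    ∃ c c' : ℂ, (g : 𝔤 ≃ₗ[ℂ] 𝔤) (B.e α) = c • B.e α ∧ (g : 𝔤 ≃ₗ[ℂ] 𝔤) (B.e (-α)) = c' • B.e (-α) ∧
      c * c' = 1 := by
  obtain ⟨hlie, hfix⟩ := torus_lie B g
  have key : ∀ β ∈ 𝔥.root, ∃ c : ℂ, (g : 𝔤 ≃ₗ[ℂ] 𝔤) (B.e β) = c • B.e β := by
    intro β hβ
    refine B.exists_smul_e_of_mem hβ (LieModule.weightSpace_le_genWeightSpace 𝔤 (β : 𝔥 → ℂ) ?_)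
    rw [LieModule.mem_weightSpace]
    intro h
    have h1 := hlie h (B.e β)
    rw [hfix, B.lie_cartan_e hβ, map_smul] at h1
    exact h1.symm
  obtain ⟨c, hc⟩ := key α hα
  obtain ⟨c', hc'⟩ := key (-α) (neg_mem_root hα)
  refine ⟨c, c', hc, hc', ?_⟩
  have h1 := hlie (B.e α) (B.e (-α))
  rw [B.lie_e_neg hα, hfix, hc, hc', smul_lie, lie_smul, B.lie_e_neg hα, smul_smul] at h1
  have h2 : (rootDual α : 𝔤) ≠ 0 := by
    intro h0
    refine mem_root.1 hα (funext fun k => ?_)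
    rw [← killingForm_rootDual, h0, map_zero, LinearMap.zero_apply]
    rfl
  have h3 : (c * c' - 1) • (rootDual α : 𝔤) = 0 := by rw [sub_smul, one_smul, ← h1, sub_self]
  exact sub_eq_zero.1 ((smul_eq_zero.1 h3).resolve_right h2)

theorem spin_act_mul (B : CartanWeyl 𝔥) (g : cartanTorus 𝔥) (x : Phase 𝔥) {α : Weight ℂ 𝔥 𝔤}
    (hα : α ∈ 𝔥.root) :
    B.spin (act g x).2.2 α * B.spin (act g x).2.2 (-α) = B.spin x.2.2 α * B.spin x.2.2 (-α) := by
  obtain ⟨c, c', hc, hc', h1⟩ := torus_apply_e B g⁻¹ hα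
  have e1 : B.spin (act g x).2.2 α = x.2.2 (((g⁻¹ : cartanTorus 𝔥) : 𝔤 ≃ₗ[ℂ] 𝔤) (B.e (-α))) := rfl
  have e2 : B.spin (act g x).2.2 (-α) =
      x.2.2 (((g⁻¹ : cartanTorus 𝔥) : 𝔤 ≃ₗ[ℂ] 𝔤) (B.e (- -α))) := rfl
  rw [e1, e2, neg_neg, hc, hc', CartanWeyl.spin, CartanWeyl.spin, neg_neg, map_smul, map_smul,
    smul_eq_mul, smul_eq_mul]
  linear_combination (x.2.2 (B.e (-α)) * x.2.2 (B.e α)) * h1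

theorem J_act (B : CartanWeyl 𝔥) (g : cartanTorus 𝔥) (x : Phase 𝔥) : J (act g x) = J x := by
  ext h
  change x.2.2 (((g⁻¹ : cartanTorus 𝔥) : 𝔤 ≃ₗ[ℂ] 𝔤) (h : 𝔤)) = x.2.2 h
  rw [(torus_lie B g⁻¹).2]

/-- The action of an element of the torus, as a linear map. -/
def actLinear (g : cartanTorus 𝔥) : Phase 𝔥 →ₗ[ℂ] Phase 𝔥 :=
  LinearMap.prodMap LinearMap.id (LinearMap.prodMap LinearMap.id
    (Module.Dual.transpose (R := ℂ) ((g⁻¹ : cartanTorus 𝔥) : 𝔤 ≃ₗ[ℂ] 𝔤).toLinearMap))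

theorem actLinear_apply (g : cartanTorus 𝔥) (x : Phase 𝔥) : actLinear g x = act g x := rfl

/-- Only the gradient in ξ changes, by g⁻¹, and g⁻¹ respects the bracket of `𝔤`. -/
theorem poisson_act (B : CartanWeyl 𝔥) (g : cartanTorus 𝔥) (F G : Phase 𝔥 → ℂ) (x : Phase 𝔥)
    (hF : IsDiffAt F (act g x)) (hG : IsDiffAt G (act g x)) :
    poisson (fun y => F (act g y)) (fun y => G (act g y)) x = poisson F G (act g x) := by
  have hP : ∀ F : Phase 𝔥 → ℂ, IsDiffAt F (act g x) →
      gradP (fun y => F (act g y)) x = gradP F (act g x) := by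
    intro F hF
    ext y
    rw [gradP_apply, gradP_apply]
    have := differential_comp_linear (actLinear g) (x := x) hF
    simp only [actLinear_apply] at this
    rw [this, LinearMap.comp_apply]
    simp [actLinear]
  have hQ : ∀ F : Phase 𝔥 → ℂ, IsDiffAt F (act g x) →
      gradQ (fun y => F (act g y)) x = gradQ F (act g x) := by
    intro F hF
    refine eq_of_forall_dual fun η => ?_
    rw [apply_gradQ, apply_gradQ]
    have := differential_comp_linear (actLinear g) (x := x) hF
    simp only [actLinear_apply] at this
    rw [this, LinearMap.comp_apply]
    simp [actLinear]
  have hXi : ∀ F : Phase 𝔥 → ℂ, IsDiffAt F (act g x) → gradXi (fun y => F (act g y)) x =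
      ((g⁻¹ : cartanTorus 𝔥) : 𝔤 ≃ₗ[ℂ] 𝔤) (gradXi F (act g x)) := by
    intro F hF
    refine eq_of_forall_dual fun η => ?_
    have h2 : η (((g⁻¹ : cartanTorus 𝔥) : 𝔤 ≃ₗ[ℂ] 𝔤) (gradXi F (act g x))) =
        (η ∘ₗ ((g⁻¹ : cartanTorus 𝔥) : 𝔤 ≃ₗ[ℂ] 𝔤).toLinearMap) (gradXi F (act g x)) := rfl
    rw [apply_gradXi, h2, apply_gradXi]
    have := differential_comp_linear (actLinear g) (x := x) hF
    simp only [actLinear_apply] at this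
    rw [this, LinearMap.comp_apply]
    congr 1
  rw [poisson, poisson, hP F hF, hP G hG, hQ F hF, hQ G hG, hXi F hF, hXi G hG,
    ← (torus_lie B g⁻¹).1]
  rfl

/-- The action moves only ξ, on which F is affine with slope `gradXi F x`. The resulting curve
exp(−s ad h) y is differentiated on eigenvectors y of ad h, where it is multiplication by e^{−sc}.
-/
theorem hasDerivAt_act_torusExp (B : CartanWeyl 𝔥) (h : 𝔥) (x : Phase 𝔥)
    (F : Module.Dual ℂ (Phase 𝔥)) :
    HasDerivAt (fun s : ℂ => F (act (torusExp (s • h)) x))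
      (poisson F (fun y => J y h) x) 0 := by
  have hJ : (fun y : Phase 𝔥 => J y h) = fun y => (Module.Dual.eval ℂ 𝔤 (h : 𝔤) ∘ₗ
    LinearMap.snd ℂ 𝔥 (Module.Dual ℂ 𝔤) ∘ₗ
      LinearMap.snd ℂ (Module.Dual ℂ 𝔥) (𝔥 × Module.Dual ℂ 𝔤)) y := rfl
  have hP : gradP (fun y : Phase 𝔥 => J y h) x = 0 := by
    ext y
    rw [hJ, gradP_apply, differential_dual]
    rfl
  have hQ : gradQ (fun y : Phase 𝔥 => J y h) x = 0 := eq_of_forall_dual fun η => by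
    rw [hJ, apply_gradQ, differential_dual, map_zero]
    rfl
  have hXi : gradXi (fun y : Phase 𝔥 => J y h) x = h := eq_of_forall_dual fun η => by
    rw [hJ, apply_gradXi, differential_dual]
    rfl
  have hF : ∀ η : Module.Dual ℂ 𝔤, F (x.1, x.2.1, η) = F (x.1, x.2.1, 0) + η (gradXi F x) := by
    intro η
    rw [apply_gradXi]
    have : (x.1, x.2.1, η) = (x.1, x.2.1, (0 : Module.Dual ℂ 𝔤)) + (0, 0, η) := by simp
    rw [this, map_add]
    congr 1
    exact (LinearMap.congr_fun (differential_dual F x) _).symm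
  have hy : ∀ y : 𝔤, HasDerivAt (fun s : ℂ => x.2.2
      (linExp (-LieAlgebra.ad ℂ 𝔤 ((s • h : 𝔥) : 𝔤)) y)) (x.2.2 ⁅y, (h : 𝔤)⁆) 0 := by
    refine B.eigen_induction h (fun y c hy => ?_) (fun y y' hy hy' => ?_)
    · have e : ∀ s : ℂ, linExp (-LieAlgebra.ad ℂ 𝔤 ((s • h : 𝔥) : 𝔤)) y =
          Complex.exp (-(s * c)) • y := by
        intro s
        refine linExp_apply_of_eigenvector _ ?_
        simp [hy, smul_smul]
      simp only [e, map_smul, smul_eq_mul]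
      rw [← lie_skew, hy]
      have h1 := (((hasDerivAt_id' (0 : ℂ)).mul_const c).neg.cexp).mul_const (x.2.2 y)
      exact h1.congr_deriv (by simp)
    · simp only [map_add, add_lie]
      exact hy.add hy'
  have hact : ∀ s : ℂ, F (act (torusExp (s • h)) x) = F (x.1, x.2.1, 0) +
      x.2.2 (linExp (-LieAlgebra.ad ℂ 𝔤 ((s • h : 𝔥) : 𝔤)) (gradXi F x)) := fun s => hF _
  simp only [hact]
  rw [poisson, hP, hQ, hXi, map_zero, LinearMap.zero_apply, sub_zero, zero_add]
  exact (hy _).const_add _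

end Torus

/-! ### Coefficient functions of the dynamical `r`-matrices -/

section Profiles

variable {𝔤 : Type*} [LieRing 𝔤] [LieAlgebra ℂ 𝔤] [FiniteDimensional ℂ 𝔤] [LieAlgebra.IsKilling ℂ 𝔤]

/-- Coefficients of an `r`-matrix `a(z) ∑ h_i ⊗ h_i + ∑ φ_α((α, q), z) e_α ⊗ e_{-α}`, together with
the constant terms `c_α(u)` of `φ_α(u, ·)` and the potentials `V_α(u)` of the Hamiltonian. -/
structure Profile (𝔥 : LieSubalgebra ℂ 𝔤) [𝔥.IsCartanSubalgebra] where
  a : ℂ → ℂ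
  φ : Weight ℂ 𝔥 𝔤 → ℂ → ℂ → ℂ
  c : Weight ℂ 𝔥 𝔤 → ℂ → ℂ
  V : Weight ℂ 𝔥 𝔤 → ℂ → ℂ
  dom : Weight ℂ 𝔥 𝔤 → Set ℂ
  constraint : Set (Module.Dual ℂ 𝔥)

variable {𝔥 : LieSubalgebra ℂ 𝔤} [𝔥.IsCartanSubalgebra]

/-- The functional and differential equations satisfied by the coefficients of a canonical
dynamical `r`-matrix with spectral parameter. -/
structure Profile.IsCanonical (P : Profile 𝔥) (r₀ : ℝ) : Prop where
  isOpen_dom : ∀ α ∈ 𝔥.root, IsOpen (P.dom α)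
  neg_mem_dom : ∀ α ∈ 𝔥.root, ∀ u ∈ P.dom α, -u ∈ P.dom (-α)
  -- Since s 0 = 0, the function a has neither a constant nor a linear term. This keeps i*ξ and
  -- additive constants out of the Hamiltonian; in the trigonometric case it is what the summand z/3
  -- achieves.
  exists_a : ∃ s : ℂ → ℂ, DifferentiableOn ℂ s (Metric.ball 0 r₀) ∧ s 0 = 0 ∧
    HasSimplePole P.a (fun z => z * s z) r₀
  a_neg : ∀ z, P.a (-z) = -P.a z
  exists_φ : ∀ α ∈ 𝔥.root, ∀ u ∈ P.dom α, ∃ h, HasSimplePole (P.φ α u) h r₀ ∧ h 0 = P.c α u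
  φ_neg : ∀ α ∈ 𝔥.root, ∀ u z, P.φ (-α) (-u) (-z) = -P.φ α u z
  c_neg : ∀ α ∈ 𝔥.root, ∀ u, P.c (-α) (-u) = -P.c α u
  hasDerivAt_φ : ∀ α ∈ 𝔥.root, ∀ u ∈ P.dom α, ∀ z, 0 < ‖z‖ → ‖z‖ < r₀ →
    HasDerivAt (fun v => P.φ α v z) (deriv (P.φ α u) z + (P.a z - P.c α u) * P.φ α u z) u
  φ_mul_φ_neg : ∀ α ∈ 𝔥.root, ∀ u ∈ P.dom α, ∀ z, 0 < ‖z‖ → ‖z‖ < r₀ →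
    P.φ α u z * P.φ (-α) (-u) z = -deriv P.a z - P.V α u
  φ_add : ∀ α ∈ 𝔥.root, ∀ γ ∈ 𝔥.root, ∀ β ∈ 𝔥.root,
    Weight.toLinear ℂ 𝔥 𝔤 β = Weight.toLinear ℂ 𝔥 𝔤 α + Weight.toLinear ℂ 𝔥 𝔤 γ →
    ∀ u ∈ P.dom α, ∀ v ∈ P.dom γ, u + v ∈ P.dom β → ∀ z, 0 < ‖z‖ → ‖z‖ < r₀ →
    deriv (P.φ α u) z * P.φ γ v z - P.φ α u z * deriv (P.φ γ v) z -
      (P.c α u - P.c γ v) * (P.φ α u z * P.φ γ v z) =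
      -((P.V α u - P.V γ v) * P.φ β (u + v) z)
  -- The coefficient of (α, i*ξ) in the Lax equation. It is the only relation there that needs the
  -- momentum constraint.
  constraint_identity : ∀ a ∈ P.constraint, ∀ α ∈ 𝔥.root, ∀ u ∈ P.dom α, ∀ z, 0 < ‖z‖ → ‖z‖ < r₀ →
    pair α a * (deriv P.a z * P.φ α u z - P.a z * (deriv (P.φ α u) z - P.c α u * P.φ α u z) -
      P.V α u * P.φ α u z) = 0
  constraint_const : ∀ a ∈ P.constraint, ∀ α ∈ 𝔥.root, ∀ u s z,
    P.φ α (u + s * pair α a) z = P.φ α u z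
  -- Nondegeneracy: the u-derivatives of the φ_α detect the constraint. The range |z| < r₀ / 2 is
  -- the one on which R_q is defined.
  mem_constraint : ∀ q a : Module.Dual ℂ 𝔥, (∀ α ∈ 𝔥.root, pair α q ∈ P.dom α) →
    (∀ α ∈ 𝔥.root, ∀ z, 0 < ‖z‖ → ‖z‖ < r₀ / 2 →
      deriv (fun v => P.φ α v (-z)) (pair α q) * pair α a = 0) → a ∈ P.constraint

/-- The `r`-matrix and the Hamiltonian of a model are those of a profile. -/
structure Profile.Realizes (P : Profile 𝔥) (m : Model 𝔥) (B : CartanWeyl 𝔥) : Prop where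
  r_eq : ∀ q z, m.r B q z = P.a z • B.cartanTensor +
    ∑ α ∈ 𝔥.root, P.φ α (pair α q) z • B.rootTensor α
  ham_eq : ∀ x, m.ham B x = B.kinetic x.2.1 -
    1 / 2 * ∑ α ∈ 𝔥.root, P.V α (pair α x.1) * (B.spin x.2.2 α * B.spin x.2.2 (-α))
  regular_iff : ∀ q, q ∈ m.regular ↔ ∀ α ∈ 𝔥.root, pair α q ∈ P.dom α
  constraint_eq : m.momentumConstraint = P.constraint

theorem sum_root_neg {M : Type*} [AddCommMonoid M] (f : Weight ℂ 𝔥 𝔤 → M) :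
    ∑ α ∈ 𝔥.root, f (-α) = ∑ α ∈ 𝔥.root, f α :=
  Finset.sum_nbij' (fun α => -α) (fun α => -α) (fun _ h => neg_mem_root h)
    (fun _ h => neg_mem_root h) (fun _ _ => neg_neg _) (fun _ _ => neg_neg _) (fun _ _ => rfl)

namespace Profile

variable {P : Profile 𝔥} {m : Model 𝔥} {B : CartanWeyl 𝔥} {r₀ : ℝ}

theorem IsCanonical.deriv_a_neg (hP : P.IsCanonical r₀) (z : ℂ) : deriv P.a (-z) = deriv P.a z := by
  have h := deriv_comp_neg P.a z
  rw [funext hP.a_neg, deriv.fun_neg] at h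
  linear_combination h

theorem IsCanonical.deriv_φ_neg (hP : P.IsCanonical r₀) {α : Weight ℂ 𝔥 𝔤} (hα : α ∈ 𝔥.root)
    (u z : ℂ) : deriv (P.φ (-α) (-u)) (-z) = deriv (P.φ α u) z := by
  have h := deriv_comp_neg (P.φ (-α) (-u)) z
  rw [funext (hP.φ_neg α hα u), deriv.fun_neg] at h
  linear_combination h

theorem IsCanonical.V_neg (hP : P.IsCanonical r₀) (hr₀ : 0 < r₀) {α : Weight ℂ 𝔥 𝔤}
    (hα : α ∈ 𝔥.root) {u : ℂ} (hu : u ∈ P.dom α) : P.V (-α) (-u) = P.V α u := by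
  -- Any point of the punctured disc would do: the product formula is symmetric under (α, u) ↦ (−α,
  -- −u), and V does not depend on z.
  have hn : ‖((r₀ / 2 : ℝ) : ℂ)‖ = r₀ / 2 := by
    rw [Complex.norm_real, Real.norm_of_nonneg (by positivity)]
  have h1 := hP.φ_mul_φ_neg α hα u hu ((r₀ / 2 : ℝ) : ℂ) (by rw [hn]; positivity) (by rw [hn]; linarith)
  have h2 := hP.φ_mul_φ_neg (-α) (neg_mem_root hα) (-u) (hP.neg_mem_dom α hα u hu)
    ((r₀ / 2 : ℝ) : ℂ) (by rw [hn]; positivity) (by rw [hn]; linarith)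
  rw [neg_neg, neg_neg] at h2
  linear_combination h2 - h1

/-- V = −a' − φ_α φ_{-α} is differentiated by the equation for ∂_u φ; the two contributions of a(z)
cancel. The result plays the role of the addition theorem for γ = −α. -/
theorem IsCanonical.hasDerivAt_V (hP : P.IsCanonical r₀) {α : Weight ℂ 𝔥 𝔤}
    (hα : α ∈ 𝔥.root) {u : ℂ} (hu : u ∈ P.dom α) {z : ℂ} (h0 : 0 < ‖z‖) (hz : ‖z‖ < r₀) :
    HasDerivAt (P.V α) (-(deriv (P.φ α u) z * P.φ (-α) (-u) z -
      P.φ α u z * deriv (P.φ (-α) (-u)) z -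
      2 * P.c α u * (P.φ α u z * P.φ (-α) (-u) z))) u := by
  have h1 := hP.hasDerivAt_φ α hα u hu z h0 hz
  have h2 := (hP.hasDerivAt_φ (-α) (neg_mem_root hα) (-u) (hP.neg_mem_dom α hα u hu) z h0 hz).scomp
    u (hasDerivAt_neg u)
  have h3 := ((h1.mul h2).const_sub (-deriv P.a z))
  refine (h3.congr_of_eventuallyEq ?_).congr_deriv ?_
  · filter_upwards [(hP.isOpen_dom α hα).mem_nhds hu] with v hv
    have := hP.φ_mul_φ_neg α hα v hv z h0 hz
    simp only [Function.comp_apply, Pi.mul_apply]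
    linear_combination this
  · simp only [Function.comp_apply, smul_eq_mul, hP.c_neg α hα u]
    ring

theorem IsCanonical.differentiableAt_V (hP : P.IsCanonical r₀) (hr₀ : 0 < r₀) {α : Weight ℂ 𝔥 𝔤}
    (hα : α ∈ 𝔥.root) {u : ℂ} (hu : u ∈ P.dom α) : DifferentiableAt ℂ (P.V α) u := by
  have hn : ‖((r₀ / 2 : ℝ) : ℂ)‖ = r₀ / 2 := by
    rw [Complex.norm_real, Real.norm_of_nonneg (by positivity)]
  exact (hP.hasDerivAt_V hα hu (z := ((r₀ / 2 : ℝ) : ℂ)) (by rw [hn]; positivity)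
    (by rw [hn]; linarith)).differentiableAt

theorem Realizes.lax_eq (hm : P.Realizes m B) (x : Phase 𝔥) (z : ℂ) :
    m.lax B x z = x.2.1 + P.a z • (B.cartanPart x.2.2 : 𝔤) +
      ∑ α ∈ 𝔥.root, (P.φ α (pair α x.1) z * B.spin x.2.2 α) • B.e α := by
  have h : (B.cartanPart x.2.2 : 𝔤) = ∑ i, x.2.2 (B.h i) • (B.h i : 𝔤) := by
    rw [CartanWeyl.cartanPart]
    push_cast
    rfl
  rw [Model.lax, hm.r_eq, h, add_assoc]
  simp only [map_add, map_smul, map_sum, CartanWeyl.cartanTensor, CartanWeyl.rootTensor,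
    LinearMap.lTensor_tmul, TensorProduct.rid_tmul, smul_smul, CartanWeyl.spin]

theorem Realizes.kernelR_eq (hm : P.Realizes m B) (q : Module.Dual ℂ 𝔥) (X : ℂ → Module.Dual ℂ 𝔤)
    (z w : ℂ) : m.kernelR B q X z w = ∑ i, (P.a (w - z) * X w (B.h i)) • (B.h i : 𝔤) +
      ∑ α ∈ 𝔥.root, (P.φ α (pair α q) (w - z) * X w (B.e α)) • B.e (-α) := by
  rw [Model.kernelR, hm.r_eq]
  simp only [map_add, map_smul, map_sum, CartanWeyl.cartanTensor, CartanWeyl.rootTensor,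
    LinearMap.rTensor_tmul, TensorProduct.lid_tmul, smul_smul, Finset.smul_sum]

theorem Realizes.hasPV_kernelR (hm : P.Realizes m B) (q : Module.Dual ℂ 𝔥)
    {X : ℂ → Module.Dual ℂ 𝔤} {z : ℂ} (hz : z ≠ 0) {v : Fin (Module.finrank ℂ 𝔥) → ℂ}
    {v' : Weight ℂ 𝔥 𝔤 → ℂ}
    (h : ∀ i, HasScalarPV (fun w => P.a (w - z) * X w (B.h i)) z (v i))
    (h' : ∀ α ∈ 𝔥.root, HasScalarPV (fun w => P.φ α (pair α q) (w - z) * X w (B.e α)) z (v' α)) :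
    HasPV (m.kernelR B q X z) z
      (∑ i, v i • (B.h i : 𝔤) + ∑ α ∈ 𝔥.root, v' α • B.e (-α)) := by
  have key := hasPV_of_sum (Finset.univ.disjSum 𝔥.root) (f := m.kernelR B q X z)
    (g := Sum.elim (fun i w => P.a (w - z) * X w (B.h i))
      (fun α w => P.φ α (pair α q) (w - z) * X w (B.e α)))
    (v := Sum.elim (fun i => (B.h i : 𝔤)) (fun α => B.e (-α))) (c := Sum.elim v v') hz
    (fun j hj => ?_) (fun w _ _ => ?_)
  · simpa only [Finset.sum_disjSum, Sum.elim_inl, Sum.elim_inr] using key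
  · rcases j with i | α
    · exact h i
    · exact h' α (by simpa using hj)
  · simp only [Finset.sum_disjSum, Sum.elim_inl, Sum.elim_inr]
    exact hm.kernelR_eq q X z w

theorem exists_hasPV (hP : P.IsCanonical r₀) (hm : P.Realizes m B) {q : Module.Dual ℂ 𝔥}
    (hq : q ∈ m.regular) {ρ : ℝ} {X : ℂ → Module.Dual ℂ 𝔤} (hX : IsLoop X ρ) {z : ℂ}
    (h0 : 0 < ‖z‖) (hρ : ‖z‖ < ρ) (hz : ‖z‖ < r₀ / 2) :
    HasPV (m.kernelR B q X z) z (m.R B q X z) := by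
  obtain ⟨s, -, -, hs⟩ := hP.exists_a
  have h1 : ∀ i, ∃ v, HasScalarPV (fun w => P.a (w - z) * X w (B.h i)) z v := fun i =>
    hs.exists_hasScalarPV (hX.differentiableOn (Module.Dual.eval ℂ 𝔤 (B.h i))) h0 hρ hz
  have h2 : ∀ α, ∃ v, α ∈ 𝔥.root →
      HasScalarPV (fun w => P.φ α (pair α q) (w - z) * X w (B.e α)) z v := by
    intro α
    by_cases hα : α ∈ 𝔥.root
    · obtain ⟨h, hh, -⟩ := hP.exists_φ α hα _ ((hm.regular_iff q).1 hq α hα)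
      obtain ⟨v, hv⟩ := hh.exists_hasScalarPV
        (hX.differentiableOn (Module.Dual.eval ℂ 𝔤 (B.e α))) h0 hρ hz
      exact ⟨v, fun _ => hv⟩
    · exact ⟨0, fun h => (hα h).elim⟩
  choose v hv using h1
  choose v' hv' using h2
  exact (hm.hasPV_kernelR q (norm_pos_iff.1 h0) hv fun α hα => hv' α hα).hasPV_pv

theorem killingForm_lax_cartan (hm : P.Realizes m B) (x : Phase 𝔥) (z : ℂ) (h : 𝔥) :
    killingForm ℂ 𝔤 (m.lax B x z) h = killingForm ℂ 𝔤 (x.2.1 : 𝔤) h + P.a z * x.2.2 h := by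
  rw [hm.lax_eq]
  simp only [map_add, map_sum, map_smul, LinearMap.add_apply, LinearMap.sum_apply,
    LinearMap.smul_apply, smul_eq_mul, B.killingForm_cartanPart]
  rw [Finset.sum_eq_zero, add_zero]
  intro α hα
  rw [B.killingForm_e_cartan hα, mul_zero]

theorem killingForm_lax_e (hm : P.Realizes m B) (x : Phase 𝔥) (z : ℂ) {α : Weight ℂ 𝔥 𝔤}
    (hα : α ∈ 𝔥.root) : killingForm ℂ 𝔤 (m.lax B x z) (B.e α) =
      P.φ (-α) (pair (-α) x.1) z * B.spin x.2.2 (-α) := by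
  rw [hm.lax_eq]
  simp only [map_add, map_sum, map_smul, LinearMap.add_apply, LinearMap.sum_apply,
    LinearMap.smul_apply, smul_eq_mul]
  rw [B.killingForm_cartan_e hα, B.killingForm_cartan_e hα, B.sum_mul_killingForm_e hα, mul_zero,
    add_zero, zero_add]

/-- Expansion in dual bases. It reassembles the half residues, computed coefficient by coefficient,
into L/(2z). -/
theorem completeness (B : CartanWeyl 𝔥) (y : 𝔤) :
    ∑ i, killingForm ℂ 𝔤 y (B.h i) • (B.h i : 𝔤) +
      ∑ α ∈ 𝔥.root, killingForm ℂ 𝔤 y (B.e α) • B.e (-α) = y := by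
  induction y using B.induction with
  | cartan h =>
    rw [Finset.sum_eq_zero (s := 𝔥.root), add_zero]
    · conv_rhs => rw [← B.sum_killingForm_smul_coe h]
      exact Finset.sum_congr rfl fun i _ => by rw [LieModule.traceForm_comm]
    · intro α hα
      rw [B.killingForm_cartan_e hα, zero_smul]
  | root α hα c =>
    rw [Finset.sum_eq_zero, zero_add, Finset.sum_eq_single_of_mem (-α) (neg_mem_root hα)]
    · rw [map_smul, LinearMap.smul_apply, B.e_dual α hα, smul_eq_mul, mul_one, neg_neg]
    · intro β hβ hne
      rw [map_smul, LinearMap.smul_apply, B.killingForm_e_e hα hβ hne, smul_zero, zero_smul]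
    · intro i _
      rw [map_smul, LinearMap.smul_apply, B.killingForm_e_cartan hα, smul_zero, zero_smul]
  | add x y hx hy =>
    conv_rhs => rw [← hx, ← hy]
    simp only [map_add, LinearMap.add_apply, add_smul, Finset.sum_add_distrib]
    abel

/-- `R_q(M)` up to a multiple of `L`. -/
def laxPartner (P : Profile 𝔥) (B : CartanWeyl 𝔥) (x : Phase 𝔥) (z : ℂ) : 𝔤 :=
  -(P.a z • (x.2.1 : 𝔤)) + deriv P.a z • (B.cartanPart x.2.2 : 𝔤) +
    ∑ α ∈ 𝔥.root, ((deriv (P.φ α (pair α x.1)) z -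
      P.c α (pair α x.1) * P.φ α (pair α x.1) z) * B.spin x.2.2 α) • B.e α

theorem hasScalarPV_laxM_cartan (hP : P.IsCanonical r₀) (hm : P.Realizes m B) (x : Phase 𝔥)
    {z : ℂ} (h0 : 0 < ‖z‖) (hz : ‖z‖ < r₀ / 2) (h : 𝔥) :
    HasScalarPV (fun w => P.a (w - z) * m.laxM B x w h) z
      (x.2.2 h * deriv P.a z - killingForm ℂ 𝔤 (x.2.1 : 𝔤) h * P.a z +
        1 / 2 * m.laxM B x z h) := by
  obtain ⟨s, hsd, -, hs⟩ := hP.exists_a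
  have hX : ∀ w, ‖w‖ = ‖z‖ → m.laxM B x w h = x.2.2 h * (w ^ 2)⁻¹ +
      killingForm ℂ 𝔤 (x.2.1 : 𝔤) h * w⁻¹ + x.2.2 h * s w := by
    intro w hw
    have hw0 : w ≠ 0 := norm_pos_iff.1 (hw ▸ h0)
    rw [Model.laxM, map_smul, LinearMap.smul_apply, killingForm_lax_cartan hm,
      hs.eq w (hw ▸ h0) (by rw [hw]; linarith), smul_eq_mul]
    field_simp
    ring
  have key := hs.hasScalarPV (x.2.2 h) (killingForm ℂ 𝔤 (x.2.1 : 𝔤) h)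
    (hsd.const_mul (x.2.2 h)) h0 hz
  refine HasScalarPV.congr_value (key.congr (norm_pos_iff.1 h0) fun w hw _ => ?_) ?_
  · rw [hX w hw]
  · rw [hX z rfl, hP.deriv_a_neg, hP.a_neg]
    ring

theorem hasScalarPV_laxM_e (hP : P.IsCanonical r₀) (hm : P.Realizes m B) {x : Phase 𝔥}
    (hx : x ∈ m.phaseSpace)
    {z : ℂ} (h0 : 0 < ‖z‖) (hz : ‖z‖ < r₀ / 2) {α : Weight ℂ 𝔥 𝔤} (hα : α ∈ 𝔥.root) :
    HasScalarPV (fun w => P.φ α (pair α x.1) (w - z) * m.laxM B x w (B.e α)) z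
      ((deriv (P.φ (-α) (pair (-α) x.1)) z -
        P.c (-α) (pair (-α) x.1) * P.φ (-α) (pair (-α) x.1) z) * B.spin x.2.2 (-α) +
        1 / 2 * m.laxM B x z (B.e α)) := by
  have hu := (hm.regular_iff x.1).1 hx
  obtain ⟨h, hh, -⟩ := hP.exists_φ α hα _ (hu α hα)
  obtain ⟨k, hk, hk0⟩ := hP.exists_φ (-α) (neg_mem_root hα) _ (hu (-α) (neg_mem_root hα))
  have hr₀ : 0 < r₀ := by linarith
  -- w⁻¹ φ(w) = w⁻² + c w⁻¹ + (regular): the double pole produces the derivative of the kernel, and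
  -- c enters as the coefficient of the simple pole.
  have hX : ∀ w, ‖w‖ = ‖z‖ → m.laxM B x w (B.e α) = B.spin x.2.2 (-α) * (w ^ 2)⁻¹ +
      (P.c (-α) (pair (-α) x.1) * B.spin x.2.2 (-α)) * w⁻¹ +
        B.spin x.2.2 (-α) * dslope k 0 w := by
    intro w hw
    have hw0 : w ≠ 0 := norm_pos_iff.1 (hw ▸ h0)
    rw [Model.laxM, map_smul, LinearMap.smul_apply, killingForm_lax_e hm x w hα,
      hk.eq w (hw ▸ h0) (by rw [hw]; linarith), smul_eq_mul, dslope_of_ne _ hw0, slope_def_field,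
      hk0, sub_zero]
    field_simp
    ring
  have hd := (Complex.differentiableOn_dslope (Metric.ball_mem_nhds (0 : ℂ) hr₀)).2 hk.diff
  have key := hh.hasScalarPV (B.spin x.2.2 (-α)) (P.c (-α) (pair (-α) x.1) * B.spin x.2.2 (-α))
    (hd.const_mul (B.spin x.2.2 (-α))) h0 hz
  refine HasScalarPV.congr_value (key.congr (norm_pos_iff.1 h0) fun w hw _ => ?_) ?_
  · rw [hX w hw]
  -- The residue at 0 involves φ_α at −z; parity converts it to φ_{-α} at z, the coefficient that
  -- occurs in L.
  · have e1 := hP.deriv_φ_neg (neg_mem_root hα) (pair (-α) x.1) z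
    have e2 := hP.φ_neg (-α) (neg_mem_root hα) (pair (-α) x.1) z
    rw [pair_neg, neg_neg, neg_neg] at e1 e2
    rw [hX z rfl, e1, e2, pair_neg]
    ring

/-- The residues at w = 0 give `laxPartner`, and the half residues at w = z give M/2 by
`completeness`. -/
theorem R_laxM (hP : P.IsCanonical r₀) (hm : P.Realizes m B) {x : Phase 𝔥} (hx : x ∈ m.phaseSpace)
    {z : ℂ} (h0 : 0 < ‖z‖) (hz : ‖z‖ < r₀ / 2) :
    m.R B x.1 (m.laxM B x) z = laxPartner P B x z + (1 / 2 * z⁻¹) • m.lax B x z := by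
  rw [Model.R, (hm.hasPV_kernelR x.1 (norm_pos_iff.1 h0)
    (fun i => hasScalarPV_laxM_cartan hP hm x h0 hz (B.h i))
    (fun α hα => hasScalarPV_laxM_e hP hm hx h0 hz hα)).pv_eq]
  have hc : (B.cartanPart x.2.2 : 𝔤) = ∑ i, x.2.2 (B.h i) • (B.h i : 𝔤) := by
    rw [CartanWeyl.cartanPart]
    push_cast
    rfl
  have hp : (x.2.1 : 𝔤) = ∑ i, killingForm ℂ 𝔤 (x.2.1 : 𝔤) (B.h i) • (B.h i : 𝔤) := by
    conv_lhs => rw [← B.sum_killingForm_smul_coe x.2.1]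
    exact Finset.sum_congr rfl fun i _ => by rw [LieModule.traceForm_comm]
  have hcomp := completeness B ((1 / 2 * z⁻¹) • m.lax B x z)
  have hlM : ∀ y, 1 / 2 * m.laxM B x z y = killingForm ℂ 𝔤 ((1 / 2 * z⁻¹) • m.lax B x z) y := by
    intro y
    rw [Model.laxM]
    simp only [map_smul, LinearMap.smul_apply, smul_eq_mul]
    ring
  have hp' : -(P.a z • (x.2.1 : 𝔤)) =
      -∑ i, (killingForm ℂ 𝔤 (x.2.1 : 𝔤) (B.h i) * P.a z) • (B.h i : 𝔤) := by
    conv_lhs => rw [hp]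
    simp only [Finset.smul_sum, smul_smul, mul_comm (P.a z)]
  refine Eq.trans ?_ (congrArg (laxPartner P B x z + ·) hcomp)
  rw [laxPartner, ← sum_root_neg (fun α => ((deriv (P.φ α (pair α x.1)) z -
      P.c α (pair α x.1) * P.φ α (pair α x.1) z) * B.spin x.2.2 α) • B.e α), hc, hp']
  simp only [hlM, add_smul, sub_smul, Finset.sum_add_distrib, Finset.sum_sub_distrib,
    Finset.smul_sum, smul_smul, mul_comm (deriv P.a z)]
  abel

theorem isLoop_laxM (hP : P.IsCanonical r₀) (hm : P.Realizes m B) {x : Phase 𝔥}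
    (hx : x ∈ m.phaseSpace) : IsLoop (m.laxM B x) r₀ := by
  obtain ⟨s, hsd, -, hs⟩ := hP.exists_a
  have hu := (hm.regular_iff x.1).1 hx
  have h1 : ∀ α, ∃ h, α ∈ 𝔥.root → HasSimplePole (P.φ α (pair α x.1)) h r₀ := by
    intro α
    by_cases hα : α ∈ 𝔥.root
    · obtain ⟨h, hh, -⟩ := hP.exists_φ α hα _ (hu α hα)
      exact ⟨h, fun _ => hh⟩
    · exact ⟨0, fun h => (hα h).elim⟩
  choose k hk using h1
  -- The index `true` stands for the term p/z and `false` for a(z)/z times the Cartan part of ξ; all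
  -- terms have at most a double pole, hence the exponent 2.
  refine isLoop_of_sum (s := (Finset.univ : Finset Bool).disjSum 𝔥.root) (X := m.laxM B x)
    (g := Sum.elim (fun b z => if b then z⁻¹ else z⁻¹ * P.a z)
      (fun α z => z⁻¹ * (P.φ α (pair α x.1) z * B.spin x.2.2 α)))
    (v := Sum.elim (fun b => if b then killingForm ℂ 𝔤 (x.2.1 : 𝔤) else
      killingForm ℂ 𝔤 (B.cartanPart x.2.2 : 𝔤)) (fun α => killingForm ℂ 𝔤 (B.e α))) 2
    (Y := Sum.elim (fun b z => if b then z else 1 + z ^ 2 * s z)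
      (fun α z => (1 + z * k α z) * B.spin x.2.2 α)) ?_ ?_ ?_
  · rintro (b | α) hj
    · rcases b with _ | _
      · exact ((differentiableOn_const _).add ((differentiableOn_pow 2).mul hsd))
      · exact differentiableOn_id
    · have hα : α ∈ 𝔥.root := by simpa using hj
      exact ((differentiableOn_const _).add (differentiableOn_id.mul (hk α hα).diff)).mul_const _
  · rintro (b | α) hj z h0 hz
    · have hz0 : z ≠ 0 := norm_pos_iff.1 h0
      rw [zpow_neg]
      norm_cast
      rcases b with _ | _
      · simp only [Sum.elim_inl, Bool.false_eq_true, if_false, hs.eq z h0 hz]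
        field_simp
      · simp only [Sum.elim_inl, if_true]
        field_simp
    · have hz0 : z ≠ 0 := norm_pos_iff.1 h0
      have hα : α ∈ 𝔥.root := by simpa using hj
      rw [zpow_neg]
      norm_cast
      simp only [Sum.elim_inr, (hk α hα).eq z h0 hz]
      field_simp
  · intro z h0 hz
    rw [Model.laxM, hm.lax_eq, Finset.sum_disjSum]
    simp [smul_smul, Finset.smul_sum]

theorem killingForm_lax_lax (hP : P.IsCanonical r₀) (hm : P.Realizes m B) {x : Phase 𝔥}
    (hx : x ∈ m.phaseSpace) {z : ℂ} (h0 : 0 < ‖z‖) (hz : ‖z‖ < r₀) :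
    killingForm ℂ 𝔤 (m.lax B x z) (m.lax B x z) =
      killingForm ℂ 𝔤 (x.2.1 : 𝔤) (x.2.1 : 𝔤) + 2 * P.a z * x.2.2 x.2.1 +
      P.a z ^ 2 * x.2.2 (B.cartanPart x.2.2) +
      ∑ α ∈ 𝔥.root, (-deriv P.a z - P.V α (pair α x.1)) * (B.spin x.2.2 α * B.spin x.2.2 (-α)) := by
  have hu := (hm.regular_iff x.1).1 hx
  conv_lhs => enter [2]; rw [hm.lax_eq]
  simp only [map_add, map_sum, map_smul, smul_eq_mul, killingForm_lax_cartan hm]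
  have e : ∑ α ∈ 𝔥.root, P.φ α (pair α x.1) z * B.spin x.2.2 α *
      killingForm ℂ 𝔤 (m.lax B x z) (B.e α) = ∑ α ∈ 𝔥.root,
      (-deriv P.a z - P.V α (pair α x.1)) * (B.spin x.2.2 α * B.spin x.2.2 (-α)) := by
    refine Finset.sum_congr rfl fun α hα => ?_
    rw [killingForm_lax_e hm x z hα, ← hP.φ_mul_φ_neg α hα _ (hu α hα) z h0 hz, pair_neg]
    ring
  have e2 : killingForm ℂ 𝔤 (x.2.1 : 𝔤) (B.cartanPart x.2.2 : 𝔤) = x.2.2 x.2.1 := by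
    rw [LieModule.traceForm_comm, B.killingForm_cartanPart]
  rw [e, e2]
  ring

theorem kinetic_eq (B : CartanWeyl 𝔥) (p : 𝔥) :
    B.kinetic p = 1 / 2 * killingForm ℂ 𝔤 (p : 𝔤) (p : 𝔤) := by
  rw [CartanWeyl.kinetic]
  congr 1
  conv_rhs => enter [2]; rw [← B.sum_killingForm_smul_coe p]
  simp only [map_sum, map_smul, smul_eq_mul, B.repr_eq_killingForm]
  refine Finset.sum_congr rfl fun i _ => ?_
  rw [LieModule.traceForm_comm ℂ 𝔤 𝔤 (p : 𝔤), sq]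

/-- The integral is the constant term of (L, L). With a = 1/z + z s, both a² and −a' have constant
terms that are multiples of s(0) = 0, so only the kinetic energy and the potentials remain. -/
theorem ham_eq_circleIntegral (hP : P.IsCanonical r₀) (hm : P.Realizes m B) {x : Phase 𝔥}
    (hx : x ∈ m.phaseSpace) {ρ : ℝ} (h0 : 0 < ρ) (hρ : ρ < r₀) :
    m.ham B x = 1 / 2 * ((2 * (Real.pi : ℂ) * Complex.I)⁻¹ *
      ∮ z in C(0, ρ), killingForm ℂ 𝔤 (m.lax B x z) (m.lax B x z) / z) := by
  obtain ⟨s, hsd, hs0, hs⟩ := hP.exists_a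
  have hd := hs.diff.deriv Metric.isOpen_ball
  have hd0 : deriv (fun z => z * s z) 0 = 0 := by
    have := (hasDerivAt_id' (0 : ℂ)).mul (hsd.differentiableAt (Metric.ball_mem_nhds (0 : ℂ)
      (h0.trans hρ))).hasDerivAt
    refine this.deriv.trans ?_
    rw [hs0]
    ring
  rw [circleIntegral_div_eq_of_eq h0 hρ
    (k := fun z => killingForm ℂ 𝔤 (x.2.1 : 𝔤) (x.2.1 : 𝔤) + 2 * (z * s z) * x.2.2 x.2.1 +
      (2 * s z + (z * s z) ^ 2) * x.2.2 (B.cartanPart x.2.2) +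
      ∑ α ∈ 𝔥.root, (-deriv (fun z => z * s z) z - P.V α (pair α x.1)) *
        (B.spin x.2.2 α * B.spin x.2.2 (-α)))
    (x.2.2 (B.cartanPart x.2.2) + ∑ α ∈ 𝔥.root, B.spin x.2.2 α * B.spin x.2.2 (-α))
    (2 * x.2.2 x.2.1) ?_ ?_]
  · rw [hm.ham_eq, hd0, hs0, kinetic_eq]
    simp only [neg_zero, zero_sub, neg_mul, Finset.sum_neg_distrib]
    ring
  · have h1 := hs.diff
    refine DifferentiableOn.add (DifferentiableOn.add ?_ ?_) ?_
    · exact (differentiableOn_const _).add ((h1.const_mul 2).mul_const _)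
    · exact ((hsd.const_mul 2).add (h1.pow 2)).mul_const _
    · exact DifferentiableOn.fun_sum fun α _ =>
        ((hd.neg.sub (differentiableOn_const _)).mul_const _)
  · intro w hw
    have hw0 : 0 < ‖w‖ := hw ▸ h0
    have hwr : ‖w‖ < r₀ := hw ▸ hρ
    have hwne : w ≠ 0 := norm_pos_iff.1 hw0
    rw [killingForm_lax_lax hP hm hx hw0 hwr, (hs.deriv_eq hw0 hwr).deriv, hs.eq w hw0 hwr]
    simp only [sub_mul, neg_add, neg_neg, add_mul, Finset.sum_add_distrib, Finset.sum_sub_distrib,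
      ← Finset.mul_sum]
    field_simp
    ring

end Profile

end Profiles

/-! ### The Hamiltonian dynamics -/

section Dynamics

variable {𝔤 : Type*} [LieRing 𝔤] [LieAlgebra ℂ 𝔤] [FiniteDimensional ℂ 𝔤] [LieAlgebra.IsKilling ℂ 𝔤]
  {𝔥 : LieSubalgebra ℂ 𝔤} [𝔥.IsCartanSubalgebra]

namespace Profile

variable {P : Profile 𝔥} {m : Model 𝔥} {B : CartanWeyl 𝔥} {r₀ : ℝ}

theorem isDiffAt_ham (hP : P.IsCanonical r₀) (hm : P.Realizes m B) (hr₀ : 0 < r₀) {x : Phase 𝔥}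
    (hx : x ∈ m.phaseSpace) : IsDiffAt (m.ham B) x := by
  have hu := (hm.regular_iff x.1).1 hx
  have hp : ∀ i, IsDiffAt (fun y : Phase 𝔥 => B.h.repr y.2.1 i) x := fun i =>
    isDiffAt_dual (B.h.coord i ∘ₗ LinearMap.fst ℂ 𝔥 (Module.Dual ℂ 𝔤) ∘ₗ
      LinearMap.snd ℂ (Module.Dual ℂ 𝔥) (𝔥 × Module.Dual ℂ 𝔤)) x
  have hq : ∀ α, IsDiffAt (fun y : Phase 𝔥 => pair α y.1) x := by
    intro α
    simp only [pair_eq]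
    exact isDiffAt_dual (Module.Dual.eval ℂ 𝔥 (rootDual α) ∘ₗ
      LinearMap.fst ℂ (Module.Dual ℂ 𝔥) (𝔥 × Module.Dual ℂ 𝔤)) x
  have hξ : ∀ α, IsDiffAt (fun y : Phase 𝔥 => B.spin y.2.2 α) x := fun α =>
    isDiffAt_dual (Module.Dual.eval ℂ 𝔤 (B.e (-α)) ∘ₗ LinearMap.snd ℂ 𝔥 (Module.Dual ℂ 𝔤) ∘ₗ
      LinearMap.snd ℂ (Module.Dual ℂ 𝔥) (𝔥 × Module.Dual ℂ 𝔤)) x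
  rw [funext hm.ham_eq]
  refine IsDiffAt.sub ?_ (IsDiffAt.const_mul (IsDiffAt.sum fun α hα => ?_) _)
  · simp only [CartanWeyl.kinetic, sq]
    exact IsDiffAt.const_mul (IsDiffAt.sum fun i _ => (hp i).mul (hp i)) _
  · exact (IsDiffAt.comp (F := fun y : Phase 𝔥 => pair α y.1)
      (hP.differentiableAt_V hr₀ hα (hu α hα)) (hq α)).mul
      ((hξ α).mul (hξ (-α)))

theorem differential_ham (hP : P.IsCanonical r₀) (hm : P.Realizes m B) (hr₀ : 0 < r₀) {x : Phase 𝔥}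
    (hx : x ∈ m.phaseSpace) (v : Phase 𝔥) :
    differential (m.ham B) x v = killingForm ℂ 𝔤 (x.2.1 : 𝔤) (v.2.1 : 𝔤) -
      1 / 2 * ∑ α ∈ 𝔥.root, (deriv (P.V α) (pair α x.1) * pair α v.1 *
        (B.spin x.2.2 α * B.spin x.2.2 (-α)) + P.V α (pair α x.1) *
        (B.spin v.2.2 α * B.spin x.2.2 (-α) + B.spin x.2.2 α * B.spin v.2.2 (-α))) := by
  have hu := (hm.regular_iff x.1).1 hx
  refine (isDiffAt_ham hP hm hr₀ hx).differential_eq ?_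
  have hid := hasDerivAt_id' (0 : ℂ)
  have hspin : ∀ α, HasDerivAt (fun s : ℂ => B.spin x.2.2 α + s * B.spin v.2.2 α)
      (B.spin v.2.2 α) 0 := by
    intro α
    simpa using (hid.mul_const (B.spin v.2.2 α)).const_add (B.spin x.2.2 α)
  have hpot : ∀ α ∈ 𝔥.root, HasDerivAt (fun s : ℂ => P.V α (pair α x.1 + s * pair α v.1))
      (deriv (P.V α) (pair α x.1) * pair α v.1) 0 := by
    intro α hα
    have h1 : HasDerivAt (fun s : ℂ => pair α x.1 + s * pair α v.1) (pair α v.1) 0 := by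
      simpa using (hid.mul_const (pair α v.1)).const_add (pair α x.1)
    have h2 : HasDerivAt (P.V α) (deriv (P.V α) (pair α x.1)) (pair α x.1 + 0 * pair α v.1) := by
      rw [zero_mul, add_zero]
      exact (hP.differentiableAt_V hr₀ hα (hu α hα)).hasDerivAt
    exact h2.comp (0 : ℂ) h1
  have hkin : HasDerivAt (fun s : ℂ => 1 / 2 * (killingForm ℂ 𝔤 (x.2.1 : 𝔤) (x.2.1 : 𝔤) +
      s * (2 * killingForm ℂ 𝔤 (x.2.1 : 𝔤) (v.2.1 : 𝔤)) +
      s ^ 2 * killingForm ℂ 𝔤 (v.2.1 : 𝔤) (v.2.1 : 𝔤)))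
      (killingForm ℂ 𝔤 (x.2.1 : 𝔤) (v.2.1 : 𝔤)) 0 := by
    refine ((((hid.mul_const _).const_add _).add ((hid.pow 2).mul_const _)).const_mul _).congr_deriv ?_
    simp
  have key := hkin.sub ((HasDerivAt.fun_sum fun α hα =>
    (hpot α hα).mul ((hspin α).mul (hspin (-α)))).const_mul (1 / 2))
  refine (key.congr_of_eventuallyEq (.of_forall fun s => ?_)).congr_deriv ?_
  · rw [hm.ham_eq, kinetic_eq]
    congr 1
    · congr 1
      change killingForm ℂ 𝔤 ((x.2.1 + s • v.2.1 : 𝔥) : 𝔤) ((x.2.1 + s • v.2.1 : 𝔥) : 𝔤) = _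
      push_cast
      simp only [map_add, map_smul, LinearMap.add_apply, LinearMap.smul_apply, smul_eq_mul]
      rw [LieModule.traceForm_comm ℂ 𝔤 𝔤 (v.2.1 : 𝔤) (x.2.1 : 𝔤)]
      ring
    · congr 1
      refine Finset.sum_congr rfl fun α _ => ?_
      change P.V α (pair α (x.1 + s • v.1)) * ((x.2.2 + s • v.2.2) (B.e (-α)) *
        (x.2.2 + s • v.2.2) (B.e (- -α))) = _
      rw [pair_add_smul]
      rfl
  · simp

theorem gradP_ham (hP : P.IsCanonical r₀) (hm : P.Realizes m B) (hr₀ : 0 < r₀) {x : Phase 𝔥}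
    (hx : x ∈ m.phaseSpace) (y : 𝔥) :
    gradP (m.ham B) x y = killingForm ℂ 𝔤 (x.2.1 : 𝔤) (y : 𝔤) := by
  rw [gradP_apply, differential_ham hP hm hr₀ hx]
  simp [pair_eq, CartanWeyl.spin]

theorem gradQ_ham (hP : P.IsCanonical r₀) (hm : P.Realizes m B) (hr₀ : 0 < r₀) {x : Phase 𝔥}
    (hx : x ∈ m.phaseSpace) :
    gradQ (m.ham B) x = -∑ α ∈ 𝔥.root, (1 / 2 * deriv (P.V α) (pair α x.1) *
      (B.spin x.2.2 α * B.spin x.2.2 (-α))) • rootDual α := by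
  refine eq_of_forall_dual fun η => ?_
  rw [apply_gradQ, differential_ham hP hm hr₀ hx]
  simp only [pair_eq, CartanWeyl.spin, LinearMap.zero_apply, map_zero, map_neg, map_sum, map_smul,
    smul_eq_mul, zero_mul, mul_zero, add_zero, Submodule.coe_zero, zero_sub,
    Finset.mul_sum]
  congr 1
  exact Finset.sum_congr rfl fun α _ => by ring

theorem gradXi_ham (hP : P.IsCanonical r₀) (hm : P.Realizes m B) (hr₀ : 0 < r₀) {x : Phase 𝔥}
    (hx : x ∈ m.phaseSpace) :
    gradXi (m.ham B) x = -∑ α ∈ 𝔥.root, (P.V α (pair α x.1) * B.spin x.2.2 α) • B.e α := by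
  have hu := (hm.regular_iff x.1).1 hx
  refine eq_of_forall_dual fun η => ?_
  rw [apply_gradXi, differential_ham hP hm hr₀ hx]
  -- The two terms of the derivative of ξ_α ξ_{-α} have equal sums under α ↔ −α, because V is even;
  -- this cancels the factor 1/2.
  have h1 : ∑ α ∈ 𝔥.root, P.V α (pair α x.1) * (B.spin η α * B.spin x.2.2 (-α)) =
      ∑ α ∈ 𝔥.root, P.V α (pair α x.1) * (B.spin x.2.2 α * B.spin η (-α)) := by
    rw [← sum_root_neg]
    refine Finset.sum_congr rfl fun α hα => ?_
    rw [pair_neg, hP.V_neg hr₀ hα (hu α hα), neg_neg]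
    ring
  simp only [pair_eq, LinearMap.zero_apply, map_zero, map_neg, map_sum, map_smul,
    smul_eq_mul, zero_mul, mul_zero, zero_add, Submodule.coe_zero, zero_sub]
  simp only [← pair_eq, mul_add, Finset.sum_add_distrib, h1]
  have h2 : ∀ α, B.spin η (-α) = η (B.e α) := fun α => by rw [CartanWeyl.spin, neg_neg]
  simp only [h2, mul_assoc]
  ring

/-- Infinitesimal torus invariance of H: the summand is V_α ξ_α ξ_{-α} α(h), odd under α ↦ −α, so
the sum equals its negative. It gives conservation of J. -/
theorem dual_lie_gradXi (hP : P.IsCanonical r₀) (hm : P.Realizes m B) (hr₀ : 0 < r₀) {x : Phase 𝔥}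
    (hx : x ∈ m.phaseSpace) (h : 𝔥) : x.2.2 ⁅(h : 𝔤), gradXi (m.ham B) x⁆ = 0 := by
  have hu := (hm.regular_iff x.1).1 hx
  rw [gradXi_ham hP hm hr₀ hx, lie_neg, lie_sum, map_neg, map_sum, neg_eq_zero]
  have h1 : ∀ α ∈ 𝔥.root, x.2.2 ⁅(h : 𝔤), (P.V α (pair α x.1) * B.spin x.2.2 α) • B.e α⁆ =
      P.V α (pair α x.1) * (B.spin x.2.2 α * B.spin x.2.2 (-α)) * α h := by
    intro α hα
    rw [lie_smul, B.lie_cartan_e hα, map_smul, map_smul, smul_eq_mul, smul_eq_mul]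
    simp only [CartanWeyl.spin, neg_neg]
    ring
  rw [Finset.sum_congr rfl h1]
  refine self_eq_neg.1 ?_
  conv_lhs => rw [← sum_root_neg]
  rw [← Finset.sum_neg_distrib]
  refine Finset.sum_congr rfl fun α hα => ?_
  rw [pair_neg, hP.V_neg hr₀ hα (hu α hα), neg_neg, Weight.coe_neg, Pi.neg_apply]
  ring

theorem J_eq_of_isTrajectory (hP : P.IsCanonical r₀) (hm : P.Realizes m B) (hr₀ : 0 < r₀) {I : Set ℝ}
    {γ : ℝ → Phase 𝔥} (hI : IsOpen I) (hI' : IsPreconnected I) (hγ : ∀ t ∈ I, γ t ∈ m.phaseSpace)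
    (htraj : IsTrajectory (m.ham B) γ I) {t₀ t : ℝ} (ht₀ : t₀ ∈ I) (ht : t ∈ I) :
    J (γ t) = J (γ t₀) := by
  ext h
  have hd : ∀ s ∈ I, HasDerivAt (fun s => (γ s).2.2 (h : 𝔤)) 0 s := by
    intro s hs
    have := htraj.hasDerivAt_spin hs (h : 𝔤)
    rwa [dual_lie_gradXi hP hm hr₀ (hγ s hs)] at this
  exact hI.is_const_of_deriv_eq_zero hI'
    (fun s hs => (hd s hs).differentiableAt.differentiableWithinAt) (fun s hs => (hd s hs).deriv)
    ht ht₀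

/-! ### The Lax equation -/

/-- The operator `y ↦ (id ⊗ (y, ·)) r(q, z)`. -/
def rMap (P : Profile 𝔥) (B : CartanWeyl 𝔥) (q : Module.Dual ℂ 𝔥) (z : ℂ) : 𝔤 →ₗ[ℂ] 𝔤 :=
  ∑ i, P.a z • (killingForm ℂ 𝔤 (B.h i : 𝔤)).smulRight (B.h i : 𝔤) +
    ∑ α ∈ 𝔥.root, P.φ α (pair α q) z • (killingForm ℂ 𝔤 (B.e (-α))).smulRight (B.e α)

theorem rMap_apply (P : Profile 𝔥) (B : CartanWeyl 𝔥) (q : Module.Dual ℂ 𝔥) (z : ℂ) (y : 𝔤) :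
    rMap P B q z y = ∑ i, (P.a z * killingForm ℂ 𝔤 (B.h i : 𝔤) y) • (B.h i : 𝔤) +
      ∑ α ∈ 𝔥.root, (P.φ α (pair α q) z * killingForm ℂ 𝔤 (B.e (-α)) y) • B.e α := by
  simp [rMap, smul_smul]

theorem rMap_cartan (P : Profile 𝔥) (B : CartanWeyl 𝔥) (q : Module.Dual ℂ 𝔥) (z : ℂ) (h : 𝔥) :
    rMap P B q z h = P.a z • (h : 𝔤) := by
  rw [rMap_apply, Finset.sum_eq_zero (s := 𝔥.root), add_zero]
  · simp only [mul_smul, ← Finset.smul_sum, B.sum_killingForm_smul_coe]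
  · intro α hα
    rw [B.killingForm_e_cartan (neg_mem_root hα), mul_zero, zero_smul]

theorem rMap_e (P : Profile 𝔥) (B : CartanWeyl 𝔥) (q : Module.Dual ℂ 𝔥) (z : ℂ)
    {α : Weight ℂ 𝔥 𝔤} (hα : α ∈ 𝔥.root) :
    rMap P B q z (B.e α) = P.φ α (pair α q) z • B.e α := by
  rw [rMap_apply, Finset.sum_eq_zero, zero_add, Finset.sum_eq_single_of_mem α hα]
  · have := B.e_dual (-α) (neg_mem_root hα)
    rw [neg_neg] at this
    rw [this, mul_one]
  · intro β hβ hne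
    rw [B.killingForm_e_e (neg_mem_root hβ) hα (fun h => hne (by rw [h, neg_neg])), mul_zero,
      zero_smul]
  · intro i _
    rw [B.killingForm_cartan_e hα, mul_zero, zero_smul]

theorem deriv_V_neg (hP : P.IsCanonical r₀) {α : Weight ℂ 𝔥 𝔤} (hα : α ∈ 𝔥.root) {u : ℂ}
    (hu : u ∈ P.dom α) {z : ℂ} (h0 : 0 < ‖z‖) (hz : ‖z‖ < r₀) :
    deriv (P.V (-α)) (-u) = -deriv (P.V α) u := by
  rw [(hP.hasDerivAt_V hα hu h0 hz).deriv, (hP.hasDerivAt_V (neg_mem_root hα)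
    (hP.neg_mem_dom α hα u hu) h0 hz).deriv, neg_neg, neg_neg, hP.c_neg α hα]
  ring

open Classical in
/-- The summand of the quadratic part of the Lax equation. -/
def quadTerm (P : Profile 𝔥) (B : CartanWeyl 𝔥) (x : Phase 𝔥) (z : ℂ) (α γ : Weight ℂ 𝔥 𝔤) : 𝔤 :=
  (B.spin x.2.2 α * B.spin x.2.2 γ) • (((deriv (P.φ α (pair α x.1)) z -
      P.c α (pair α x.1) * P.φ α (pair α x.1) z) * P.φ γ (pair γ x.1) z) • ⁅B.e α, B.e γ⁆ +
    P.V α (pair α x.1) • rMap P B x.1 z ⁅B.e α, B.e γ⁆ +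
    if γ = -α then (1 / 2 * deriv (P.V α) (pair α x.1)) • (rootDual α : 𝔤) else 0)

/-- For γ = −α the bracket lies in `𝔥` and the claim is the formula for V'. Otherwise the bracket is
zero or a multiple of e_β with β = α + γ, and the claim is the addition theorem `φ_add`. -/
theorem quadTerm_add_swap (hP : P.IsCanonical r₀) (hm : P.Realizes m B) (hr₀ : 0 < r₀)
    {x : Phase 𝔥} (hx : x ∈ m.phaseSpace) {z : ℂ} (h0 : 0 < ‖z‖) (hz : ‖z‖ < r₀)
    {α γ : Weight ℂ 𝔥 𝔤} (hα : α ∈ 𝔥.root) (hγ : γ ∈ 𝔥.root) :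
    quadTerm P B x z α γ + quadTerm P B x z γ α = 0 := by
  have hu := (hm.regular_iff x.1).1 hx
  rw [quadTerm, quadTerm, mul_comm (B.spin x.2.2 γ), ← smul_add, ← lie_skew (B.e γ) (B.e α), map_neg]
  by_cases hne : γ = -α
  · subst hne
    rw [if_pos rfl, if_pos (neg_neg α).symm, B.lie_e_neg hα, rMap_cartan,
      pair_neg, hP.V_neg hr₀ hα (hu α hα), deriv_V_neg hP hα (hu α hα) h0 hz, hP.c_neg α hα,
      rootDual_neg, (hP.hasDerivAt_V hα (hu α hα) h0 hz).deriv]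
    push_cast
    simp only [smul_neg, smul_smul, ← neg_smul, ← add_smul]
    rw [smul_eq_zero]
    left
    ring
  · rw [if_neg hne, if_neg (fun h => hne (CartanWeyl.neg_eq_iff_of_root.1 h))]
    rcases B.lie_e_e hα hγ hne with h | ⟨β, hβ, hsum, c, hc⟩
    · rw [h]
      simp
    · have key := hP.φ_add α hα γ hγ β hβ hsum _ (hu α hα) _ (hu γ hγ)
        (pair_of_toLinear_add hsum x.1 ▸ hu β hβ) z h0 hz
      rw [← pair_of_toLinear_add hsum] at key
      rw [hc, map_smul, rMap_e P B x.1 z hβ]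
      simp only [smul_smul, ← neg_smul, ← add_smul, add_zero]
      rw [smul_eq_zero]
      left
      linear_combination B.spin x.2.2 α * B.spin x.2.2 γ * c * key

theorem sum_quadTerm (hP : P.IsCanonical r₀) (hm : P.Realizes m B) (hr₀ : 0 < r₀)
    {x : Phase 𝔥} (hx : x ∈ m.phaseSpace) {z : ℂ} (h0 : 0 < ‖z‖) (hz : ‖z‖ < r₀) :
    ∑ α ∈ 𝔥.root, ∑ γ ∈ 𝔥.root, quadTerm P B x z α γ = 0 := by
  have h2 : (2 : ℂ) • ∑ α ∈ 𝔥.root, ∑ γ ∈ 𝔥.root, quadTerm P B x z α γ = 0 := by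
    rw [two_smul]
    conv_lhs => enter [2]; rw [Finset.sum_comm]
    simp only [← Finset.sum_add_distrib]
    exact Finset.sum_eq_zero fun α hα => Finset.sum_eq_zero fun γ hγ =>
      quadTerm_add_swap hP hm hr₀ hx h0 hz hα hγ
  exact (smul_eq_zero.1 h2).resolve_left two_ne_zero

theorem lie_cartan_add_sum (B : CartanWeyl 𝔥) (h h' : 𝔥) (f g : Weight ℂ 𝔥 𝔤 → ℂ) :
    ⁅(h : 𝔤) + ∑ α ∈ 𝔥.root, f α • B.e α, (h' : 𝔤) + ∑ α ∈ 𝔥.root, g α • B.e α⁆ =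
      ∑ α ∈ 𝔥.root, (g α * α h - f α * α h') • B.e α +
        ∑ α ∈ 𝔥.root, ∑ γ ∈ 𝔥.root, (f α * g γ) • ⁅B.e α, B.e γ⁆ := by
  have h1 : ∀ (k : 𝔥) (f : Weight ℂ 𝔥 𝔤 → ℂ), ⁅(k : 𝔤), ∑ α ∈ 𝔥.root, f α • B.e α⁆ =
      ∑ α ∈ 𝔥.root, (f α * α k) • B.e α := by
    intro k f
    rw [lie_sum]
    refine Finset.sum_congr rfl fun α hα => ?_
    rw [lie_smul, B.lie_cartan_e hα, smul_smul]
  rw [add_lie, lie_add, lie_add, lie_eq_zero_of_cartan, h1, ← lie_skew _ (h' : 𝔤), h1, zero_add,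
    sum_lie]
  simp only [lie_sum, smul_lie, lie_smul, sub_smul, Finset.sum_sub_distrib, smul_smul]
  simp only [mul_comm]
  abel

/-- The left side is the velocity of L along the flow, with the `rMap` term coming from ξ' = [∂H/∂ξ,
ξ]. Both sides are split into Cartan–root brackets (`e1`, `e2`) and root–root brackets (`e3`). -/
theorem lax_identity (hP : P.IsCanonical r₀) (hm : P.Realizes m B) (hr₀ : 0 < r₀)
    {x : Phase 𝔥} (hx : x ∈ m.phaseSpace) (hJ : J x ∈ P.constraint) {z : ℂ} (h0 : 0 < ‖z‖)
    (hz : ‖z‖ < r₀) :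
    (gradQ (m.ham B) x : 𝔤) + rMap P B x.1 z ⁅gradXi (m.ham B) x,
        (B.cartanPart x.2.2 : 𝔤) + ∑ α ∈ 𝔥.root, B.spin x.2.2 α • B.e α⁆ -
      ∑ α ∈ 𝔥.root, ((deriv (P.φ α (pair α x.1)) z + (P.a z - P.c α (pair α x.1)) *
        P.φ α (pair α x.1) z) * α x.2.1 * B.spin x.2.2 α) • B.e α =
      ⁅laxPartner P B x z, m.lax B x z⁆ := by
  classical
  have hu := (hm.regular_iff x.1).1 hx
  have hq := sum_quadTerm hP hm hr₀ hx h0 hz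
  have hgQ : (gradQ (m.ham B) x : 𝔤) = -∑ α ∈ 𝔥.root, (1 / 2 * deriv (P.V α) (pair α x.1) *
      (B.spin x.2.2 α * B.spin x.2.2 (-α))) • (rootDual α : 𝔤) := by
    rw [gradQ_ham hP hm hr₀ hx]
    push_cast
    rfl
  have hD : gradXi (m.ham B) x = ((0 : 𝔥) : 𝔤) +
      ∑ α ∈ 𝔥.root, (-(P.V α (pair α x.1) * B.spin x.2.2 α)) • B.e α := by
    rw [gradXi_ham hP hm hr₀ hx, Submodule.coe_zero, zero_add]
    simp only [neg_smul, Finset.sum_neg_distrib]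
  have hN : laxPartner P B x z = ((-(P.a z • x.2.1) + deriv P.a z • B.cartanPart x.2.2 : 𝔥) : 𝔤) +
      ∑ α ∈ 𝔥.root, ((deriv (P.φ α (pair α x.1)) z -
      P.c α (pair α x.1) * P.φ α (pair α x.1) z) * B.spin x.2.2 α) • B.e α := by
    rw [laxPartner]
    push_cast
    rfl
  have hL : m.lax B x z = ((x.2.1 + P.a z • B.cartanPart x.2.2 : 𝔥) : 𝔤) +
      ∑ α ∈ 𝔥.root, (P.φ α (pair α x.1) z * B.spin x.2.2 α) • B.e α := by
    rw [hm.lax_eq]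
    push_cast
    rfl
  rw [hD, hN, hL, lie_cartan_add_sum, lie_cartan_add_sum, hgQ]
  rw [map_add (rMap P B x.1 z)]
  simp only [map_sum, map_smul (rMap P B x.1 z)]
  have e1 : ∀ α ∈ 𝔥.root, (B.spin x.2.2 α * α (0 : 𝔥) -
      -(P.V α (pair α x.1) * B.spin x.2.2 α) * α (B.cartanPart x.2.2)) • rMap P B x.1 z (B.e α) =
      (P.V α (pair α x.1) * B.spin x.2.2 α * α (B.cartanPart x.2.2) * P.φ α (pair α x.1) z) •
        B.e α := by
    intro α hα
    rw [rMap_e P B x.1 z hα, smul_smul, ← Weight.toLinear_apply, map_zero]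
    congr 1
    ring
  have e2 : ∑ α ∈ 𝔥.root, ((P.φ α (pair α x.1) z * B.spin x.2.2 α) *
        α (-(P.a z • x.2.1) + deriv P.a z • B.cartanPart x.2.2) -
      (deriv (P.φ α (pair α x.1)) z - P.c α (pair α x.1) * P.φ α (pair α x.1) z) *
        B.spin x.2.2 α * α (x.2.1 + P.a z • B.cartanPart x.2.2)) • B.e α =
      ∑ α ∈ 𝔥.root, (P.V α (pair α x.1) * B.spin x.2.2 α * α (B.cartanPart x.2.2) *
        P.φ α (pair α x.1) z) • B.e α -
      ∑ α ∈ 𝔥.root, ((deriv (P.φ α (pair α x.1)) z + (P.a z - P.c α (pair α x.1)) *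
        P.φ α (pair α x.1) z) * α x.2.1 * B.spin x.2.2 α) • B.e α := by
    rw [← Finset.sum_sub_distrib]
    refine Finset.sum_congr rfl fun α hα => ?_
    -- The terms with α(p) already agree with the equation for ∂_u φ; the constraint is needed only
    -- for those with (α, i*ξ).
    have key := hP.constraint_identity _ hJ α hα _ (hu α hα) z h0 hz
    have hJα : pair α (J x) = α (B.cartanPart x.2.2) := by
      rw [B.weight_cartanPart, pair_eq]
      rfl
    rw [hJα] at key
    simp only [← Weight.toLinear_apply ℂ 𝔥 𝔤] at key ⊢
    rw [← sub_smul]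
    congr 1
    simp only [map_add, map_neg, map_smul, smul_eq_mul]
    linear_combination B.spin x.2.2 α * key
  have e3 : ∑ α ∈ 𝔥.root, ∑ γ ∈ 𝔥.root, ((deriv (P.φ α (pair α x.1)) z -
      P.c α (pair α x.1) * P.φ α (pair α x.1) z) * B.spin x.2.2 α *
      (P.φ γ (pair γ x.1) z * B.spin x.2.2 γ)) • ⁅B.e α, B.e γ⁆ =
      -∑ α ∈ 𝔥.root, (1 / 2 * deriv (P.V α) (pair α x.1) *
      (B.spin x.2.2 α * B.spin x.2.2 (-α))) • (rootDual α : 𝔤) +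
      ∑ α ∈ 𝔥.root, ∑ γ ∈ 𝔥.root, (-(P.V α (pair α x.1) * B.spin x.2.2 α) * B.spin x.2.2 γ) •
        rMap P B x.1 z ⁅B.e α, B.e γ⁆ := by
    have hdiag : ∑ α ∈ 𝔥.root, (1 / 2 * deriv (P.V α) (pair α x.1) *
        (B.spin x.2.2 α * B.spin x.2.2 (-α))) • (rootDual α : 𝔤) =
        ∑ α ∈ 𝔥.root, ∑ γ ∈ 𝔥.root, (B.spin x.2.2 α * B.spin x.2.2 γ) •
          (if γ = -α then (1 / 2 * deriv (P.V α) (pair α x.1)) • (rootDual α : 𝔤) else 0) := by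
      refine Finset.sum_congr rfl fun α hα => ?_
      rw [Finset.sum_eq_single_of_mem (-α) (neg_mem_root hα), if_pos rfl, smul_smul, mul_comm]
      intro γ _ hne
      rw [if_neg hne, smul_zero]
    rw [hdiag]
    refine sub_eq_zero.1 (Eq.trans ?_ hq)
    rw [← Finset.sum_neg_distrib, ← Finset.sum_add_distrib,
      ← Finset.sum_sub_distrib]
    refine Finset.sum_congr rfl fun α _ => ?_
    rw [← Finset.sum_neg_distrib, ← Finset.sum_add_distrib, ← Finset.sum_sub_distrib]
    refine Finset.sum_congr rfl fun γ _ => ?_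
    rw [quadTerm]
    module
  rw [Finset.sum_congr rfl e1, e2, e3]
  abel

theorem hasVelocityAt_lax (hP : P.IsCanonical r₀) (hm : P.Realizes m B) (hr₀ : 0 < r₀) {I : Set ℝ}
    {γ : ℝ → Phase 𝔥} (hγ : ∀ t ∈ I, γ t ∈ m.phaseSpace)
    (htraj : IsTrajectory (m.ham B) γ I) {t : ℝ} (ht : t ∈ I) (hJ : J (γ t) ∈ P.constraint) {z : ℂ}
    (h0 : 0 < ‖z‖) (hz : ‖z‖ < r₀ / 2) :
    HasVelocityAt (fun s : ℝ => m.lax B (γ s) z)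
      ⁅m.R B (γ t).1 (m.laxM B (γ t)) z, m.lax B (γ t) z⁆ t := by
  have hx := hγ t ht
  have hz' : ‖z‖ < r₀ := by linarith
  have hu := (hm.regular_iff (γ t).1).1 hx
  intro l
  -- The multiple of L in R_q(M) drops out of the commutator.
  rw [R_laxM hP hm hx h0 hz, add_lie, smul_lie, lie_self, smul_zero, add_zero,
    ← lax_identity hP hm hr₀ hx hJ h0 hz']
  have hp : HasDerivAt (fun s => l ((γ s).2.1 : 𝔤)) (l (gradQ (m.ham B) (γ t) : 𝔤)) t :=
    htraj.hasDerivAt_momentum ht (l ∘ₗ 𝔥.toSubmodule.subtype)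
  have hξ : ∀ y, HasDerivAt (fun s => (γ s).2.2 y) (killingForm ℂ 𝔤 y ⁅gradXi (m.ham B) (γ t),
      (B.cartanPart (γ t).2.2 : 𝔤) + ∑ α ∈ 𝔥.root, B.spin (γ t).2.2 α • B.e α⁆) t := by
    intro y
    refine (htraj.hasDerivAt_spin ht y).congr_deriv ?_
    -- Invariance of the Killing form turns the Lie–Poisson equation into ξ' = [∂H/∂ξ, ξ] in `𝔤`.
    rw [B.dual_apply_eq (γ t).2.2 ⁅y, _⁆, LieModule.traceForm_comm,
      LieModule.traceForm_apply_lie_apply]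
  -- The sign comes from the normalization {p, q} = 1, under which q' = −p.
  have hφ : ∀ α ∈ 𝔥.root, HasDerivAt (fun s => P.φ α (pair α (γ s).1) z)
      ((deriv (P.φ α (pair α (γ t).1)) z + (P.a z - P.c α (pair α (γ t).1)) *
        P.φ α (pair α (γ t).1) z) * -(α (γ t).2.1)) t := by
    intro α hα
    have h1 := htraj.hasDerivAt_position ht (rootDual α)
    rw [gradP_ham hP hm hr₀ hx, LieModule.traceForm_comm, killingForm_rootDual] at h1
    simp only [← pair_eq] at h1
    exact (hP.hasDerivAt_φ α hα _ (hu α hα) z h0 hz').comp t h1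
  have key := (hp.add (HasDerivAt.fun_sum (u := Finset.univ) fun i _ =>
    ((hξ (B.h i)).const_mul (P.a z)).mul_const (l (B.h i)))).add
    (HasDerivAt.fun_sum fun α hα => (((hφ α hα).mul (hξ (B.e (-α)))).mul_const (l (B.e α))))
  refine (key.congr_of_eventuallyEq (.of_forall fun s => ?_)).congr_deriv ?_
  · have hc : (B.cartanPart (γ s).2.2 : 𝔤) = ∑ i, (γ s).2.2 (B.h i) • (B.h i : 𝔤) := by
      rw [CartanWeyl.cartanPart]
      push_cast
      rfl
    simp only [hm.lax_eq, hc, map_add, map_smul, map_sum, smul_eq_mul, CartanWeyl.spin,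
      Finset.mul_sum, mul_assoc, Pi.add_apply, Pi.mul_apply]
  · rw [rMap_apply]
    simp only [map_add, map_sub, map_smul, map_sum, smul_eq_mul, CartanWeyl.spin, add_mul,
      Finset.sum_add_distrib]
    simp only [mul_neg, neg_mul, Finset.sum_neg_distrib]
    ring

/-! ### The set `Σ` -/

/-- The loop w⁻¹ (e_{-α}, ·) isolates one coefficient of r: the residue at w = 0 is φ_α(−z), and the
half residue at w = z is 1/(2z), independent of q. -/
theorem Realizes.hasPV_test (hP : P.IsCanonical r₀) (hm : P.Realizes m B) {q : Module.Dual ℂ 𝔥}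
    (hq : q ∈ m.regular) {α : Weight ℂ 𝔥 𝔤} (hα : α ∈ 𝔥.root) {z : ℂ} (h0 : 0 < ‖z‖)
    (hz : ‖z‖ < r₀ / 2) :
    m.R B q (fun w => w⁻¹ • killingForm ℂ 𝔤 (B.e (-α))) z =
      (P.φ α (pair α q) (-z) + 1 / 2 * z⁻¹) • B.e (-α) := by
  classical
  have hu := (hm.regular_iff q).1 hq
  have hzero : HasScalarPV (fun _ => 0) z 0 := by
    obtain ⟨h, hh, -⟩ := hP.exists_φ α hα _ (hu α hα)
    have := hh.hasScalarPV 0 0 (differentiableOn_const 0) h0 hz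
    simpa using this
  have key := hm.hasPV_kernelR q (X := fun w => w⁻¹ • killingForm ℂ 𝔤 (B.e (-α)))
    (norm_pos_iff.1 h0) (v := fun _ => 0)
    (v' := fun β => if β = α then P.φ α (pair α q) (-z) + 1 / 2 * z⁻¹ else 0) (fun i => ?_)
    (fun β hβ => ?_)
  · rw [Model.R, key.pv_eq]
    simp [Finset.sum_ite_eq', ite_smul, hα]
  · refine hzero.congr (norm_pos_iff.1 h0) fun w _ _ => ?_
    rw [LinearMap.smul_apply, B.killingForm_e_cartan (neg_mem_root hα), smul_zero, mul_zero]
  · by_cases hβα : β = α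
    · subst hβα
      rw [if_pos rfl]
      obtain ⟨h, hh, -⟩ := hP.exists_φ β hβ _ (hu β hβ)
      refine ((hh.hasScalarPV 0 1 (differentiableOn_const 0) h0 hz).congr (norm_pos_iff.1 h0)
        fun w _ _ => ?_).congr_value ?_
      · have hd := B.e_dual (-β) (neg_mem_root hβ)
        rw [neg_neg] at hd
        rw [LinearMap.smul_apply, hd, smul_eq_mul]
        ring
      · ring
    · rw [if_neg hβα]
      refine hzero.congr (norm_pos_iff.1 h0) fun w _ _ => ?_
      rw [LinearMap.smul_apply, B.killingForm_e_e (neg_mem_root hα) hβ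
        (fun h => hβα (by rw [h, neg_neg])), smul_zero, mul_zero]

theorem isLoop_inv_smul {V : Type*} [AddCommGroup V] [Module ℂ V] [FiniteDimensional ℂ V] (v : V)
    (ρ : ℝ) : IsLoop (fun w => w⁻¹ • v) ρ := by
  refine ⟨1, fun n => if n = 0 then v else 0, fun z _ _ l => ?_⟩
  have h := hasSum_single (f := fun n : ℕ => l (if n = 0 then v else 0) *
    z ^ ((n : ℤ) - ((1 : ℕ) : ℤ))) 0 (fun n hn => by simp [hn])
  simpa [mul_comm] using h

/-- One inclusion tests the derivative on the loops of `hasPV_test`. For the other, r(q, ·) itself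
does not change along q + s J when J satisfies the constraint. -/
theorem sigmaSet_eq (hP : P.IsCanonical r₀) (hm : P.Realizes m B) :
    m.sigmaSet B r₀ = {x | x ∈ m.phaseSpace ∧ J x ∈ m.momentumConstraint} := by
  ext x
  refine and_congr_right fun hx => ?_
  rw [hm.constraint_eq]
  have hu := (hm.regular_iff x.1).1 hx
  constructor
  · intro h
    refine hP.mem_constraint x.1 (J x) hu fun α hα z h0 hz => ?_
    have h1 := h r₀ _ (isLoop_inv_smul (killingForm ℂ 𝔤 (B.e (-α))) r₀) z h0 (by linarith) hz
      (killingForm ℂ 𝔤 (B.e α))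
    -- The formula for the test loops holds only at regular points; these form an open set.
    have hreg : ∀ᶠ s : ℂ in 𝓝 0, x.1 + s • J x ∈ m.regular := by
      simp only [hm.regular_iff, pair_add_smul]
      refine (Finset.eventually_all 𝔥.root).2 fun β hβ => ?_
      have hc : ContinuousAt (fun s : ℂ => pair β x.1 + s * pair β (J x)) 0 := by fun_prop
      refine hc.eventually_mem ((hP.isOpen_dom β hβ).mem_nhds ?_)
      simpa using hu β hβ
    have h2 : HasDerivAt (fun s : ℂ => P.φ α (pair α x.1 + s * pair α (J x)) (-z) + 1 / 2 * z⁻¹)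
        (deriv (fun v => P.φ α v (-z)) (pair α x.1) * pair α (J x)) 0 := by
      have e1 : HasDerivAt (fun s : ℂ => pair α x.1 + s * pair α (J x)) (pair α (J x)) 0 := by
        simpa using ((hasDerivAt_id' (0 : ℂ)).mul_const (pair α (J x))).const_add (pair α x.1)
      have e2 := (hP.hasDerivAt_φ α hα _ (hu α hα) (-z) (by rwa [norm_neg])
        (by rw [norm_neg]; linarith)).differentiableAt.hasDerivAt
      have e3 : HasDerivAt (fun v => P.φ α v (-z)) (deriv (fun v => P.φ α v (-z)) (pair α x.1))
          (pair α x.1 + 0 * pair α (J x)) := by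
        rwa [zero_mul, add_zero]
      exact (e3.comp (0 : ℂ) e1).add_const _
    rw [map_zero] at h1
    refine (h2.congr_of_eventuallyEq ?_).unique h1
    filter_upwards [hreg] with s hs
    rw [hm.hasPV_test hP hs hα h0 hz, map_smul, B.e_dual α hα, pair_add_smul, smul_eq_mul, mul_one]
  · intro h ρ X _ z _ _ _ l
    have hc : ∀ s : ℂ, m.R B (x.1 + s • J x) X z = m.R B x.1 X z := by
      intro s
      have hr : ∀ w, m.r B (x.1 + s • J x) w = m.r B x.1 w := by
        intro w
        simp only [hm.r_eq, pair_add_smul]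
        congr 1
        exact Finset.sum_congr rfl fun α hα => by rw [hP.constraint_const _ h α hα]
      have hk : m.kernelR B (x.1 + s • J x) X z = m.kernelR B x.1 X z :=
        funext fun w => by rw [Model.kernelR, Model.kernelR, hr]
      rw [Model.R, Model.R, hk]
    simp only [hc, map_zero]
    exact hasDerivAt_const _ _

theorem ham_act (hm : P.Realizes m B) (g : cartanTorus 𝔥) (x : Phase 𝔥) :
    m.ham B (act g x) = m.ham B x := by
  rw [hm.ham_eq, hm.ham_eq]
  congr 2
  exact Finset.sum_congr rfl fun α hα => by rw [spin_act_mul B g x hα]; rfl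

end Profile

end Dynamics

/-! ### The rational case -/

section Rational

variable {𝔤 : Type*} [LieRing 𝔤] [LieAlgebra ℂ 𝔤] [FiniteDimensional ℂ 𝔤] [LieAlgebra.IsKilling ℂ 𝔤]
  {𝔥 : LieSubalgebra ℂ 𝔤} [𝔥.IsCartanSubalgebra]

theorem norm_ofReal_quarter {r₀ : ℝ} (hr₀ : 0 < r₀) : ‖((r₀ / 4 : ℝ) : ℂ)‖ = r₀ / 4 := by
  rw [Complex.norm_real, Real.norm_of_nonneg (by positivity)]

open Classical in
/-- `1 / u` for `α ∈ Δ'`, and `0` otherwise. -/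
def ratCoeff (Δ' : Finset (Weight ℂ 𝔥 𝔤)) (α : Weight ℂ 𝔥 𝔤) (u : ℂ) : ℂ :=
  if α ∈ Δ' then u⁻¹ else 0

/-- The coefficients of the rational `r`-matrix. -/
def ratProfile (Δ' : Finset (Weight ℂ 𝔥 𝔤)) : Profile 𝔥 where
  a z := z⁻¹
  φ α u z := z⁻¹ + ratCoeff Δ' α u
  c := ratCoeff Δ'
  V α u := ratCoeff Δ' α u ^ 2
  dom α := {u | α ∈ Δ' → u ≠ 0}
  constraint := {a | ∀ α ∈ Δ', pair α a = 0}

variable {Δ' : Finset (Weight ℂ 𝔥 𝔤)}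

theorem ratCoeff_neg (hneg : ∀ α ∈ Δ', -α ∈ Δ') (α : Weight ℂ 𝔥 𝔤) (u : ℂ) :
    ratCoeff Δ' (-α) (-u) = -ratCoeff Δ' α u := by
  have h : -α ∈ Δ' ↔ α ∈ Δ' := ⟨fun h => neg_neg α ▸ hneg _ h, hneg α⟩
  by_cases hα : α ∈ Δ'
  · rw [ratCoeff, ratCoeff, if_pos hα, if_pos (h.2 hα), inv_neg]
  · rw [ratCoeff, ratCoeff, if_neg hα, if_neg (fun h' => hα (h.1 h')), neg_zero]

theorem hasDerivAt_ratCoeff {α : Weight ℂ 𝔥 𝔤} {u : ℂ} (hu : α ∈ Δ' → u ≠ 0) :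
    HasDerivAt (ratCoeff Δ' α) (-ratCoeff Δ' α u ^ 2) u := by
  by_cases hα : α ∈ Δ'
  · have e : ratCoeff Δ' α = fun u => u⁻¹ := funext fun u => by rw [ratCoeff, if_pos hα]
    rw [e]
    refine (hasDerivAt_inv (hu hα)).congr_deriv ?_
    rw [inv_pow]
  · have e : ratCoeff Δ' α = fun _ => 0 := funext fun u => by rw [ratCoeff, if_neg hα]
    rw [e]
    refine (hasDerivAt_const u (0 : ℂ)).congr_deriv ?_
    ring

theorem deriv_inv_add (k z : ℂ) : deriv (fun z : ℂ => z⁻¹ + k) z = -(z ^ 2)⁻¹ := by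
  rw [deriv_add_const, deriv_inv]

/-- If α and γ are in Δ', so is their sum, and this is 1/(uv) = (1/u + 1/v)/(u + v). If exactly one
is, closure under addition and negation keeps the sum out of Δ', and both products vanish. -/
theorem ratCoeff_add (hneg : ∀ α ∈ Δ', -α ∈ Δ')
    (hadd : ∀ α ∈ Δ', ∀ β ∈ Δ', ∀ δ ∈ 𝔥.root,
        Weight.toLinear ℂ 𝔥 𝔤 δ = Weight.toLinear ℂ 𝔥 𝔤 α + Weight.toLinear ℂ 𝔥 𝔤 β → δ ∈ Δ')
    {α γ β : Weight ℂ 𝔥 𝔤} (hα : α ∈ 𝔥.root) (hγ : γ ∈ 𝔥.root) (hβ : β ∈ 𝔥.root)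
    (hsum : Weight.toLinear ℂ 𝔥 𝔤 β = Weight.toLinear ℂ 𝔥 𝔤 α + Weight.toLinear ℂ 𝔥 𝔤 γ) {u v : ℂ}
    (hu : α ∈ Δ' → u ≠ 0) (hv : γ ∈ Δ' → v ≠ 0) (huv : β ∈ Δ' → u + v ≠ 0) :
    (ratCoeff Δ' α u - ratCoeff Δ' γ v) * (ratCoeff Δ' α u * ratCoeff Δ' γ v -
      (ratCoeff Δ' α u + ratCoeff Δ' γ v) * ratCoeff Δ' β (u + v)) = 0 := by
  by_cases h1 : α ∈ Δ' <;> by_cases h2 : γ ∈ Δ'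
  · have h3 := hadd α h1 γ h2 β hβ hsum
    have hu' := hu h1
    have hv' := hv h2
    have huv' := huv h3
    simp only [ratCoeff, if_pos h1, if_pos h2, if_pos h3]
    field_simp
    ring
  · have h3 : β ∉ Δ' := fun h3 => h2 (hadd β h3 (-α) (hneg α h1) γ hγ (by
      rw [hsum, Weight.toLinear_neg]; abel))
    simp [ratCoeff, if_neg h2, if_neg h3]
  · have h3 : β ∉ Δ' := fun h3 => h1 (hadd β h3 (-γ) (hneg γ h2) α hα (by
      rw [hsum, Weight.toLinear_neg]; abel))
    simp [ratCoeff, if_neg h1, if_neg h3]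
  · simp [ratCoeff, if_neg h1, if_neg h2]

theorem ratProfile_isCanonical (hneg : ∀ α ∈ Δ', -α ∈ Δ') (hsub : Δ' ⊆ 𝔥.root)
    (hadd : ∀ α ∈ Δ', ∀ β ∈ Δ', ∀ δ ∈ 𝔥.root,
        Weight.toLinear ℂ 𝔥 𝔤 δ = Weight.toLinear ℂ 𝔥 𝔤 α + Weight.toLinear ℂ 𝔥 𝔤 β → δ ∈ Δ')
    {r₀ : ℝ} (hr₀ : 0 < r₀) : (ratProfile Δ').IsCanonical r₀ where
  isOpen_dom α _ := by
    by_cases hα : α ∈ Δ'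
    · have : (ratProfile Δ').dom α = {0}ᶜ := by
        ext u
        exact ⟨fun h => h hα, fun h _ => h⟩
      rw [this]
      exact isOpen_compl_singleton
    · have : (ratProfile Δ').dom α = Set.univ := Set.eq_univ_of_forall fun u h => (hα h).elim
      rw [this]
      exact isOpen_univ
  neg_mem_dom α _ u hu := fun h => neg_ne_zero.2 (hu (neg_neg α ▸ hneg _ h))
  exists_a := ⟨fun _ => 0, differentiableOn_const 0, rfl, by simp,
    fun z _ _ => by simp [ratProfile]⟩
  a_neg z := inv_neg
  exists_φ α _ u _ := ⟨fun _ => ratCoeff Δ' α u, ⟨differentiableOn_const _, fun z _ _ => rfl⟩, rfl⟩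
  φ_neg α _ u z := by
    change (-z)⁻¹ + ratCoeff Δ' (-α) (-u) = -(z⁻¹ + ratCoeff Δ' α u)
    rw [ratCoeff_neg hneg, inv_neg]
    ring
  c_neg α _ u := ratCoeff_neg hneg α u
  hasDerivAt_φ α _ u hu z _ _ := by
    refine ((hasDerivAt_ratCoeff hu).const_add z⁻¹).congr_deriv ?_
    change _ = deriv (fun z : ℂ => z⁻¹ + ratCoeff Δ' α u) z +
      (z⁻¹ - ratCoeff Δ' α u) * (z⁻¹ + ratCoeff Δ' α u)
    rw [deriv_inv_add, ← inv_pow]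
    ring
  φ_mul_φ_neg α _ u _ z _ _ := by
    change (z⁻¹ + ratCoeff Δ' α u) * (z⁻¹ + ratCoeff Δ' (-α) (-u)) =
      -deriv (fun z : ℂ => z⁻¹) z - ratCoeff Δ' α u ^ 2
    rw [ratCoeff_neg hneg, deriv_inv, ← inv_pow]
    ring
  φ_add α hα γ hγ β hβ hsum u hu v hv huv z _ _ := by
    have key := ratCoeff_add hneg hadd hα hγ hβ hsum hu hv huv
    change deriv (fun z : ℂ => z⁻¹ + ratCoeff Δ' α u) z * (z⁻¹ + ratCoeff Δ' γ v) -
      (z⁻¹ + ratCoeff Δ' α u) * deriv (fun z : ℂ => z⁻¹ + ratCoeff Δ' γ v) z -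
      (ratCoeff Δ' α u - ratCoeff Δ' γ v) *
        ((z⁻¹ + ratCoeff Δ' α u) * (z⁻¹ + ratCoeff Δ' γ v)) =
      -((ratCoeff Δ' α u ^ 2 - ratCoeff Δ' γ v ^ 2) * (z⁻¹ + ratCoeff Δ' β (u + v)))
    rw [deriv_inv_add, deriv_inv_add, ← inv_pow]
    linear_combination -key
  constraint_identity a ha α _ u _ z _ _ := by
    change pair α a * (deriv (fun z : ℂ => z⁻¹) z * (z⁻¹ + ratCoeff Δ' α u) -
      z⁻¹ * (deriv (fun z : ℂ => z⁻¹ + ratCoeff Δ' α u) z -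
        ratCoeff Δ' α u * (z⁻¹ + ratCoeff Δ' α u)) -
      ratCoeff Δ' α u ^ 2 * (z⁻¹ + ratCoeff Δ' α u)) = 0
    have h : pair α a * ratCoeff Δ' α u = 0 := by
      by_cases hα : α ∈ Δ'
      · rw [ha α hα, zero_mul]
      · rw [ratCoeff, if_neg hα, mul_zero]
    rw [deriv_inv_add, deriv_inv, ← inv_pow]
    linear_combination -ratCoeff Δ' α u ^ 2 * h
  constraint_const a ha α _ u s z := by
    change z⁻¹ + ratCoeff Δ' α (u + s * pair α a) = z⁻¹ + ratCoeff Δ' α u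
    by_cases hα : α ∈ Δ'
    · rw [ha α hα, mul_zero, add_zero]
    · rw [ratCoeff, ratCoeff, if_neg hα, if_neg hα]
  mem_constraint q a hq h := by
    intro α hα
    -- One sample point suffices, since the u-derivative does not depend on z.
    have h1 := h α (hsub hα) ((r₀ / 4 : ℝ) : ℂ) (by rw [norm_ofReal_quarter hr₀]; positivity)
      (by rw [norm_ofReal_quarter hr₀]; linarith)
    have hq' := hq α (hsub hα)
    have h2 : deriv (fun v => (ratProfile Δ').φ α v (-((r₀ / 4 : ℝ) : ℂ))) (pair α q) =
        -ratCoeff Δ' α (pair α q) ^ 2 :=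
      ((hasDerivAt_ratCoeff hq').const_add (-((r₀ / 4 : ℝ) : ℂ))⁻¹).deriv
    rw [h2] at h1
    refine (mul_eq_zero.1 h1).resolve_left ?_
    rw [ratCoeff, if_pos hα]
    exact neg_ne_zero.2 (pow_ne_zero 2 (inv_ne_zero (hq' hα)))

theorem ratProfile_realizes (B : CartanWeyl 𝔥) (hsub : Δ' ⊆ 𝔥.root) (hneg : ∀ α ∈ Δ', -α ∈ Δ')
    (hadd : ∀ α ∈ Δ', ∀ β ∈ Δ', ∀ δ ∈ 𝔥.root,
        Weight.toLinear ℂ 𝔥 𝔤 δ = Weight.toLinear ℂ 𝔥 𝔤 α + Weight.toLinear ℂ 𝔥 𝔤 β → δ ∈ Δ') :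
    (ratProfile Δ').Realizes (.rational Δ' hsub hneg hadd) B where
  r_eq q z := by
    change z⁻¹ • B.casimir + ∑ α ∈ Δ', (pair α q)⁻¹ • B.rootTensor α =
      z⁻¹ • B.cartanTensor + ∑ α ∈ 𝔥.root, (z⁻¹ + ratCoeff Δ' α (pair α q)) • B.rootTensor α
    have h : ∑ α ∈ Δ', (pair α q)⁻¹ • B.rootTensor α =
        ∑ α ∈ 𝔥.root, ratCoeff Δ' α (pair α q) • B.rootTensor α := by
      rw [← Finset.sum_subset hsub]
      · exact Finset.sum_congr rfl fun α hα => by rw [ratCoeff, if_pos hα]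
      · intro α _ hα
        rw [ratCoeff, if_neg hα, zero_smul]
    rw [h, CartanWeyl.casimir]
    simp only [add_smul, Finset.sum_add_distrib, smul_add, Finset.smul_sum]
    abel
  ham_eq x := by
    obtain ⟨q, p, ξ⟩ := x
    change B.kinetic p - 1 / 2 * ∑ α ∈ Δ', B.spin ξ α * B.spin ξ (-α) / pair α q ^ 2 =
      B.kinetic p - 1 / 2 * ∑ α ∈ 𝔥.root,
        ratCoeff Δ' α (pair α q) ^ 2 * (B.spin ξ α * B.spin ξ (-α))
    congr 2
    rw [← Finset.sum_subset hsub]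
    · refine Finset.sum_congr rfl fun α hα => ?_
      rw [ratCoeff, if_pos hα, inv_pow, div_eq_inv_mul]
    · intro α _ hα
      rw [ratCoeff, if_neg hα]
      ring
  regular_iff q := ⟨fun h α _ hα => h α hα, fun h α hα => h α (hsub hα) hα⟩
  constraint_eq := rfl

end Rational

/-! ### The elliptic case -/

/-- Here g = zφ; its difference quotient at 0 is the regular part of φ, so the constant term c is
g'(0). -/
theorem hasSimplePole_of_eq_inv_mul {φ g : ℂ → ℂ} {r₀ : ℝ} (hr₀ : 0 < r₀)
    (hg : DifferentiableOn ℂ g (Metric.ball 0 r₀)) (hg0 : g 0 = 1)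
    (h : ∀ z, 0 < ‖z‖ → ‖z‖ < r₀ → φ z = z⁻¹ * g z) : HasSimplePole φ (dslope g 0) r₀ := by
  refine ⟨(Complex.differentiableOn_dslope (Metric.ball_mem_nhds (0 : ℂ) hr₀)).2 hg,
    fun z h0 hz => ?_⟩
  have hz0 : z ≠ 0 := norm_pos_iff.1 h0
  rw [h z h0 hz, dslope_of_ne _ hz0, slope_def_field, hg0]
  field_simp
  ring

section Elliptic

variable (Λ : PeriodPair)

/-- `-l(u, z)`. -/
def ellCoeff (u z : ℂ) : ℂ := sigma Λ (u + z) / (sigma Λ u * sigma Λ z)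

/-- ζ − 1/z is the logarithmic derivative of σ(z)/z. It vanishes at 0, and so does its derivative,
which is minus ℘ without its pole term. -/
theorem hasSimplePole_zeta {r₀ : ℝ} (hr₀ : 0 < r₀)
    (hpoles : ∀ z : ℂ, 0 < ‖z‖ → ‖z‖ < r₀ → z ∉ Λ.lattice) :
    ∃ s : ℂ → ℂ, DifferentiableOn ℂ s (Metric.ball 0 r₀) ∧ s 0 = 0 ∧
      HasSimplePole (zeta Λ) (fun z => z * s z) r₀ := by
  have hmem : ∀ z ∈ Metric.ball (0 : ℂ) r₀, z ∈ ((Λ.lattice : Set ℂ) \ {0})ᶜ := by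
    rintro z hz ⟨h1, h2⟩
    exact hpoles z (norm_pos_iff.2 h2) (by simpa using hz) h1
  have hd : DifferentiableOn ℂ (logDeriv (sigmaQuot Λ)) (Metric.ball 0 r₀) := fun z hz =>
    (hasDerivAt_logDeriv_sigmaQuot Λ (hmem z hz)).differentiableAt.differentiableWithinAt
  refine ⟨dslope (logDeriv (sigmaQuot Λ)) 0,
    (Complex.differentiableOn_dslope (Metric.ball_mem_nhds (0 : ℂ) hr₀)).2 hd, ?_, ?_, ?_⟩
  · rw [dslope_same, (hasDerivAt_logDeriv_sigmaQuot Λ (hmem 0 (Metric.mem_ball_self hr₀))).deriv,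
      PeriodPair.weierstrassPExcept_zero, neg_zero]
  · exact differentiableOn_id.mul
      ((Complex.differentiableOn_dslope (Metric.ball_mem_nhds (0 : ℂ) hr₀)).2 hd)
  · intro z h0 hz
    have hz0 : z ≠ 0 := norm_pos_iff.1 h0
    rw [zeta_eq Λ (hpoles z h0 hz), dslope_of_ne _ hz0, slope_def_field, logDeriv_sigmaQuot_zero]
    field_simp
    ring

theorem ellCoeff_neg (u z : ℂ) : ellCoeff Λ (-u) (-z) = -ellCoeff Λ u z := by
  rw [ellCoeff, ellCoeff, ← neg_add, sigma_neg, sigma_neg, sigma_neg, neg_mul_neg, neg_div]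

theorem deriv_sigma_eq {z : ℂ} (hz : z ∉ Λ.lattice) :
    deriv (sigma Λ) z = zeta Λ z * sigma Λ z := by
  rw [zeta, div_mul_cancel₀ _ (sigma_ne_zero Λ hz)]

theorem hasDerivAt_ellCoeff_right {u z : ℂ} (hz : z ∉ Λ.lattice) :
    HasDerivAt (ellCoeff Λ u)
      (deriv (sigma Λ) (u + z) / (sigma Λ u * sigma Λ z) - zeta Λ z * ellCoeff Λ u z) z := by
  -- When σ(u) = 0, division by zero makes the function and its stated derivative both zero.
  by_cases hu : sigma Λ u = 0
  · have e : ellCoeff Λ u = fun _ => 0 := funext fun z => by rw [ellCoeff, hu, zero_mul, div_zero]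
    rw [e, hu]
    simpa using hasDerivAt_const z (0 : ℂ)
  have hz' := sigma_ne_zero Λ hz
  have h1 := ((differentiable_sigma Λ (u + z)).hasDerivAt).comp_const_add u z
  have h2 := ((differentiable_sigma Λ z).hasDerivAt).const_mul (sigma Λ u)
  refine (h1.div h2 (mul_ne_zero hu hz')).congr_deriv ?_
  rw [deriv_sigma_eq Λ hz, ellCoeff]
  field_simp

theorem ellCoeff_swap (u z : ℂ) : ellCoeff Λ u z = ellCoeff Λ z u := by
  rw [ellCoeff, ellCoeff, add_comm, mul_comm (sigma Λ u)]

/-- By the symmetry in u and z this is the z-derivative with the variables exchanged. The two differ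
by (ζ(z) − ζ(u)) φ, which is the differential equation with a = c = ζ. -/
theorem hasDerivAt_ellCoeff_left {u z : ℂ} (hu : u ∉ Λ.lattice) :
    HasDerivAt (fun v => ellCoeff Λ v z)
      (deriv (sigma Λ) (u + z) / (sigma Λ u * sigma Λ z) - zeta Λ u * ellCoeff Λ u z) u := by
  have h := hasDerivAt_ellCoeff_right Λ (u := z) hu
  rw [ellCoeff_swap Λ z u, add_comm z u, mul_comm (sigma Λ z)] at h
  exact h.congr_of_eventuallyEq (.of_forall fun v => ellCoeff_swap Λ v z)

theorem hasSimplePole_ellCoeff {r₀ : ℝ} (hr₀ : 0 < r₀)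
    (hpoles : ∀ z : ℂ, 0 < ‖z‖ → ‖z‖ < r₀ → z ∉ Λ.lattice) {u : ℂ} (hu : u ∉ Λ.lattice) :
    ∃ h, HasSimplePole (ellCoeff Λ u) h r₀ ∧ h 0 = zeta Λ u := by
  have hmem : ∀ z ∈ Metric.ball (0 : ℂ) r₀, z ∈ ((Λ.lattice : Set ℂ) \ {0})ᶜ := by
    rintro z hz ⟨h1, h2⟩
    exact hpoles z (norm_pos_iff.2 h2) (by simpa using hz) h1
  have hu' := sigma_ne_zero Λ hu
  have hg : ∀ z ∈ Metric.ball (0 : ℂ) r₀, HasDerivAt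
      (fun z => sigma Λ (u + z) / (sigma Λ u * sigmaQuot Λ z)) _ z := fun z hz =>
    (((differentiable_sigma Λ (u + z)).hasDerivAt).comp_const_add u z).div
      ((differentiable_sigmaQuot Λ z).hasDerivAt.const_mul (sigma Λ u))
      (mul_ne_zero hu' (sigmaQuot_ne_zero Λ (hmem z hz)))
  refine ⟨_, hasSimplePole_of_eq_inv_mul hr₀
    (g := fun z => sigma Λ (u + z) / (sigma Λ u * sigmaQuot Λ z))
    (fun z hz => (hg z hz).differentiableAt.differentiableWithinAt) ?_ ?_, ?_⟩
  · rw [add_zero, sigmaQuot_zero, mul_one, div_self hu']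
  · intro z h0 hz
    rw [ellCoeff, sigma_eq Λ z]
    have hz0 : z ≠ 0 := norm_pos_iff.1 h0
    have := sigmaQuot_ne_zero Λ (hmem z (by simpa using hz))
    field_simp
  · rw [dslope_same, (hg 0 (Metric.mem_ball_self hr₀)).deriv]
    have h0 : deriv (sigmaQuot Λ) 0 = 0 := by
      have := logDeriv_sigmaQuot_zero Λ
      rwa [logDeriv_apply, sigmaQuot_zero, div_one] at this
    rw [h0, add_zero, sigmaQuot_zero, zeta]
    field_simp
    ring

theorem ellCoeff_mul_ellCoeff_neg {u z : ℂ} (hu : u ∉ Λ.lattice) (hz : z ∉ Λ.lattice) :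
    ellCoeff Λ u z * ellCoeff Λ (-u) z = wp Λ z - wp Λ u := by
  have hu' := sigma_ne_zero Λ hu
  have hz' := sigma_ne_zero Λ hz
  have h := sigma_add_mul_sigma_sub Λ hz hu
  rw [← wp_eq Λ hu, ← wp_eq Λ hz] at h
  rw [ellCoeff, ellCoeff, sigma_neg, neg_add_eq_sub, add_comm u z, div_mul_div_comm, h]
  field_simp
  ring

/-- The terms with ζ(z) cancel, the four-term identity factors the numerator, and ℘(v) − ℘(u) is a
product of σ's, so both sides become σ(u+v+z)σ(u−v) over the same denominator. -/
theorem ellCoeff_add {u v z : ℂ} (hu : u ∉ Λ.lattice) (hv : v ∉ Λ.lattice)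
    (huv : u + v ∉ Λ.lattice) (hz : z ∉ Λ.lattice) :
    deriv (ellCoeff Λ u) z * ellCoeff Λ v z - ellCoeff Λ u z * deriv (ellCoeff Λ v) z -
      (zeta Λ u - zeta Λ v) * (ellCoeff Λ u z * ellCoeff Λ v z) =
      -((wp Λ u - wp Λ v) * ellCoeff Λ (u + v) z) := by
  have hu' := sigma_ne_zero Λ hu
  have hv' := sigma_ne_zero Λ hv
  have hz' := sigma_ne_zero Λ hz
  have huv' := sigma_ne_zero Λ huv
  have h4 := deriv_sigma_four_term Λ u v z
  have h2 := sigma_add_mul_sigma_sub Λ hu hv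
  rw [← wp_eq Λ hu, ← wp_eq Λ hv] at h2
  rw [(hasDerivAt_ellCoeff_right Λ hz).deriv, (hasDerivAt_ellCoeff_right Λ hz).deriv]
  rw [deriv_sigma_eq Λ hu, deriv_sigma_eq Λ hv] at h4
  have hw : wp Λ v - wp Λ u = sigma Λ (u + v) * sigma Λ (u - v) /
      (sigma Λ u ^ 2 * sigma Λ v ^ 2) := by
    rw [h2]
    field_simp
  have e : -((wp Λ u - wp Λ v) * ellCoeff Λ (u + v) z) =
      (wp Λ v - wp Λ u) * ellCoeff Λ (u + v) z := by ring
  rw [e, hw]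
  simp only [ellCoeff]
  field_simp
  linear_combination h4

variable {𝔤 : Type*} [LieRing 𝔤] [LieAlgebra ℂ 𝔤] [FiniteDimensional ℂ 𝔤] [LieAlgebra.IsKilling ℂ 𝔤]
  (𝔥 : LieSubalgebra ℂ 𝔤) [𝔥.IsCartanSubalgebra]

/-- The coefficients of the elliptic `r`-matrix. -/
def ellProfile : Profile 𝔥 where
  a := zeta Λ
  φ _ := ellCoeff Λ
  c _ := zeta Λ
  V _ := wp Λ
  dom _ := (Λ.lattice : Set ℂ)ᶜ
  constraint := {0}

theorem pair_zero (α : Weight ℂ 𝔥 𝔤) : pair α 0 = 0 := by rw [pair_eq, LinearMap.zero_apply]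

theorem ellProfile_isCanonical {r₀ : ℝ} (hr₀ : 0 < r₀)
    (hpoles : ∀ z : ℂ, 0 < ‖z‖ → ‖z‖ < r₀ → z ∉ Λ.lattice) :
    (ellProfile Λ 𝔥).IsCanonical r₀ where
  isOpen_dom _ _ := isOpen_compl_lattice Λ
  neg_mem_dom _ _ _ hu := fun h => hu (neg_mem_iff.1 h)
  exists_a := hasSimplePole_zeta Λ hr₀ hpoles
  a_neg := zeta_neg Λ
  exists_φ _ _ _ hu := hasSimplePole_ellCoeff Λ hr₀ hpoles hu
  φ_neg _ _ := ellCoeff_neg Λ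
  c_neg _ _ := zeta_neg Λ
  hasDerivAt_φ _ _ u hu z h0 hz := by
    refine (hasDerivAt_ellCoeff_left Λ hu).congr_deriv ?_
    change _ = deriv (ellCoeff Λ u) z + (zeta Λ z - zeta Λ u) * ellCoeff Λ u z
    rw [(hasDerivAt_ellCoeff_right Λ (hpoles z h0 hz)).deriv]
    ring
  φ_mul_φ_neg _ _ _ hu z h0 hz := ellCoeff_mul_ellCoeff_neg Λ hu (hpoles z h0 hz)
  φ_add _ _ _ _ _ _ _ _ hu _ hv huv z h0 hz := ellCoeff_add Λ hu hv huv (hpoles z h0 hz)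
  constraint_identity a ha α _ _ _ _ _ _ := by
    rw [Set.mem_singleton_iff.1 ha, pair_zero, zero_mul]
  constraint_const a ha α _ _ _ _ := by
    rw [Set.mem_singleton_iff.1 ha, pair_zero, mul_zero, add_zero]
  mem_constraint q a hq h := by
    refine eq_zero_of_pair_eq_zero fun α hα => ?_
    by_contra hne
    have hu := hq α hα
    -- If (α, a) ≠ 0, then ∂_u φ = 0 at all small z. This reads ζ(u − z) = ζ(u), so ζ would be
    -- constant near u = (α, q); below, w = u − z.
    refine not_eventually_zeta_eq_const Λ hu (zeta Λ (pair α q)) ?_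
    filter_upwards [(isOpen_compl_lattice Λ).mem_nhds hu,
      Metric.ball_mem_nhds (pair α q) (half_pos hr₀)] with w hw hwb
    by_cases hwu : w = pair α q
    · rw [hwu]
    have hn0 : 0 < ‖pair α q - w‖ := norm_pos_iff.2 (sub_ne_zero.2 (Ne.symm hwu))
    have hn : ‖pair α q - w‖ < r₀ / 2 := by rwa [mem_ball_iff_norm'] at hwb
    have h1 := (mul_eq_zero.1 (h α hα (pair α q - w) hn0 hn)).resolve_right hne
    have h2 : deriv (fun v => (ellProfile Λ 𝔥).φ α v (-(pair α q - w))) (pair α q) = _ :=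
      (hasDerivAt_ellCoeff_left Λ hu).deriv
    have hz : -(pair α q - w) ∉ Λ.lattice := hpoles _ (by rwa [norm_neg])
      (by rw [norm_neg]; linarith)
    have e : pair α q + -(pair α q - w) = w := by ring
    rw [h1, ellCoeff, e, deriv_sigma_eq Λ hw, mul_div_assoc, ← sub_mul] at h2
    exact sub_eq_zero.1 ((mul_eq_zero.1 h2.symm).resolve_right (div_ne_zero (sigma_ne_zero Λ hw)
      (mul_ne_zero (sigma_ne_zero Λ hu) (sigma_ne_zero Λ hz))))

theorem ellProfile_realizes (B : CartanWeyl 𝔥) : (ellProfile Λ 𝔥).Realizes (.elliptic Λ) B where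
  r_eq q z := by
    change zeta Λ z • B.cartanTensor - ∑ α ∈ 𝔥.root, ell Λ (pair α q) z • B.rootTensor α =
      zeta Λ z • B.cartanTensor + ∑ α ∈ 𝔥.root, ellCoeff Λ (pair α q) z • B.rootTensor α
    rw [sub_eq_add_neg, ← Finset.sum_neg_distrib]
    congr 1
    refine Finset.sum_congr rfl fun α _ => ?_
    rw [ell, neg_smul, neg_neg]
    rfl
  ham_eq _ := rfl
  regular_iff _ := Iff.rfl
  constraint_eq := rfl

end Elliptic

/-! ### The trigonometric case -/

/-! ### Positive roots and the roots spanned by a set of simple roots -/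

section Polarization

variable {𝔤 : Type*} [LieRing 𝔤] [LieAlgebra ℂ 𝔤] [FiniteDimensional ℂ 𝔤] [LieAlgebra.IsKilling ℂ 𝔤]
  {𝔥 : LieSubalgebra ℂ 𝔤} [𝔥.IsCartanSubalgebra]

theorem mem_posRoots {b : (rootSystem 𝔥).Base} {α : Weight ℂ 𝔥 𝔤} (hα : α ∈ 𝔥.root) :
    α ∈ posRoots b ↔ Weight.toLinear ℂ 𝔥 𝔤 α ∈
      AddSubmonoid.closure ((rootSystem 𝔥).root '' (b.support : Set 𝔥.root)) := by
  classical
  rw [posRoots, Finset.mem_filter]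
  exact and_iff_right hα

theorem mem_rootsSpannedBy {S : Finset 𝔥.root} {α : Weight ℂ 𝔥 𝔤} (hα : α ∈ 𝔥.root) :
    α ∈ rootsSpannedBy S ↔ Weight.toLinear ℂ 𝔥 𝔤 α ∈
      Submodule.span ℂ ((rootSystem 𝔥).root '' (S : Set 𝔥.root)) := by
  classical
  rw [rootsSpannedBy, Finset.mem_filter]
  exact and_iff_right hα

theorem coord_closure_support (b : (rootSystem 𝔥).Base) {x : Module.Dual ℂ 𝔥}
    (hx : x ∈ AddSubmonoid.closure ((rootSystem 𝔥).root '' (b.support : Set 𝔥.root)))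
    (i : b.support) : ∃ n : ℕ, b.toWeightBasis.repr x i = n := by
  classical
  induction hx using AddSubmonoid.closure_induction with
  | mem x hx =>
    obtain ⟨j, hj, rfl⟩ := hx
    refine ⟨if (⟨j, hj⟩ : b.support) = i then 1 else 0, ?_⟩
    rw [b.toWeightBasis_repr_root ⟨j, hj⟩, Finsupp.single_apply]
    split_ifs <;> simp
  | zero => exact ⟨0, by simp⟩
  | add x y _ _ hx hy =>
    obtain ⟨n, hn⟩ := hx
    obtain ⟨k, hk⟩ := hy
    exact ⟨n + k, by simp [hn, hk]⟩

theorem coord_span (b : (rootSystem 𝔥).Base) {S : Finset 𝔥.root} (hS : S ⊆ b.support)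
    {x : Module.Dual ℂ 𝔥}
    (hx : x ∈ Submodule.span ℂ ((rootSystem 𝔥).root '' (S : Set 𝔥.root)))
    (i : b.support) (hi : (i : 𝔥.root) ∉ S) : b.toWeightBasis.repr x i = 0 := by
  classical
  induction hx using Submodule.span_induction with
  | mem x hx =>
    obtain ⟨j, hj, rfl⟩ := hx
    rw [b.toWeightBasis_repr_root ⟨j, hS hj⟩, Finsupp.single_apply, if_neg]
    rintro rfl
    exact hi hj
  | zero => simp
  | add x y _ _ hx hy => simp [hx, hy]
  | smul c x _ hx => simp [hx]

theorem exists_coord_ne_zero (b : (rootSystem 𝔥).Base) {S : Finset 𝔥.root} {x : Module.Dual ℂ 𝔥}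
    (hx : x ∉ Submodule.span ℂ ((rootSystem 𝔥).root '' (S : Set 𝔥.root))) :
    ∃ i : b.support, (i : 𝔥.root) ∉ S ∧ b.toWeightBasis.repr x i ≠ 0 := by
  by_contra! h
  refine hx ?_
  rw [← b.toWeightBasis.sum_repr x]
  refine Submodule.sum_mem _ fun i _ => ?_
  by_cases hi : (i : 𝔥.root) ∈ S
  · refine Submodule.smul_mem _ _ (Submodule.subset_span ⟨i, hi, ?_⟩)
    rw [b.toWeightBasis_apply]
  · rw [h i hi, zero_smul]
    exact Submodule.zero_mem _

theorem neg_mem_posRoots (b : (rootSystem 𝔥).Base) {α : Weight ℂ 𝔥 𝔤} (hα : α ∈ 𝔥.root)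
    (h : α ∉ posRoots b) : -α ∈ posRoots b := by
  rw [mem_posRoots hα] at h
  rw [mem_posRoots (neg_mem_root hα), Weight.toLinear_neg]
  exact (b.root_mem_or_neg_mem ⟨α, hα⟩).resolve_left h

theorem coord_eq_zero_of_neg (b : (rootSystem 𝔥).Base) {x : Module.Dual ℂ 𝔥} {i : b.support}
    (h : ∃ n : ℕ, b.toWeightBasis.repr x i = n) (h' : ∃ n : ℕ, b.toWeightBasis.repr (-x) i = n) :
    b.toWeightBasis.repr x i = 0 := by
  obtain ⟨n, hn⟩ := h
  obtain ⟨k, hk⟩ := h'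
  have e : ((n + k : ℕ) : ℂ) = 0 := by
    push_cast
    rw [← hn, ← hk]
    simp
  have : n = 0 := by
    have := Nat.cast_eq_zero.1 e
    omega
  rw [hn, this, Nat.cast_zero]

theorem neg_mem_posRoots_iff (b : (rootSystem 𝔥).Base) {α : Weight ℂ 𝔥 𝔤} (hα : α ∈ 𝔥.root) :
    -α ∈ posRoots b ↔ α ∉ posRoots b := by
  refine ⟨fun h h' => ?_, neg_mem_posRoots b hα⟩
  rw [mem_posRoots (neg_mem_root hα), Weight.toLinear_neg] at h
  rw [mem_posRoots hα] at h'
  have h0 : Weight.toLinear ℂ 𝔥 𝔤 α = 0 := by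
    refine b.toWeightBasis.ext_elem fun i => ?_
    rw [coord_eq_zero_of_neg b (coord_closure_support b h' i) (coord_closure_support b h i)]
    simp
  refine mem_root.1 hα (funext fun k => ?_)
  rw [← Weight.toLinear_apply, h0]
  rfl

theorem neg_mem_rootsSpannedBy_iff {S : Finset 𝔥.root} {α : Weight ℂ 𝔥 𝔤} (hα : α ∈ 𝔥.root) :
    -α ∈ rootsSpannedBy S ↔ α ∈ rootsSpannedBy S := by
  rw [mem_rootsSpannedBy hα, mem_rootsSpannedBy (neg_mem_root hα), Weight.toLinear_neg,
    neg_mem_iff]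

variable {α γ β : Weight ℂ 𝔥 𝔤}

theorem add_mem_rootsSpannedBy_iff {S : Finset 𝔥.root} (hαS : α ∈ rootsSpannedBy S)
    (hα : α ∈ 𝔥.root) (hγ : γ ∈ 𝔥.root) (hβ : β ∈ 𝔥.root)
    (hsum : Weight.toLinear ℂ 𝔥 𝔤 β = Weight.toLinear ℂ 𝔥 𝔤 α + Weight.toLinear ℂ 𝔥 𝔤 γ) :
    β ∈ rootsSpannedBy S ↔ γ ∈ rootsSpannedBy S := by
  rw [mem_rootsSpannedBy hα] at hαS
  rw [mem_rootsSpannedBy hβ, mem_rootsSpannedBy hγ, hsum]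
  exact Submodule.add_mem_iff_right _ hαS

/-- Some simple root outside S has a nonzero coordinate in γ. Adding α, which lies in the span of S,
leaves this coordinate unchanged, and its sign decides positivity. -/
theorem add_mem_posRoots_iff (b : (rootSystem 𝔥).Base) {S : Finset 𝔥.root} (hS : S ⊆ b.support)
    (hαS : α ∈ rootsSpannedBy S) (hγS : γ ∉ rootsSpannedBy S)
    (hα : α ∈ 𝔥.root) (hγ : γ ∈ 𝔥.root) (hβ : β ∈ 𝔥.root)
    (hsum : Weight.toLinear ℂ 𝔥 𝔤 β = Weight.toLinear ℂ 𝔥 𝔤 α + Weight.toLinear ℂ 𝔥 𝔤 γ) :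
    β ∈ posRoots b ↔ γ ∈ posRoots b := by
  rw [mem_rootsSpannedBy hα] at hαS
  rw [mem_rootsSpannedBy hγ] at hγS
  obtain ⟨i, hiS, hi⟩ := exists_coord_ne_zero b hγS
  have hrepr : b.toWeightBasis.repr (Weight.toLinear ℂ 𝔥 𝔤 β) i =
      b.toWeightBasis.repr (Weight.toLinear ℂ 𝔥 𝔤 γ) i := by
    rw [hsum, map_add, Finsupp.add_apply, coord_span b hS hαS i hiS, zero_add]
  have key : ∀ δ ∈ 𝔥.root, ∀ ε ∈ 𝔥.root, b.toWeightBasis.repr (Weight.toLinear ℂ 𝔥 𝔤 δ) i =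
      b.toWeightBasis.repr (Weight.toLinear ℂ 𝔥 𝔤 ε) i →
      b.toWeightBasis.repr (Weight.toLinear ℂ 𝔥 𝔤 ε) i ≠ 0 → δ ∈ posRoots b → ε ∈ posRoots b := by
    intro δ hδ ε hε h h0 hδp
    by_contra hεp
    have h1 := neg_mem_posRoots b hε hεp
    rw [mem_posRoots (neg_mem_root hε), Weight.toLinear_neg] at h1
    rw [mem_posRoots hδ] at hδp
    refine h0 (coord_eq_zero_of_neg b ?_ (coord_closure_support b h1 i))
    rw [← h]
    exact coord_closure_support b hδp i
  exact ⟨key β hβ γ hγ hrepr hi, key γ hγ β hβ hrepr.symm (hrepr ▸ hi)⟩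

end Polarization

/-! ### Expansion of the cotangent at zero and its addition formula -/

section Cotangent

/-- The entire function `sin z / z`. -/
def sinQuot : ℂ → ℂ := dslope Complex.sin 0

theorem sin_eq_mul_sinQuot (z : ℂ) : Complex.sin z = z * sinQuot z := by
  have h := sub_smul_dslope Complex.sin 0 z
  rw [Complex.sin_zero, sub_zero, sub_zero, smul_eq_mul] at h
  exact h.symm

theorem sinQuot_zero : sinQuot 0 = 1 := by
  rw [sinQuot, dslope_same, Complex.deriv_sin, Complex.cos_zero]

theorem differentiable_dslope {f : ℂ → ℂ} (hf : Differentiable ℂ f) (c : ℂ) :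
    Differentiable ℂ (dslope f c) := by
  rw [← differentiableOn_univ] at hf ⊢
  exact (Complex.differentiableOn_dslope univ_mem).2 hf

theorem differentiable_sinQuot : Differentiable ℂ sinQuot :=
  differentiable_dslope Complex.differentiable_sin 0

theorem sinQuot_eq_div {z : ℂ} (hz : z ≠ 0) : sinQuot z = Complex.sin z / z := by
  rw [sin_eq_mul_sinQuot, mul_div_cancel_left₀ _ hz]

theorem sinQuot_neg (z : ℂ) : sinQuot (-z) = sinQuot z := by
  by_cases hz : z = 0
  · rw [hz, neg_zero]
  · rw [sinQuot_eq_div hz, sinQuot_eq_div (neg_ne_zero.2 hz), Complex.sin_neg, neg_div_neg_eq]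

theorem deriv_sinQuot_zero : deriv sinQuot 0 = 0 := by
  have h := deriv_comp_neg sinQuot 0
  rw [funext sinQuot_neg, neg_zero] at h
  linear_combination h / 2

/-- The entire function `(sin z - z) / z ^ 3`. -/
def sinRem : ℂ → ℂ := dslope (dslope sinQuot 0) 0

theorem sinQuot_eq_sinRem (z : ℂ) : sinQuot z = 1 + z ^ 2 * sinRem z := by
  have h1 := sub_smul_dslope sinQuot 0 z
  have h2 := sub_smul_dslope (dslope sinQuot 0) 0 z
  rw [dslope_same, deriv_sinQuot_zero, sub_zero, sub_zero, smul_eq_mul] at h2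
  rw [sinQuot_zero, sub_zero, smul_eq_mul, ← h2] at h1
  rw [sinRem]
  linear_combination -h1

theorem differentiable_sinRem : Differentiable ℂ sinRem :=
  differentiable_dslope (differentiable_dslope differentiable_sinQuot 0) 0

/-- The triple-angle formula for z = 3 · (z/3) gives a relation between `sinRem z` and `sinRem (z /
3)` off 0. At z = 0, by continuity, it says (8/9) · `sinRem 0` = −4/27. -/
theorem sinRem_zero : sinRem 0 = -1 / 6 := by
  have h : ∀ z ≠ 0, sinRem z - sinRem (z / 3) / 9 + 4 / 27 * sinQuot (z / 3) ^ 3 = 0 := by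
    intro z hz
    have h3 := Complex.sin_three_mul (z / 3)
    rw [mul_div_cancel₀ z (three_ne_zero), sin_eq_mul_sinQuot z, sin_eq_mul_sinQuot (z / 3),
      sinQuot_eq_sinRem z] at h3
    have h4 := sinQuot_eq_sinRem (z / 3)
    have h5 : z ^ 3 * (sinRem z - sinRem (z / 3) / 9 + 4 / 27 * sinQuot (z / 3) ^ 3) = 0 := by
      linear_combination h3 + z * h4
    exact (mul_eq_zero.1 h5).resolve_left (pow_ne_zero 3 hz)
  have hc : Continuous fun z : ℂ => sinRem z - sinRem (z / 3) / 9 + 4 / 27 * sinQuot (z / 3) ^ 3 := by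
    have h1 := differentiable_sinRem.continuous
    have h2 := differentiable_sinQuot.continuous
    fun_prop
  have h0 := (isClosed_eq hc continuous_const).closure_subset_iff.2
    (show ({0}ᶜ : Set ℂ) ⊆ {z | _ = (0 : ℂ)} from fun z hz => h z hz)
  have h0' := h0 ((dense_compl_singleton (0 : ℂ)).closure_eq ▸ Set.mem_univ (0 : ℂ))
  simp only [Set.mem_ofPred_eq, zero_div, sinQuot_zero] at h0'
  linear_combination 9 / 8 * h0'

theorem cos_eq_sinQuot (z : ℂ) : Complex.cos z = 1 - z ^ 2 * (sinQuot (z / 2) ^ 2 / 2) := by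
  have h := Complex.cos_two_mul (z / 2)
  have h2 := Complex.sin_sq_add_cos_sq (z / 2)
  rw [mul_div_cancel₀ z two_ne_zero] at h
  rw [sin_eq_mul_sinQuot] at h2
  linear_combination h + 2 * h2

theorem sinQuot_ne_zero {z : ℂ} (h : z ≠ 0 → Complex.sin z ≠ 0) : sinQuot z ≠ 0 := by
  by_cases hz : z = 0
  · rw [hz, sinQuot_zero]
    exact one_ne_zero
  · rw [sinQuot_eq_div hz]
    exact div_ne_zero (h hz) hz

/-- cot z = 1/z − z/3 + …, so adding z/3 removes the linear term; at 0 this is −1/2 + 1/6 + 1/3 = 0.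
-/
theorem hasSimplePole_cot {r₀ : ℝ}
    (hpoles : ∀ z : ℂ, 0 < ‖z‖ → ‖z‖ < r₀ → Complex.sin z ≠ 0) :
    ∃ s : ℂ → ℂ, DifferentiableOn ℂ s (Metric.ball 0 r₀) ∧ s 0 = 0 ∧
      HasSimplePole (fun z => Complex.cot z + z / 3) (fun z => z * s z) r₀ := by
  have hS : ∀ z ∈ Metric.ball (0 : ℂ) r₀, sinQuot z ≠ 0 := fun z hz =>
    sinQuot_ne_zero fun h0 => hpoles z (norm_pos_iff.2 h0) (by simpa using hz)
  have hd : DifferentiableOn ℂ (fun z => (-(sinQuot (z / 2) ^ 2 / 2) - sinRem z) / sinQuot z + 1 / 3)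
      (Metric.ball 0 r₀) := by
    have h1 := differentiable_sinQuot
    have h2 := differentiable_sinRem
    have h3 : Differentiable ℂ fun z => -(sinQuot (z / 2) ^ 2 / 2) - sinRem z := by fun_prop
    exact (h3.differentiableOn.div h1.differentiableOn hS).add_const _
  refine ⟨_, hd, ?_, ⟨differentiableOn_id.mul hd, fun z h0 hz => ?_⟩⟩
  · rw [zero_div, sinQuot_zero, sinRem_zero]
    norm_num
  · have hz0 : z ≠ 0 := norm_pos_iff.1 h0
    have hSz := hS z (by simpa using hz)
    have e := sinQuot_eq_sinRem z
    rw [Complex.cot_eq_cos_div_sin, sin_eq_mul_sinQuot, cos_eq_sinQuot]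
    field_simp
    linear_combination -6 * e

theorem hasDerivAt_cot {z : ℂ} (hz : Complex.sin z ≠ 0) :
    HasDerivAt Complex.cot (-(1 + Complex.cot z ^ 2)) z := by
  have h := (Complex.hasDerivAt_cos z).div (Complex.hasDerivAt_sin z) hz
  refine (h.congr_of_eventuallyEq (.of_forall fun w => Complex.cot_eq_cos_div_sin w)).congr_deriv ?_
  rw [Complex.cot_eq_cos_div_sin]
  field_simp
  ring

theorem cot_add_mul {u v : ℂ} (hu : Complex.sin u ≠ 0) (hv : Complex.sin v ≠ 0)
    (huv : Complex.sin (u + v) ≠ 0) :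
    (Complex.cot u + Complex.cot v) * Complex.cot (u + v) = Complex.cot u * Complex.cot v - 1 := by
  simp only [Complex.cot_eq_cos_div_sin]
  rw [Complex.sin_add] at huv
  rw [Complex.sin_add, Complex.cos_add]
  field_simp
  ring

end Cotangent

/-! ### The trigonometric coefficients and their functional equations -/

section Trigonometric

variable {𝔤 : Type*} [LieRing 𝔤] [LieAlgebra ℂ 𝔤] [FiniteDimensional ℂ 𝔤] [LieAlgebra.IsKilling ℂ 𝔤]
  {𝔥 : LieSubalgebra ℂ 𝔤} [𝔥.IsCartanSubalgebra] (b : (rootSystem 𝔥).Base) (S : Finset 𝔥.root)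

open Classical in
/-- The coefficients `φ_α(u, z)`, without the exponential factor. -/
def trigCoeff (α : Weight ℂ 𝔥 𝔤) (u z : ℂ) : ℂ :=
  if α ∈ rootsSpannedBy S then Complex.sin (u + z) / (Complex.sin u * Complex.sin z)
  else if α ∈ posRoots b then Complex.exp (-(Complex.I * z)) / Complex.sin z
  else Complex.exp (Complex.I * z) / Complex.sin z

open Classical in
/-- `φ_α(u, z) - cot z`. -/
def trigCot (α : Weight ℂ 𝔥 𝔤) (u : ℂ) : ℂ :=
  if α ∈ rootsSpannedBy S then Complex.cot u else if α ∈ posRoots b then -Complex.I else Complex.I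

open Classical in
/-- The potential of the trigonometric Hamiltonian. -/
def trigPotential (α : Weight ℂ 𝔥 𝔤) (u : ℂ) : ℂ :=
  if α ∈ rootsSpannedBy S then 1 / Complex.sin u ^ 2 - 1 / 3 else -1 / 3

variable {b S}

theorem rootsSpannedBy_subset : rootsSpannedBy S ⊆ 𝔥.root := by
  classical
  exact Finset.filter_subset _ _

theorem posRoots_subset : posRoots b ⊆ 𝔥.root := by
  classical
  exact Finset.filter_subset _ _

/-- The constants ∓i are the limits of cot at ±i∞ and the stationary solutions of C' = −(1 + C²).
Hence the same formulas serve the roots inside and outside Δ(S). -/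
theorem trigCot_sq {α : Weight ℂ 𝔥 𝔤} (hα : α ∉ rootsSpannedBy S) (u : ℂ) :
    trigCot b S α u ^ 2 = -1 := by
  rw [trigCot, if_neg hα]
  split_ifs <;> simp

theorem trigPotential_eq {α : Weight ℂ 𝔥 𝔤} {u : ℂ}
    (hu : α ∈ rootsSpannedBy S → Complex.sin u ≠ 0) :
    trigPotential S α u = trigCot b S α u ^ 2 + 2 / 3 := by
  by_cases hα : α ∈ rootsSpannedBy S
  · have hu' := hu hα
    have h := Complex.sin_sq_add_cos_sq u
    rw [trigPotential, trigCot, if_pos hα, if_pos hα, Complex.cot_eq_cos_div_sin]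
    field_simp
    linear_combination -3 * h
  · rw [trigCot_sq hα, trigPotential, if_neg hα]
    norm_num

theorem trigCoeff_eq {α : Weight ℂ 𝔥 𝔤} {u z : ℂ} (hu : α ∈ rootsSpannedBy S → Complex.sin u ≠ 0)
    (hz : Complex.sin z ≠ 0) : trigCoeff b S α u z = Complex.cot z + trigCot b S α u := by
  rw [trigCoeff, trigCot]
  split_ifs with h1 h2
  · have hu' := hu h1
    rw [Complex.cot_eq_cos_div_sin, Complex.cot_eq_cos_div_sin, Complex.sin_add]
    field_simp
  · rw [Complex.cot_eq_cos_div_sin, mul_comm, ← neg_mul, Complex.exp_mul_I, Complex.cos_neg,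
      Complex.sin_neg]
    field_simp
  · rw [Complex.cot_eq_cos_div_sin, mul_comm, Complex.exp_mul_I]
    field_simp

theorem trigCoeff_neg {α : Weight ℂ 𝔥 𝔤} (hα : α ∈ 𝔥.root) (u z : ℂ) :
    trigCoeff b S (-α) (-u) (-z) = -trigCoeff b S α u z := by
  have h1 := neg_mem_rootsSpannedBy_iff (S := S) hα
  have h2 := neg_mem_posRoots_iff b hα
  by_cases hS : α ∈ rootsSpannedBy S
  · rw [trigCoeff, trigCoeff, if_pos hS, if_pos (h1.2 hS), ← neg_add, Complex.sin_neg,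
      Complex.sin_neg, Complex.sin_neg, neg_mul_neg, neg_div]
  · by_cases hp : α ∈ posRoots b
    · rw [trigCoeff, trigCoeff, if_neg hS, if_neg (fun h => hS (h1.1 h)), if_pos hp,
        if_neg (fun h => h2.1 h hp), Complex.sin_neg, mul_neg, div_neg]
    · rw [trigCoeff, trigCoeff, if_neg hS, if_neg (fun h => hS (h1.1 h)), if_neg hp,
        if_pos (h2.2 hp), Complex.sin_neg, mul_neg, neg_neg, div_neg]

theorem trigCot_neg {α : Weight ℂ 𝔥 𝔤} (hα : α ∈ 𝔥.root) (u : ℂ) :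
    trigCot b S (-α) (-u) = -trigCot b S α u := by
  have h1 := neg_mem_rootsSpannedBy_iff (S := S) hα
  have h2 := neg_mem_posRoots_iff b hα
  by_cases hS : α ∈ rootsSpannedBy S
  · rw [trigCot, trigCot, if_pos hS, if_pos (h1.2 hS), Complex.cot_eq_cos_div_sin,
      Complex.cot_eq_cos_div_sin, Complex.sin_neg, Complex.cos_neg, div_neg]
  · by_cases hp : α ∈ posRoots b
    · rw [trigCot, trigCot, if_neg hS, if_neg (fun h => hS (h1.1 h)), if_pos hp,
        if_neg (fun h => h2.1 h hp), neg_neg]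
    · rw [trigCot, trigCot, if_neg hS, if_neg (fun h => hS (h1.1 h)), if_neg hp,
        if_pos (h2.2 hp)]

theorem hasDerivAt_trigCot {α : Weight ℂ 𝔥 𝔤} {u : ℂ}
    (hu : α ∈ rootsSpannedBy S → Complex.sin u ≠ 0) :
    HasDerivAt (trigCot b S α) (-(1 + trigCot b S α u ^ 2)) u := by
  by_cases hS : α ∈ rootsSpannedBy S
  · have e : trigCot b S α = Complex.cot := funext fun u => by rw [trigCot, if_pos hS]
    rw [e]
    exact hasDerivAt_cot (hu hS)
  · rw [trigCot_sq hS]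
    have e : trigCot b S α = fun _ => trigCot b S α u := funext fun v => by
      rw [trigCot, trigCot, if_neg hS, if_neg hS]
    rw [e]
    simpa using hasDerivAt_const u (trigCot b S α u)

/-- If both roots are in Δ(S), this is the addition formula of cot. If exactly one is, the sum β has
the same constant as the other root, whose square is −1. If neither is, the constants are ±i: when
equal the first factor vanishes, when opposite the second does, whatever β is. -/
theorem trigCot_add (hS : S ⊆ b.support)
    {α γ β : Weight ℂ 𝔥 𝔤} (hα : α ∈ 𝔥.root) (hγ : γ ∈ 𝔥.root) (hβ : β ∈ 𝔥.root)
    (hsum : Weight.toLinear ℂ 𝔥 𝔤 β = Weight.toLinear ℂ 𝔥 𝔤 α + Weight.toLinear ℂ 𝔥 𝔤 γ) {u v : ℂ}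
    (hu : α ∈ rootsSpannedBy S → Complex.sin u ≠ 0)
    (hv : γ ∈ rootsSpannedBy S → Complex.sin v ≠ 0)
    (huv : β ∈ rootsSpannedBy S → Complex.sin (u + v) ≠ 0) :
    (trigCot b S α u - trigCot b S γ v) * (1 - trigCot b S α u * trigCot b S γ v +
      (trigCot b S α u + trigCot b S γ v) * trigCot b S β (u + v)) = 0 := by
  classical
  by_cases h1 : α ∈ rootsSpannedBy S
  · have hβγ := add_mem_rootsSpannedBy_iff h1 hα hγ hβ hsum
    by_cases h2 : γ ∈ rootsSpannedBy S
    · have h3 := hβγ.2 h2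
      have h := cot_add_mul (hu h1) (hv h2) (huv h3)
      simp only [trigCot, if_pos h1, if_pos h2, if_pos h3]
      linear_combination (Complex.cot u - Complex.cot v) * h
    · have h3 : β ∉ rootsSpannedBy S := fun h => h2 (hβγ.1 h)
      have h4 := add_mem_posRoots_iff b hS h1 h2 hα hγ hβ hsum
      have e : trigCot b S β (u + v) = trigCot b S γ v := by
        rw [trigCot, trigCot, if_neg h2, if_neg h3]
        exact if_congr h4 rfl rfl
      rw [e]
      linear_combination (trigCot b S α u - trigCot b S γ v) * trigCot_sq h2 v
  · by_cases h2 : γ ∈ rootsSpannedBy S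
    · have hsum' := hsum.trans (add_comm _ _)
      have hβα := add_mem_rootsSpannedBy_iff h2 hγ hα hβ hsum'
      have h3 : β ∉ rootsSpannedBy S := fun h => h1 (hβα.1 h)
      have h4 := add_mem_posRoots_iff b hS h2 h1 hγ hα hβ hsum'
      have e : trigCot b S β (u + v) = trigCot b S α u := by
        rw [trigCot, trigCot, if_neg h1, if_neg h3]
        exact if_congr h4 rfl rfl
      rw [e]
      linear_combination (trigCot b S α u - trigCot b S γ v) * trigCot_sq h1 u
    · have e1 := trigCot_sq (b := b) h1 u
      have e2 := trigCot_sq (b := b) h2 v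
      rcases sq_eq_sq_iff_eq_or_eq_neg.1 (e1.trans e2.symm) with h | h
      · rw [h]
        ring
      · rw [h]
        linear_combination (-2 * trigCot b S γ v) * e2

variable (b S) in
/-- The coefficients of the trigonometric `r`-matrix. -/
def trigProfile : Profile 𝔥 where
  a z := Complex.cot z + z / 3
  φ α u z := trigCoeff b S α u z * Complex.exp (z * u / 3)
  c α u := trigCot b S α u + u / 3
  V := trigPotential S
  dom α := {u | α ∈ rootsSpannedBy S → Complex.sin u ≠ 0}
  constraint := {0}

theorem hasDerivAt_trigCoeff_mul_exp {α : Weight ℂ 𝔥 𝔤} {u z : ℂ}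
    (hu : α ∈ rootsSpannedBy S → Complex.sin u ≠ 0) (hz : Complex.sin z ≠ 0) :
    HasDerivAt (fun z => trigCoeff b S α u z * Complex.exp (z * u / 3))
      ((-(1 + Complex.cot z ^ 2) + u / 3 * (Complex.cot z + trigCot b S α u)) *
        Complex.exp (z * u / 3)) z := by
  have h1 := ((hasDerivAt_cot hz).add_const (trigCot b S α u)).mul
    ((((hasDerivAt_id' z).mul_const u).div_const 3).cexp)
  refine (h1.congr_of_eventuallyEq ?_).congr_deriv (by ring)
  filter_upwards [Complex.continuous_sin.continuousAt.eventually_ne hz] with w hw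
  rw [trigCoeff_eq hu hw]
  rfl

theorem hasDerivAt_trigCoeff_mul_exp_left {α : Weight ℂ 𝔥 𝔤} {u z : ℂ}
    (hu : α ∈ rootsSpannedBy S → Complex.sin u ≠ 0) (hz : Complex.sin z ≠ 0) :
    HasDerivAt (fun u => trigCoeff b S α u z * Complex.exp (z * u / 3))
      ((-(1 + trigCot b S α u ^ 2) + z / 3 * (Complex.cot z + trigCot b S α u)) *
        Complex.exp (z * u / 3)) u := by
  have h1 := ((hasDerivAt_trigCot (b := b) hu).const_add (Complex.cot z)).mul
    ((((hasDerivAt_id' u).const_mul z).div_const 3).cexp)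
  refine (h1.congr_of_eventuallyEq ?_).congr_deriv (by ring)
  have hev : ∀ᶠ v in 𝓝 u, α ∈ rootsSpannedBy S → Complex.sin v ≠ 0 := by
    by_cases hS : α ∈ rootsSpannedBy S
    · filter_upwards [Complex.continuous_sin.continuousAt.eventually_ne (hu hS)] with v hv _
      exact hv
    · exact .of_forall fun v h => (hS h).elim
  filter_upwards [hev] with v hv
  rw [trigCoeff_eq hv hz]
  rfl

theorem deriv_cot_add {z : ℂ} (hz : Complex.sin z ≠ 0) :
    deriv (fun z => Complex.cot z + z / 3) z = -(1 + Complex.cot z ^ 2) + 1 / 3 :=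
  ((hasDerivAt_cot hz).add ((hasDerivAt_id' z).div_const 3)).deriv

/-- z cot z tends to 1 at 0. The value 3 is the one at which the u-derivative of φ could still
vanish when C_α = 0. -/
theorem exists_mul_cot_ne_three {r₀ : ℝ} (hr₀ : 0 < r₀) :
    ∃ z : ℂ, 0 < ‖z‖ ∧ ‖z‖ < r₀ / 2 ∧ z * Complex.cot z ≠ 3 := by
  have hc : ContinuousAt (fun z => Complex.cos z / sinQuot z) 0 :=
    Complex.continuous_cos.continuousAt.div differentiable_sinQuot.continuous.continuousAt
      (by rw [sinQuot_zero]; exact one_ne_zero)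
  have h1 : ∀ᶠ z in 𝓝 (0 : ℂ), Complex.cos z / sinQuot z ≠ 3 := by
    refine hc.eventually_ne ?_
    rw [sinQuot_zero, Complex.cos_zero]
    norm_num
  have h2 := (h1.and (Metric.ball_mem_nhds (0 : ℂ) (half_pos hr₀))).filter_mono
    (nhdsWithin_le_nhds (s := {0}ᶜ))
  obtain ⟨z, ⟨hz, hzb⟩, hz0⟩ := (h2.and self_mem_nhdsWithin).exists
  refine ⟨z, norm_pos_iff.2 hz0, by simpa using hzb, fun h => hz ?_⟩
  have hz0' : z ≠ 0 := hz0
  rw [← h, Complex.cot_eq_cos_div_sin, sin_eq_mul_sinQuot]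
  field_simp

theorem hasSimplePole_trigCoeff {r₀ : ℝ} (hr₀ : 0 < r₀)
    (hpoles : ∀ z : ℂ, 0 < ‖z‖ → ‖z‖ < r₀ → Complex.sin z ≠ 0) {α : Weight ℂ 𝔥 𝔤} {u : ℂ}
    (hu : α ∈ rootsSpannedBy S → Complex.sin u ≠ 0) :
    ∃ h, HasSimplePole (fun z => trigCoeff b S α u z * Complex.exp (z * u / 3)) h r₀ ∧
      h 0 = trigCot b S α u + u / 3 := by
  have hS : ∀ z ∈ Metric.ball (0 : ℂ) r₀, sinQuot z ≠ 0 := fun z hz =>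
    sinQuot_ne_zero fun h0 => hpoles z (norm_pos_iff.2 h0) (by simpa using hz)
  have hg : ∀ z ∈ Metric.ball (0 : ℂ) r₀, HasDerivAt
      (fun z => (Complex.cos z + trigCot b S α u * Complex.sin z) / sinQuot z *
        Complex.exp (z * u / 3)) _ z := fun z hz =>
    (((Complex.hasDerivAt_cos z).add ((Complex.hasDerivAt_sin z).const_mul _)).div
      (differentiable_sinQuot z).hasDerivAt (hS z hz)).mul
      ((((hasDerivAt_id' z).mul_const u).div_const 3).cexp)
  refine ⟨_, hasSimplePole_of_eq_inv_mul hr₀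
    (g := fun z => (Complex.cos z + trigCot b S α u * Complex.sin z) / sinQuot z *
        Complex.exp (z * u / 3))
    (fun z hz => (hg z hz).differentiableAt.differentiableWithinAt) ?_ ?_, ?_⟩
  · simp [sinQuot_zero]
  · intro z h0 hz
    have hz0 : z ≠ 0 := norm_pos_iff.1 h0
    have hSz := hS z (by simpa using hz)
    rw [trigCoeff_eq hu (hpoles z h0 hz), Complex.cot_eq_cos_div_sin, sin_eq_mul_sinQuot]
    field_simp
  · rw [dslope_same, (hg 0 (Metric.mem_ball_self hr₀)).deriv]
    simp [sinQuot_zero, deriv_sinQuot_zero]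

theorem trigProfile_isCanonical (hS : S ⊆ b.support) {r₀ : ℝ} (hr₀ : 0 < r₀)
    (hpoles : ∀ z : ℂ, 0 < ‖z‖ → ‖z‖ < r₀ → Complex.sin z ≠ 0) :
    (trigProfile b S).IsCanonical r₀ where
  isOpen_dom α _ := by
    by_cases hα : α ∈ rootsSpannedBy S
    · have : (trigProfile b S).dom α = {u | Complex.sin u ≠ 0} := by
        ext u
        exact ⟨fun h => h hα, fun h _ => h⟩
      rw [this]
      exact isOpen_ne_fun Complex.continuous_sin continuous_const
    · have : (trigProfile b S).dom α = Set.univ := Set.eq_univ_of_forall fun u h => (hα h).elim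
      rw [this]
      exact isOpen_univ
  neg_mem_dom α hα u hu := fun h => by
    rw [Complex.sin_neg]
    exact neg_ne_zero.2 (hu ((neg_mem_rootsSpannedBy_iff hα).1 h))
  exists_a := hasSimplePole_cot hpoles
  a_neg z := by
    change Complex.cot (-z) + -z / 3 = -(Complex.cot z + z / 3)
    rw [Complex.cot_eq_cos_div_sin, Complex.cot_eq_cos_div_sin, Complex.sin_neg, Complex.cos_neg,
      div_neg]
    ring
  exists_φ α _ u hu := hasSimplePole_trigCoeff hr₀ hpoles hu
  φ_neg α hα u z := by
    change trigCoeff b S (-α) (-u) (-z) * Complex.exp (-z * -u / 3) =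
      -(trigCoeff b S α u z * Complex.exp (z * u / 3))
    rw [trigCoeff_neg hα, neg_mul_neg, neg_mul]
  c_neg α hα u := by
    change trigCot b S (-α) (-u) + -u / 3 = -(trigCot b S α u + u / 3)
    rw [trigCot_neg hα]
    ring
  hasDerivAt_φ α _ u hu z h0 hz := by
    have hs := hpoles z h0 hz
    refine (hasDerivAt_trigCoeff_mul_exp_left hu hs).congr_deriv ?_
    change _ = deriv (fun z => trigCoeff b S α u z * Complex.exp (z * u / 3)) z +
      (Complex.cot z + z / 3 - (trigCot b S α u + u / 3)) *
        (trigCoeff b S α u z * Complex.exp (z * u / 3))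
    rw [(hasDerivAt_trigCoeff_mul_exp hu hs).deriv, trigCoeff_eq hu hs]
    ring
  φ_mul_φ_neg α hα u hu z h0 hz := by
    have hs := hpoles z h0 hz
    have hu' : -α ∈ rootsSpannedBy S → Complex.sin (-u) ≠ 0 := fun h => by
      rw [Complex.sin_neg]
      exact neg_ne_zero.2 (hu ((neg_mem_rootsSpannedBy_iff hα).1 h))
    change trigCoeff b S α u z * Complex.exp (z * u / 3) *
      (trigCoeff b S (-α) (-u) z * Complex.exp (z * -u / 3)) =
      -deriv (fun z => Complex.cot z + z / 3) z - trigPotential S α u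
    have he : Complex.exp (z * u / 3) * Complex.exp (z * -u / 3) = 1 := by
      rw [← Complex.exp_add, ← Complex.exp_zero]
      congr 1
      ring
    rw [trigPotential_eq (b := b) hu, deriv_cot_add hs, trigCoeff_eq hu hs, trigCoeff_eq hu' hs, trigCot_neg hα]
    linear_combination (Complex.cot z ^ 2 - trigCot b S α u ^ 2) * he
  φ_add α hα γ hγ β hβ hsum u hu v hv huv z h0 hz := by
    have hs := hpoles z h0 hz
    have key := trigCot_add hS hα hγ hβ hsum hu hv huv
    change deriv (fun z => trigCoeff b S α u z * Complex.exp (z * u / 3)) z *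
        (trigCoeff b S γ v z * Complex.exp (z * v / 3)) -
      trigCoeff b S α u z * Complex.exp (z * u / 3) *
        deriv (fun z => trigCoeff b S γ v z * Complex.exp (z * v / 3)) z -
      (trigCot b S α u + u / 3 - (trigCot b S γ v + v / 3)) *
        (trigCoeff b S α u z * Complex.exp (z * u / 3) *
          (trigCoeff b S γ v z * Complex.exp (z * v / 3))) =
      -((trigPotential S α u - trigPotential S γ v) *
        (trigCoeff b S β (u + v) z * Complex.exp (z * (u + v) / 3)))
    have he : Complex.exp (z * (u + v) / 3) = Complex.exp (z * u / 3) * Complex.exp (z * v / 3) := by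
      rw [← Complex.exp_add]
      congr 1
      ring
    rw [trigPotential_eq (b := b) hu, trigPotential_eq (b := b) hv,
      (hasDerivAt_trigCoeff_mul_exp hu hs).deriv, (hasDerivAt_trigCoeff_mul_exp hv hs).deriv,
      trigCoeff_eq hu hs, trigCoeff_eq hv hs, trigCoeff_eq huv hs, he]
    linear_combination (Complex.exp (z * u / 3) * Complex.exp (z * v / 3)) * key
  constraint_identity a ha α _ _ _ _ _ _ := by
    rw [Set.mem_singleton_iff.1 ha, pair_zero, zero_mul]
  constraint_const a ha α _ _ _ _ := by
    rw [Set.mem_singleton_iff.1 ha, pair_zero, mul_zero, add_zero]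
  mem_constraint q a hq h := by
    refine eq_zero_of_pair_eq_zero fun α hα => ?_
    by_contra hne
    have hu := hq α hα
    obtain ⟨z, h0, hz, hz3⟩ := exists_mul_cot_ne_three hr₀
    have key : ∀ w, 0 < ‖w‖ → ‖w‖ < r₀ / 2 → -(1 + trigCot b S α (pair α q) ^ 2) +
        w / 3 * (Complex.cot w + trigCot b S α (pair α q)) = 0 := by
      intro w hw0 hw
      have hs := hpoles w hw0 (by linarith)
      have h1 := (mul_eq_zero.1 (h α hα (-w) (by rwa [norm_neg]) (by rwa [norm_neg]))).resolve_right
        hne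
      rw [neg_neg] at h1
      have h2 : deriv (fun v => (trigProfile b S).φ α v w) (pair α q) = _ :=
        (hasDerivAt_trigCoeff_mul_exp_left hu hs).deriv
      rw [h1] at h2
      exact (mul_eq_zero.1 h2.symm).resolve_right (Complex.exp_ne_zero _)
    -- Comparing z and −z separates parities: the odd part forces C_α = 0, and then the even part
    -- reads z cot z = 3.
    have k1 := key z h0 hz
    have k2 := key (-z) (by rwa [norm_neg]) (by rwa [norm_neg])
    have hcot : Complex.cot (-z) = -Complex.cot z := by
      rw [Complex.cot_eq_cos_div_sin, Complex.cot_eq_cos_div_sin, Complex.sin_neg, Complex.cos_neg,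
        div_neg]
    rw [hcot] at k2
    have k3 : z * trigCot b S α (pair α q) = 0 := by linear_combination 3 / 2 * (k1 - k2)
    have k4 := (mul_eq_zero.1 k3).resolve_left (norm_pos_iff.1 h0)
    rw [k4] at k1
    exact hz3 (by linear_combination 3 * k1)

theorem trigProfile_realizes (B : CartanWeyl 𝔥) (hS : S ⊆ b.support) :
    (trigProfile b S).Realizes (.trigonometric b S hS) B where
  r_eq q z := by
    classical
    change (Complex.cot z + z / 3) • B.cartanTensor
      + ∑ α ∈ rootsSpannedBy S,
          (Complex.sin (pair α q + z) / (Complex.sin (pair α q) * Complex.sin z)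
            * Complex.exp (z * pair α q / 3)) • B.rootTensor α
      + ∑ α ∈ posRoots b \ rootsSpannedBy S,
          (Complex.exp (-(Complex.I * z)) / Complex.sin z
            * Complex.exp (z * pair α q / 3)) • B.rootTensor α
      + ∑ α ∈ negRoots b \ rootsSpannedBy S,
          (Complex.exp (Complex.I * z) / Complex.sin z
            * Complex.exp (z * pair α q / 3)) • B.rootTensor α =
      (Complex.cot z + z / 3) • B.cartanTensor + ∑ α ∈ 𝔥.root,
        (trigCoeff b S α (pair α q) z * Complex.exp (z * pair α q / 3)) • B.rootTensor α
    have hsub' : posRoots b \ rootsSpannedBy S ⊆ 𝔥.root \ rootsSpannedBy S :=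
      Finset.sdiff_subset_sdiff posRoots_subset le_rfl
    have hneg : (𝔥.root \ rootsSpannedBy S) \ (posRoots b \ rootsSpannedBy S) =
        negRoots b \ rootsSpannedBy S := by
      ext α
      simp only [negRoots, Finset.mem_sdiff]
      tauto
    -- The roots split into Δ(S) and the positive and negative roots outside it, matching the three
    -- cases of `trigCoeff`.
    rw [← Finset.sum_sdiff rootsSpannedBy_subset, ← Finset.sum_sdiff hsub', hneg]
    have e1 : ∀ α ∈ rootsSpannedBy S, trigCoeff b S α (pair α q) z =
        Complex.sin (pair α q + z) / (Complex.sin (pair α q) * Complex.sin z) := fun α hα => by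
      rw [trigCoeff, if_pos hα]
    have e2 : ∀ α ∈ posRoots b \ rootsSpannedBy S, trigCoeff b S α (pair α q) z =
        Complex.exp (-(Complex.I * z)) / Complex.sin z := fun α hα => by
      rw [Finset.mem_sdiff] at hα
      rw [trigCoeff, if_neg hα.2, if_pos hα.1]
    have e3 : ∀ α ∈ negRoots b \ rootsSpannedBy S, trigCoeff b S α (pair α q) z =
        Complex.exp (Complex.I * z) / Complex.sin z := fun α hα => by
      rw [Finset.mem_sdiff, negRoots, Finset.mem_sdiff] at hα
      rw [trigCoeff, if_neg hα.2, if_neg hα.1.2]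
    have key : ∀ (s : Finset (Weight ℂ 𝔥 𝔤)) (f g : Weight ℂ 𝔥 𝔤 → ℂ), (∀ α ∈ s, f α = g α) →
        ∑ α ∈ s, (f α * Complex.exp (z * pair α q / 3)) • B.rootTensor α =
          ∑ α ∈ s, (g α * Complex.exp (z * pair α q / 3)) • B.rootTensor α :=
      fun s f g h => Finset.sum_congr rfl fun α hα => by rw [h α hα]
    rw [key _ _ _ e1, key _ _ _ e2, key _ _ _ e3]
    abel
  ham_eq x := by
    classical
    obtain ⟨q, p, ξ⟩ := x
    change B.kinetic p
      - 1 / 2 * ∑ α ∈ rootsSpannedBy S,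
          (1 / Complex.sin (pair α q) ^ 2 - 1 / 3) * (B.spin ξ α * B.spin ξ (-α))
      + 1 / 6 * ∑ α ∈ 𝔥.root \ rootsSpannedBy S, B.spin ξ α * B.spin ξ (-α) =
      B.kinetic p - 1 / 2 * ∑ α ∈ 𝔥.root,
        trigPotential S α (pair α q) * (B.spin ξ α * B.spin ξ (-α))
    have e1 : ∑ α ∈ rootsSpannedBy S, trigPotential S α (pair α q) *
        (B.spin ξ α * B.spin ξ (-α)) = ∑ α ∈ rootsSpannedBy S,
          (1 / Complex.sin (pair α q) ^ 2 - 1 / 3) * (B.spin ξ α * B.spin ξ (-α)) :=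
      Finset.sum_congr rfl fun α hα => by rw [trigPotential, if_pos hα]
    have e2 : ∑ α ∈ 𝔥.root \ rootsSpannedBy S, trigPotential S α (pair α q) *
        (B.spin ξ α * B.spin ξ (-α)) = -1 / 3 * ∑ α ∈ 𝔥.root \ rootsSpannedBy S,
          B.spin ξ α * B.spin ξ (-α) := by
      rw [Finset.mul_sum]
      exact Finset.sum_congr rfl fun α hα => by
        rw [trigPotential, if_neg (Finset.mem_sdiff.1 hα).2]
    rw [← Finset.sum_sdiff rootsSpannedBy_subset, e1, e2]
    ring
  regular_iff q := ⟨fun h α _ hα => h α hα, fun h α hα =>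
    h α (rootsSpannedBy_subset hα) hα⟩
  constraint_eq := rfl

end Trigonometric

/-! ### The three families as canonical profiles, and the theorem -/

theorem Model.exists_profile {𝔤 : Type*} [LieRing 𝔤] [LieAlgebra ℂ 𝔤] [FiniteDimensional ℂ 𝔤]
    [LieAlgebra.IsKilling ℂ 𝔤] {𝔥 : LieSubalgebra ℂ 𝔤} [𝔥.IsCartanSubalgebra] (m : Model 𝔥)
    (B : CartanWeyl 𝔥) {r₀ : ℝ} (hr₀ : 0 < r₀)
    (hpoles : ∀ z : ℂ, 0 < ‖z‖ → ‖z‖ < r₀ → z ∉ m.poles) :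
    ∃ P : Profile 𝔥, P.IsCanonical r₀ ∧ P.Realizes m B := by
  cases m with
  | rational Δ' hsub hneg hadd =>
    exact ⟨_, ratProfile_isCanonical hneg hsub hadd hr₀, ratProfile_realizes B hsub hneg hadd⟩
  | trigonometric b S hS =>
    exact ⟨_, trigProfile_isCanonical hS hr₀ hpoles, trigProfile_realizes B hS⟩
  | elliptic Λ =>
    exact ⟨_, ellProfile_isCanonical Λ 𝔥 hr₀ hpoles, ellProfile_realizes Λ 𝔥 B⟩

end

end SpinCM

theorem theoremB {𝔤 : Type*} [LieRing 𝔤] [LieAlgebra ℂ 𝔤] [FiniteDimensional ℂ 𝔤]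
    [LieAlgebra.IsSimple ℂ 𝔤] (𝔥 : LieSubalgebra ℂ 𝔤) [𝔥.IsCartanSubalgebra]
    (B : SpinCM.CartanWeyl 𝔥) (m : SpinCM.Model 𝔥)
    (r₀ : ℝ) (hr₀ : 0 < r₀) (hpoles : ∀ z : ℂ, 0 < ‖z‖ → ‖z‖ < r₀ → z ∉ m.poles) :
    -- the objects are well defined: `H` is differentiable, `M` is a loop, `R` exists
    (∀ x ∈ m.phaseSpace, SpinCM.IsDiffAt (m.ham B) x) ∧
    (∀ x ∈ m.phaseSpace, SpinCM.IsLoop (m.laxM B x) r₀) ∧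
    (∀ q ∈ m.regular, ∀ (ρ : ℝ) (X : ℂ → Module.Dual ℂ 𝔤), SpinCM.IsLoop X ρ →
      ∀ z : ℂ, 0 < ‖z‖ → ‖z‖ < ρ → ‖z‖ < r₀ / 2 →
        SpinCM.HasPV (m.kernelR B q X z) z (m.R B q X z)) ∧
    -- `H` is the pull-back by `L` of `X ↦ ½ ∮ (X(z), X(z)) dz / (2πi z)`
    (∀ x ∈ m.phaseSpace, ∀ ρ : ℝ, 0 < ρ → ρ < r₀ →
      m.ham B x = 1 / 2 * ((2 * (Real.pi : ℂ) * Complex.I)⁻¹ *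
        ∮ z in C(0, ρ), killingForm ℂ 𝔤 (m.lax B x z) (m.lax B x z) / z)) ∧
    -- the torus action is canonical, i.e. by Poisson maps
    (∀ (g : SpinCM.cartanTorus 𝔥) (F G : SpinCM.Phase 𝔥 → ℂ) (x : SpinCM.Phase 𝔥),
      SpinCM.IsDiffAt F (SpinCM.act g x) → SpinCM.IsDiffAt G (SpinCM.act g x) →
        SpinCM.poisson (fun y => F (SpinCM.act g y)) (fun y => G (SpinCM.act g y)) x =
          SpinCM.poisson F G (SpinCM.act g x)) ∧
    -- the Hamiltonian is invariant
    (∀ (g : SpinCM.cartanTorus 𝔥) (x : SpinCM.Phase 𝔥), m.ham B (SpinCM.act g x) = m.ham B x) ∧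
    -- `J` is an (equivariant) momentum map of the action
    (∀ (h : 𝔥) (x : SpinCM.Phase 𝔥) (F : Module.Dual ℂ (SpinCM.Phase 𝔥)),
      HasDerivAt (fun s : ℂ => F (SpinCM.act (SpinCM.torusExp (s • h)) x))
        (SpinCM.poisson F (fun y => SpinCM.J y h) x) 0) ∧
    (∀ (g : SpinCM.cartanTorus 𝔥) (x : SpinCM.Phase 𝔥),
      SpinCM.J (SpinCM.act g x) = SpinCM.J x) ∧
    -- description of `Σ`
    m.sigmaSet B r₀ = {x | x ∈ m.phaseSpace ∧ SpinCM.J x ∈ m.momentumConstraint} ∧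
    -- `Σ` is invariant under the dynamics, and the Lax equation holds on `Σ`
    (∀ (I : Set ℝ) (γ : ℝ → SpinCM.Phase 𝔥), IsOpen I → IsPreconnected I →
      (∀ t ∈ I, γ t ∈ m.phaseSpace) → SpinCM.IsTrajectory (m.ham B) γ I →
        (∀ t₀ ∈ I, γ t₀ ∈ m.sigmaSet B r₀ → ∀ t ∈ I, γ t ∈ m.sigmaSet B r₀) ∧
        (∀ t ∈ I, γ t ∈ m.sigmaSet B r₀ → ∀ z : ℂ, 0 < ‖z‖ → ‖z‖ < r₀ / 2 →
          SpinCM.HasVelocityAt (fun s : ℝ => m.lax B (γ s) z)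
            ⁅m.R B (γ t).1 (m.laxM B (γ t)) z, m.lax B (γ t) z⁆ t)) := by
  obtain ⟨P, hP, hm⟩ := SpinCM.Model.exists_profile m B hr₀ hpoles
  refine ⟨fun x hx => SpinCM.Profile.isDiffAt_ham hP hm hr₀ hx,
    fun x hx => SpinCM.Profile.isLoop_laxM hP hm hx,
    fun q hq ρ X hX z h0 hρ hz => SpinCM.Profile.exists_hasPV hP hm hq hX h0 hρ hz,
    fun x hx ρ h0 hρ => SpinCM.Profile.ham_eq_circleIntegral hP hm hx h0 hρ,
    fun g F G x hF hG => SpinCM.poisson_act B g F G x hF hG,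
    fun g x => SpinCM.Profile.ham_act hm g x,
    fun h x F => SpinCM.hasDerivAt_act_torusExp B h x F,
    fun g x => SpinCM.J_act B g x,
    SpinCM.Profile.sigmaSet_eq hP hm, fun I γ hI hI' hγ htraj => ?_⟩
  rw [SpinCM.Profile.sigmaSet_eq hP hm]
  refine ⟨fun t₀ ht₀ h t ht => ⟨hγ t ht, ?_⟩, fun t ht h z h0 hz => ?_⟩
  · rw [SpinCM.Profile.J_eq_of_isTrajectory hP hm hr₀ hI hI' hγ htraj ht₀ ht]
    exact h.2
  · exact SpinCM.Profile.hasVelocityAt_lax hP hm hr₀ hγ htraj ht (hm.constraint_eq ▸ h.2) h0 hz
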